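/- Let $m,n\in\mathbb N$, $\gamma\in(0,1]$, $N=\lfloor 1/\gamma\rfloor$, $p\in(1,\infty)$, $\alpha=1/(p-1)$, $\eta\in\mathbb R$ and $q\ge -1$ satisfy $$\gamma/\alpha+\gamma-q(1-\gamma)-\eta>0 .$$ Then there exists $C>0$, depending only on $m,n,\gamma,p,\eta,q$, such that the following holds. Let $f\in C^N(\mathbb R^m,L(\mathbb R^n,\mathbb R^m))$ with $$\|f\|_{\eta,q}:=\max_{0\le \ell\le N}\ \sup_{x\in\mathbb R^m}\frac{|D^\ell f(x)|}{(|x|+1)^{\eta+\ell q}}<\infty ,$$ and let $\mathbf X=(\mathbf X^\tau)$ be an $n$-dimensional $\gamma$-Hölder branched rough path on $[-1,0]$: a family of continuous functions $\mathbf X^\tau\colon[-1,0]^2\to\mathbb R$, indexed by the unordered rooted forests $\tau$ with vertex labels in $\{1,\dots,n\}$ and number of vertices $|\tau|\le N$, which is multiplicative ($\mathbf X^{\mathbf 1}\equiv 1$ for the empty forest $\mathbf 1$, and $\mathbf X^{\sigma\tau}=\mathbf X^\sigma\mathbf X^\tau$), satisfies Chen's relation with respect to the Connes–Kreimer coproduct,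 and has $\sup_{s\ne t}|\mathbf X^\tau_{s,t}|/|t-s|^{\gamma|\tau|}<\infty$. For $I\subset[-1,0]$ put $$|||\mathbf X|||_I=\max_{1\le|\tau|\le N}\Big(\sup_{s\neq t\in I}\frac{|\mathbf X^\tau_{s,t}|}{|t-s|^{\gamma|\tau|}}\Big)^{1/|\tau|}.$$ Let $\phi\colon[-1,0]\to\mathbb R^m$ solve $\mathrm d\phi_t=-|\phi_t|^{p-1}\phi_t\,\mathrm dt+f(\phi_t)\,\mathrm d\mathbf X_t$ in the sense that, uniformly over $-1\le s<t\le 0$, $$\phi_t-\phi_s=-|\phi_s|^{p-1}\phi_s\,(t-s)+\sum_{0\le|\tau|\le N-1}\frac{1}{\sigma([\tau])}\,f^\tau(\phi_s)\,\mathbf X^{[\tau]}_{s,t}+o(|t-s|).$$ Here, for $\tau=[\sigma_1]_{i_1}\cdots[\sigma_\ell]_{i_\ell}$ (with $[\sigma]_i$ the tree obtained by attaching a root labelled $i$ to the forest $\sigma$), $f^\tau=(D^\ell f)(f^{\sigma_1}_{i_1},\dots,f^{\sigma_\ell}_{i_\ell})$ with $f^{\mathbf 1}=f$ and $f^\sigma_i$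 the $i$-th component of $f^\sigma$; $\mathbf X^{[\tau]}$ is the $\mathbb R^n$-valued function with components $\mathbf X^{[\tau]_i}$, and $\sigma([\tau])$ is the number of automorphisms of $[\tau]$ (which does not depend on the label of its root). Then, for all $z\in(-1,0]$, $$|\phi_z|\le C\Big(\big(\|f\|_{\eta,q}\,|||\mathbf X|||_{[z-\lambda_z,z]}\big)^{\frac1{\gamma+\gamma/\alpha-q(1-\gamma)-\eta}}+|z+1|^{-\alpha}\Big),\qquad \lambda_z=\big(C|\phi_z|^{-1/\alpha}\big)\wedge\tfrac12|z+1| ,$$ where $|\phi_z|^{-1/\alpha}=\infty$ if $\phi_z=0$. -/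

import Mathlib

open scoped ENNReal

namespace BranchedRDE

/-- Ordered (plane) rooted forests with vertices labelled by `Fin n`. The empty forest is `nil`, and
`cons i σ τ` is the forest `[σ]_i · τ`: its first tree has a root labelled `i` to which the trees of
`σ` are attached, and the remaining trees are those of `τ`. -/
inductive PlaneForest (n : ℕ) : Type
  | nil : PlaneForest n
  | cons (i : Fin n) (σ τ : PlaneForest n) : PlaneForest n

namespace PlaneForest

variable {n : ℕ}

/-- The number `|τ|` of vertices. -/
def card : PlaneForest n → ℕ
  | nil => 0
  | cons _ σ τ => card σ + 1 + card τ

/-- The number of trees of a forest. -/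
def width : PlaneForest n → ℕ
  | nil => 0
  | cons _ _ τ => width τ + 1

/-- The product over all vertices `v` of `(number of children of v)!`. -/
def childrenFactorial : PlaneForest n → ℕ
  | nil => 1
  | cons _ σ τ => (width σ).factorial * childrenFactorial σ * childrenFactorial τ

/-- Juxtaposition of forests. -/
def mul : PlaneForest n → PlaneForest n → PlaneForest n
  | nil, ρ => ρ
  | cons i σ τ, ρ => cons i σ (mul τ ρ)

/-- The tree `[τ]_i`: a root labelled `i` is attached below the forest `τ`. -/
def graft (i : Fin n) (τ : PlaneForest n) : PlaneForest n := cons i τ nil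

/-- The Connes-Kreimer coproduct, as the list (with multiplicity) of its terms
`(pruned branches, trunk)`. It is given by `Δ 1 = 1 ⊗ 1`, multiplicativity and
`Δ [σ]_i = [σ]_i ⊗ 1 + (id ⊗ [·]_i) Δ σ`. -/
def coproduct : PlaneForest n → List (PlaneForest n × PlaneForest n)
  | nil => [(nil, nil)]
  | cons i σ τ => (coproduct τ).flatMap fun d =>
      (cons i σ d.1, d.2) :: (coproduct σ).map fun c => (mul c.1 d.1, cons i c.2 d.2)

/-- Two plane forests are isomorphic if they differ only by reordering the trees and,
at each vertex, the branches: they represent the same combinatorial forest. -/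
inductive Iso : PlaneForest n → PlaneForest n → Prop
  | nil : Iso nil nil
  | cons (i : Fin n) {σ σ' τ τ' : PlaneForest n} :
      Iso σ σ' → Iso τ τ' → Iso (cons i σ τ) (cons i σ' τ')
  | swap (i j : Fin n) (ρ σ τ : PlaneForest n) :
      Iso (cons i ρ (cons j σ τ)) (cons j σ (cons i ρ τ))
  | trans {ρ σ τ : PlaneForest n} : Iso ρ σ → Iso σ τ → Iso ρ τ

theorem Iso.refl (τ : PlaneForest n) : Iso τ τ := by
  induction τ with
  | nil => exact Iso.nil
  | cons i σ τ h₁ h₂ => exact Iso.cons i h₁ h₂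

theorem Iso.symm {σ τ : PlaneForest n} (h : Iso σ τ) : Iso τ σ := by
  induction h with
  | nil => exact Iso.nil
  | cons i _ _ h₁ h₂ => exact Iso.cons i h₁ h₂
  | swap i j ρ σ τ => exact Iso.swap j i σ ρ τ
  | trans _ _ h₁ h₂ => exact Iso.trans h₂ h₁

instance isoSetoid (n : ℕ) : Setoid (PlaneForest n) :=
  ⟨Iso, Iso.refl, Iso.symm, Iso.trans⟩

theorem finite_card_lt (n N : ℕ) : {τ : PlaneForest n | τ.card < N}.Finite := by
  induction N with
  | zero => simp
  | succ N ih =>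
    refine (((Set.finite_univ (α := Fin n)).prod (ih.prod ih)).image
      (fun x => cons x.1 x.2.1 x.2.2) |>.insert nil).subset ?_
    intro τ hτ
    cases τ with
    | nil => exact Set.mem_insert _ _
    | cons i σ τ =>
      refine Set.mem_insert_of_mem _ ⟨(i, σ, τ), ?_, rfl⟩
      simp only [Set.mem_ofPred_eq, card] at hτ
      refine ⟨Set.mem_univ _, ?_, ?_⟩ <;> simp only [Set.mem_ofPred_eq] <;> omega

/-- The finite set of plane forests with fewer than `N` vertices. -/
noncomputable def lowOrder (n N : ℕ) : Finset (PlaneForest n) := (finite_card_lt n N).toFinset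

end PlaneForest

/-- Labelled rooted (combinatorial, i.e. unordered) forests. -/
def Forest (n : ℕ) : Type := Quotient (PlaneForest.isoSetoid n)

/-- The combinatorial forest underlying a plane forest. -/
def PlaneForest.toForest {n : ℕ} (τ : PlaneForest n) : Forest n :=
  Quotient.mk (PlaneForest.isoSetoid n) τ

/-- `sup` of `|x_{s,t}| / |t - s| ^ β` over `s ≠ t` in `I`. -/
noncomputable def holderNorm (β : ℝ) (I : Set ℝ) (x : ℝ → ℝ → ℝ) : ℝ≥0∞ :=
  ⨆ s ∈ I, ⨆ t ∈ I, ⨆ _ : s ≠ t, ENNReal.ofReal (|x s t| / |t - s| ^ β)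

/-- The number `N = ⌊1/γ⌋` of levels of a `γ`-Hölder branched rough path. -/
noncomputable def level (γ : ℝ) : ℕ := ⌊1 / γ⌋₊

/-- A `γ`-Hölder branched rough path over `ℝⁿ` on `[-1, 0]`. Only the components with at most
`⌊1/γ⌋` vertices, at times in `[-1, 0]`, carry information. -/
structure BranchedRoughPath (n : ℕ) (γ : ℝ) where
  toFun : Forest n → ℝ → ℝ → ℝ
  continuousOn : ∀ τ : PlaneForest n, τ.card ≤ level γ →
    ContinuousOn (fun x : ℝ × ℝ => toFun τ.toForest x.1 x.2)
      (Set.Icc (-1) 0 ×ˢ Set.Icc (-1) 0)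
  map_one : ∀ s ∈ Set.Icc (-1 : ℝ) 0, ∀ t ∈ Set.Icc (-1 : ℝ) 0,
    toFun (PlaneForest.nil : PlaneForest n).toForest s t = 1
  map_mul : ∀ σ τ : PlaneForest n, σ.card + τ.card ≤ level γ →
    ∀ s ∈ Set.Icc (-1 : ℝ) 0, ∀ t ∈ Set.Icc (-1 : ℝ) 0,
      toFun (σ.mul τ).toForest s t = toFun σ.toForest s t * toFun τ.toForest s t
  chen : ∀ τ : PlaneForest n, τ.card ≤ level γ →
    ∀ s ∈ Set.Icc (-1 : ℝ) 0, ∀ u ∈ Set.Icc (-1 : ℝ) 0, ∀ t ∈ Set.Icc (-1 : ℝ) 0,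
      toFun τ.toForest s t =
        (τ.coproduct.map fun c => toFun c.1.toForest s u * toFun c.2.toForest u t).sum
  holder : ∀ τ : PlaneForest n, τ.card ≤ level γ →
    holderNorm (γ * τ.card) (Set.Icc (-1) 0) (toFun τ.toForest) < ∞

/-- The homogeneous norm: the maximum over `1 ≤ |τ| ≤ N` of `‖X^τ‖_I ^ (1/|τ|)`. -/
noncomputable def BranchedRoughPath.homNorm {n : ℕ} {γ : ℝ} (X : BranchedRoughPath n γ)
    (I : Set ℝ) : ℝ≥0∞ :=
  ⨆ τ : PlaneForest n, ⨆ _ : 1 ≤ τ.card ∧ τ.card ≤ level γ,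
    holderNorm (γ * τ.card) I (X.toFun τ.toForest) ^ (1 / (τ.card : ℝ))

/-- The `ℝⁿ`-valued object `X^{[τ]}_{s,t}`, with `i`-th component `X^{[τ]_i}_{s,t}`. -/
noncomputable def BranchedRoughPath.graftVec {n : ℕ} {γ : ℝ} (X : BranchedRoughPath n γ)
    (τ : PlaneForest n) (s t : ℝ) : EuclideanSpace ℝ (Fin n) :=
  WithLp.toLp 2 fun i => X.toFun (τ.graft i).toForest s t

section

variable {m n : ℕ}

/-- For `τ = [σ₁]_{i₁} ⋯ [σ_ℓ]_{i_ℓ}`, the list of the vectors `f^{σ_j}_{i_j}(x)`. -/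
noncomputable def branchVectors
    (f : EuclideanSpace ℝ (Fin m) → EuclideanSpace ℝ (Fin n) →L[ℝ] EuclideanSpace ℝ (Fin m))
    (x : EuclideanSpace ℝ (Fin m)) : PlaneForest n → List (EuclideanSpace ℝ (Fin m))
  | .nil => []
  | .cons i σ τ =>
      iteratedFDeriv ℝ (branchVectors f x σ).length f x (branchVectors f x σ).get
        (EuclideanSpace.single i 1) :: branchVectors f x τ

/-- The Butcher elementary differential `f^τ`: `f^1 = f`, and
`f^τ = (D^ℓ f)(f^{σ₁}_{i₁}, …, f^{σ_ℓ}_{i_ℓ})` for `τ = [σ₁]_{i₁} ⋯ [σ_ℓ]_{i_ℓ}`. -/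
noncomputable def elemDiff
    (f : EuclideanSpace ℝ (Fin m) → EuclideanSpace ℝ (Fin n) →L[ℝ] EuclideanSpace ℝ (Fin m))
    (τ : PlaneForest n) (x : EuclideanSpace ℝ (Fin m)) :
    EuclideanSpace ℝ (Fin n) →L[ℝ] EuclideanSpace ℝ (Fin m) :=
  iteratedFDeriv ℝ (branchVectors f x τ).length f x (branchVectors f x τ).get

/-- The increment `∑_{|τ| ≤ N-1} f^τ(x) X^{[τ]}_{s,t} / σ([τ])` of the Euler scheme, where the sum is
over combinatorial forests and `σ([τ])` is the symmetry factor (the number of automorphisms) of the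
tree `[τ]`. It is written as a sum over plane forests with weight `∏_v 1 / (children of v)!`,
the product being over the vertices `v` of `[τ]`: the plane representatives of a combinatorial
forest `τ` number `∏_v (children of v)! / σ([τ])`, and they have equal terms. -/
noncomputable def eulerIncrement {γ : ℝ}
    (f : EuclideanSpace ℝ (Fin m) → EuclideanSpace ℝ (Fin n) →L[ℝ] EuclideanSpace ℝ (Fin m))
    (X : BranchedRoughPath n γ) (x : EuclideanSpace ℝ (Fin m)) (s t : ℝ) :
    EuclideanSpace ℝ (Fin m) :=
  ∑ τ ∈ PlaneForest.lowOrder n (level γ),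
    (1 / ((τ.width.factorial * τ.childrenFactorial : ℕ) : ℝ)) • elemDiff f τ x (X.graftVec τ s t)

/-- `φ` solves `dφ = -|φ|^{p-1} φ dt + f(φ) dX` on `[-1, 0]`, in the sense of Davie:
`φ_t - φ_s = -|φ_s|^{p-1} φ_s (t-s) + ∑_{|τ| ≤ N-1} f^τ(φ_s) X^{[τ]}_{s,t} / σ([τ]) + o(|t-s|)`,
uniformly in `s < t`. -/
def IsSolution {γ : ℝ} (p : ℝ)
    (f : EuclideanSpace ℝ (Fin m) → EuclideanSpace ℝ (Fin n) →L[ℝ] EuclideanSpace ℝ (Fin m))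
    (X : BranchedRoughPath n γ) (φ : ℝ → EuclideanSpace ℝ (Fin m)) : Prop :=
  ∀ ε > 0, ∃ δ > 0, ∀ s t : ℝ, -1 ≤ s → s < t → t ≤ 0 → t - s ≤ δ →
    ‖φ t - φ s - (-((t - s) • ‖φ s‖ ^ (p - 1) • φ s) + eulerIncrement f X (φ s) s t)‖
      ≤ ε * (t - s)

/-- `‖f‖_{η,q}`, the maximum over `0 ≤ ℓ ≤ N` of the supremum of
`|D^ℓ f(x)| / (|x| + 1)^{η + ℓ q}`. -/
noncomputable def weightedNorm (N : ℕ) (η q : ℝ)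
    (f : EuclideanSpace ℝ (Fin m) → EuclideanSpace ℝ (Fin n) →L[ℝ] EuclideanSpace ℝ (Fin m)) :
    ℝ≥0∞ :=
  ⨆ ℓ ∈ Finset.range (N + 1), ⨆ x : EuclideanSpace ℝ (Fin m),
    ENNReal.ofReal (‖iteratedFDeriv ℝ ℓ f x‖ / (‖x‖ + 1) ^ (η + ℓ * q))

end

/-- `(C |y|^{-1/α}) ∧ (|z+1|/2)`, where `|y|^{-1/α} = ∞` for `y = 0`. -/
noncomputable def localScale {m : ℕ} (C α z : ℝ) (y : EuclideanSpace ℝ (Fin m)) : ℝ :=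
  open Classical in
  if y = 0 then |z + 1| / 2 else min (C * ‖y‖ ^ (-(1 / α))) (|z + 1| / 2)

end BranchedRDE

/-!
The statement is a comparison of the noise with the damping at the right scale. Where `|φ|` is of
size `L ≥ 1`, measure lengths in units of `L ^ -q`, on which `f` varies, and time in units of
`L ^ -(p + q)`, in which the damping covers one unit of length (`localBounds_damping`). In these
units the rough driver has size `‖f‖ · |||X||| · L ^ -δ`, where `δ = γ + γ / α - q (1 - γ) - η` is
the quantity assumed to be positive. So if the asserted bound fails at `z`, with a large constant,
the noise is small compared with the damping at all times before `z` in the window considered at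
which `|φ| ≥ |φ z| / 2`; during one unit of time `|φ|` then decreases by at least half of what the
damping alone would achieve (`exists_step_bound`). Hence `|φ|` cannot have been below `|φ z| / 2`
in the window, and `|φ| ^ -(p - 1)` has grown at least linearly throughout, so that the window is
shorter than a multiple of `|φ z| ^ -(p - 1)` (`length_le_of_damped`). The window in the statement
is longer than that.

The estimate over one unit of time is Davie's: the additivity defect of the Euler scheme is of order
larger than one in time, and a bisection of the time interval turns this into a bound for the
remainder of a solution (`exists_sewing_bound`, `exists_local_bound`). For the defect one needs that
`w(ρ) f^ρ`, at a point reached from `x` by one step of the scheme, is given up to an error of the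
expected order by `∑_τ w(τ) f^τ(x) ∑ Y`, the inner sum being over the pruned parts of the cuts of
`τ` with trunk `ρ`; by Chen's relation these are the terms that occur in the defect
(`eulerIncrement_sub`). The number of plane representatives of a forest makes the weights `w`
multiplicative over the branches, so the expansion follows from Taylor's formula by a recursion over
plane forests without any symmetry factors (`sum_box_cutSum`, `exists_expansion_bound`). Products of
expansions produce forests with more vertices than the rough path sees; its increments are
therefore extended to a character of all plane forests, under which those terms are part of the
error.
-/

namespace BranchedRDE

/-! ### Iterated derivatives evaluated on lists of vectors -/

section IterD

theorem get_cons_eq_cons {α : Type*} (v : α) (l : List α) :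
    (v :: l).get = (Fin.cons v l.get : Fin (l.length + 1) → α) := by
  funext i
  refine Fin.cases ?_ (fun j => ?_) i <;> rfl

variable {E F : Type*} [NormedAddCommGroup E] [NormedSpace ℝ E]
  [NormedAddCommGroup F] [NormedSpace ℝ F]

/-- The derivative `D^ℓ f(x)(v₁, …, v_ℓ)` for a list of directions `[v₁, …, v_ℓ]`. -/
noncomputable def iterD (f : E → F) (x : E) (l : List E) : F :=
  iteratedFDeriv ℝ l.length f x l.get

theorem iterD_cons (f : E → F) (x v : E) (l : List E) :
    iterD f x (v :: l) = iteratedFDeriv ℝ (l.length + 1) f x (Fin.cons v l.get) := by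
  rw [← get_cons_eq_cons]; rfl

/-- `D^ℓ f(x)` as a linear map in its first argument. -/
noncomputable def iterDLin (f : E → F) (x : E) (l : List E) : E →ₗ[ℝ] F where
  toFun v := iterD f x (v :: l)
  map_add' v w := by
    simp only [iterD_cons]
    exact ContinuousMultilinearMap.cons_add _ _ _ _
  map_smul' c v := by
    simp only [iterD_cons]
    exact ContinuousMultilinearMap.cons_smul _ _ _ _

theorem norm_iterD_le (f : E → F) (x : E) (l : List E) :
    ‖iterD f x l‖ ≤ ‖iteratedFDeriv ℝ l.length f x‖ * (l.map fun v => ‖v‖).prod := by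
  refine ((iteratedFDeriv ℝ l.length f x).le_opNorm _).trans (le_of_eq ?_)
  congr 1
  rw [← List.prod_ofFn]
  congr 1
  conv_rhs => rw [← List.ofFn_get l, List.map_ofFn]
  rfl

variable {f : E → F} {N : ℕ}

theorem hasFDerivAt_iteratedFDeriv (hf : ContDiff ℝ N f) {l : List E} (hl : l.length < N)
    (x : E) : HasFDerivAt (fun y => iterD f y l)
      ((ContinuousMultilinearMap.apply ℝ (fun _ : Fin l.length => E) F l.get).comp
        (fderiv ℝ (iteratedFDeriv ℝ l.length f) x)) x := by
  have h : DifferentiableAt ℝ (iteratedFDeriv ℝ l.length f) x :=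
    hf.differentiable_iteratedFDeriv (mod_cast hl) x
  exact (ContinuousMultilinearMap.apply ℝ (fun _ : Fin l.length => E) F l.get).hasFDerivAt.comp x
    h.hasFDerivAt

theorem fderiv_iterD (hf : ContDiff ℝ N f) {l : List E} (hl : l.length < N) (x v : E) :
    fderiv ℝ (fun y => iterD f y l) x v = iterD f x (v :: l) := by
  rw [(hasFDerivAt_iteratedFDeriv hf hl x).fderiv, iterD_cons, iteratedFDeriv_succ_apply_left]
  simp

theorem differentiableAt_iterD (hf : ContDiff ℝ N f) {l : List E} (hl : l.length < N) (x : E) :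
    DifferentiableAt ℝ (fun y => iterD f y l) x :=
  (hasFDerivAt_iteratedFDeriv hf hl x).differentiableAt

theorem hasDerivAt_iterD (hf : ContDiff ℝ N f) {l : List E} (hl : l.length < N) (x v : E) (t : ℝ) :
    HasDerivAt (fun t : ℝ => iterD f (x + t • v) l) (iterD f (x + t • v) (v :: l)) t := by
  have h1 := (differentiableAt_iterD hf hl (x + t • v)).hasFDerivAt
  have h2 : HasDerivAt (fun t : ℝ => x + t • v) v t := by
    simpa using ((hasDerivAt_id t).smul_const v).const_add x
  have := h1.comp_hasDerivAt t h2
  rwa [fderiv_iterD hf hl] at this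

theorem contDiff_iterD (hf : ContDiff ℝ N f) {l : List E} {k : ℕ} (hl : l.length + k ≤ N) :
    ContDiff ℝ k (fun y => iterD f y l) := by
  have h : ContDiff ℝ k (iteratedFDeriv ℝ l.length f) :=
    hf.iteratedFDeriv_right (by rw [add_comm]; exact_mod_cast hl)
  exact (ContinuousMultilinearMap.apply ℝ (fun _ : Fin l.length => E) F l.get).contDiff.comp h

/-- The derivatives of a `C^N` function up to order `N` are symmetric: in a list of directions two
neighbours may be exchanged by the symmetry of second derivatives, and an identity between
derivatives may be differentiated in a further direction. -/
theorem iterD_perm (hf : ContDiff ℝ N f) {l l' : List E} (h : l.Perm l') (hl : l.length ≤ N)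
    (x : E) : iterD f x l = iterD f x l' := by
  induction h generalizing x with
  | nil => rfl
  | @cons v l₁ l₂ h ih =>
    have h₁ : l₁.length < N := by simpa using hl
    have h₂ : l₂.length < N := by rwa [← h.length_eq]
    rw [← fderiv_iterD hf h₁, ← fderiv_iterD hf h₂]
    congr 2
    funext y
    exact ih h₁.le y
  | swap v w l =>
    have h₁ : l.length + 2 ≤ N := by simp only [List.length_cons] at hl; omega
    have hv : (v :: l).length < N := by simp; omega
    have hw : (w :: l).length < N := by simp; omega
    have hsymm : IsSymmSndFDerivAt ℝ (fun y => iterD f y l) x :=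
      (contDiff_iterD hf h₁).contDiffAt.isSymmSndFDerivAt (by simp)
    have hd : DifferentiableAt ℝ (fderiv ℝ (fun y => iterD f y l)) x :=
      ((contDiff_iterD hf h₁).fderiv_right (m := 1) (by norm_num)).differentiable
        (by norm_num) x
    rw [← fderiv_iterD hf hv, ← fderiv_iterD hf hw]
    have key : ∀ u u' : E, fderiv ℝ (fun y => iterD f y (u :: l)) x u'
        = fderiv ℝ (fderiv ℝ (fun y => iterD f y l)) x u' u := by
      intro u u'
      have : (fun y => iterD f y (u :: l)) = fun y => fderiv ℝ (fun y => iterD f y l) y u := by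
        funext y
        rw [fderiv_iterD hf (by omega)]
      rw [this, fderiv_clm_apply hd (differentiableAt_const u)]
      simp
    rw [key, key]
    exact hsymm w v
  | trans h₁ h₂ ih₁ ih₂ =>
    rw [ih₁ hl, ih₂ (h₁.length_eq ▸ hl)]

/-- Taylor's formula for a chain of functions, each the derivative of the preceding one. -/
theorem norm_taylor_chain_le (K : ℕ) {B : ℝ} (g : ℕ → ℝ → F)
    (hg : ∀ j < K, ∀ t ∈ Set.Icc (0 : ℝ) 1, HasDerivAt (g j) (g (j + 1) t) t)
    (hB : ∀ t ∈ Set.Icc (0 : ℝ) 1, ‖g K t‖ ≤ B) :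
    ∀ t ∈ Set.Icc (0 : ℝ) 1,
      ‖g 0 t - ∑ j ∈ Finset.range K, (t ^ j / (j.factorial : ℝ)) • g j 0‖ ≤ B := by
  induction K generalizing g with
  | zero => simpa using hB
  | succ K ih =>
    intro t ht
    have hB0 : 0 ≤ B := (norm_nonneg _).trans (hB 0 (by simp))
    have ih' := ih (fun j => g (j + 1)) (fun j hj s hs => hg (j + 1) (by omega) s hs) hB
    have hd : ∀ s ∈ Set.Icc (0 : ℝ) 1, HasDerivWithinAt
        (fun t => g 0 t - ∑ j ∈ Finset.range (K + 1), (t ^ j / (j.factorial : ℝ)) • g j 0)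
        (g 1 s - ∑ j ∈ Finset.range K, (s ^ j / (j.factorial : ℝ)) • g (j + 1) 0)
        (Set.Icc 0 1) s := by
      intro s hs
      refine HasDerivAt.hasDerivWithinAt (HasDerivAt.sub (hg 0 (by omega) s hs) ?_)
      simp only [Finset.sum_range_succ']
      have : HasDerivAt (fun t : ℝ => ∑ j ∈ Finset.range K,
          (t ^ (j + 1) / ((j + 1).factorial : ℝ)) • g (j + 1) 0)
          (∑ j ∈ Finset.range K, (s ^ j / (j.factorial : ℝ)) • g (j + 1) 0) s := by
        refine HasDerivAt.fun_sum fun j _ => ?_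
        refine HasDerivAt.smul_const ?_ _
        have h := (hasDerivAt_pow (j + 1) s).div_const ((j + 1).factorial : ℝ)
        convert! h using 1
        rw [Nat.factorial_succ]
        push_cast
        have h1 : (j : ℝ) + 1 ≠ 0 := by positivity
        have h2 : (j.factorial : ℝ) ≠ 0 := by positivity
        field_simp
      simpa using this.add_const (g 0 0)
    have := (convex_Icc (0 : ℝ) 1).norm_image_sub_le_of_norm_hasDerivWithin_le hd
      (fun s hs => ih' s hs) (Set.left_mem_Icc.2 zero_le_one) ht
    have h0 : ∑ j ∈ Finset.range (K + 1), ((0 : ℝ) ^ j / (j.factorial : ℝ)) • g j 0 = g 0 0 := by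
      simp [Finset.sum_range_succ']
    rw [h0, sub_self, sub_zero, sub_zero] at this
    refine this.trans ?_
    have h1 : ‖t‖ ≤ 1 := by rw [Real.norm_of_nonneg ht.1]; exact ht.2
    nlinarith [norm_nonneg t]

/-- Taylor's formula for `D^ℓ f` at `x`, with a bound of the remainder by the derivative of top
order on the segment. -/
theorem norm_iterD_taylor_le (hf : ContDiff ℝ N f) (x v : E) (l : List E) (K : ℕ)
    (hl : l.length + K ≤ N) {B : ℝ}
    (hB : ∀ t ∈ Set.Icc (0 : ℝ) 1, ‖iterD f (x + t • v) (List.replicate K v ++ l)‖ ≤ B) :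
    ‖iterD f (x + v) l - ∑ j ∈ Finset.range K,
      (1 / (j.factorial : ℝ)) • iterD f x (List.replicate j v ++ l)‖ ≤ B := by
  have := norm_taylor_chain_le K (fun j t => iterD f (x + t • v) (List.replicate j v ++ l))
    (fun j hj t _ => by
      have := hasDerivAt_iterD hf (l := List.replicate j v ++ l) (by simp; omega) x v t
      simpa [List.replicate_succ] using this) hB 1 (by simp)
  simpa using this

end IterD

/-! ### Cuts of plane forests -/

namespace PlaneForest

variable {n : ℕ}

theorem mem_lowOrder {N : ℕ} {τ : PlaneForest n} : τ ∈ lowOrder n N ↔ τ.card < N := by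
  simp [lowOrder]

theorem mul_nil (τ : PlaneForest n) : mul τ nil = τ := by
  induction τ with
  | nil => rfl
  | cons i σ τ _ ih => simp [mul, ih]

theorem card_mul (σ τ : PlaneForest n) : (mul σ τ).card = σ.card + τ.card := by
  induction σ with
  | nil => simp [mul, card]
  | cons i σ σ' _ ih => simp only [mul, card, ih]; omega

theorem card_graft (i : Fin n) (τ : PlaneForest n) : (graft i τ).card = τ.card + 1 := by
  simp [graft, card]

theorem width_le_card (τ : PlaneForest n) : τ.width ≤ τ.card := by
  induction τ with
  | nil => simp [width]
  | cons i σ τ _ ih => simp only [width, card]; omega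

theorem childrenFactorial_pos (τ : PlaneForest n) : 0 < τ.childrenFactorial := by
  induction τ with
  | nil => simp [childrenFactorial]
  | cons i σ τ h₁ h₂ => simp only [childrenFactorial]; positivity

theorem card_add_card_of_mem_coproduct {τ : PlaneForest n} :
    ∀ {c : PlaneForest n × PlaneForest n}, c ∈ coproduct τ → c.1.card + c.2.card = τ.card := by
  induction τ with
  | nil => simp [coproduct, card]
  | cons i σ τ ih₁ ih₂ =>
    intro c hc
    simp only [coproduct, List.mem_flatMap, List.mem_cons, List.mem_map] at hc
    obtain ⟨d, hd, rfl | ⟨c, hc, rfl⟩⟩ := hc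
    · have := ih₂ hd
      simp only [card]; omega
    · have h₁ := ih₁ hc
      have h₂ := ih₂ hd
      simp only [card, card_mul]; omega

/-- The weight `1 / ∏_v (children of v)!` of a plane forest, the product being over the vertices
of the tree obtained by adding a root. -/
noncomputable def weight (τ : PlaneForest n) : ℝ :=
  1 / ((τ.width.factorial * τ.childrenFactorial : ℕ) : ℝ)

theorem weight_nonneg (τ : PlaneForest n) : 0 ≤ τ.weight := by unfold weight; positivity

theorem weight_le_one (τ : PlaneForest n) : τ.weight ≤ 1 := by
  have : 1 ≤ τ.width.factorial * τ.childrenFactorial :=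
    Nat.mul_pos (Nat.factorial_pos _) τ.childrenFactorial_pos
  rw [weight, div_le_one (by exact_mod_cast this)]
  exact_mod_cast this

theorem weight_eq (τ : PlaneForest n) :
    τ.weight = 1 / (τ.width.factorial : ℝ) * (τ.childrenFactorial : ℝ)⁻¹ := by
  rw [weight]; push_cast; rw [one_div, mul_inv, one_div]

theorem inv_childrenFactorial_cons (i : Fin n) (σ τ : PlaneForest n) :
    ((cons i σ τ).childrenFactorial : ℝ)⁻¹ = σ.weight * (τ.childrenFactorial : ℝ)⁻¹ := by
  rw [childrenFactorial, weight]; push_cast; rw [one_div, mul_inv]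

/-- A character of plane forests: a functional multiplicative for juxtaposition. -/
def IsCharacter (Y : PlaneForest n → ℝ) : Prop :=
  Y nil = 1 ∧ ∀ σ τ, Y (mul σ τ) = Y σ * Y τ

theorem IsCharacter.cons {Y : PlaneForest n → ℝ} (hY : IsCharacter Y) (i : Fin n)
    (σ τ : PlaneForest n) : Y (cons i σ τ) = Y (graft i σ) * Y τ := hY.2 (graft i σ) τ

open Classical in
/-- The sum of `Y` over the pruned parts of all the admissible cuts of `τ` with trunk `ρ`. -/
noncomputable def cutSum (Y : PlaneForest n → ℝ) (τ ρ : PlaneForest n) : ℝ :=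
  ((coproduct τ).map fun c => if c.2 = ρ then Y c.1 else 0).sum

theorem sum_map_flatMap {α β : Type*} (l : List α) (g : α → List β) (F : β → ℝ) :
    ((l.flatMap g).map F).sum = (l.map fun a => ((g a).map F).sum).sum := by
  induction l with
  | nil => simp
  | cons a l ih => simp [ih]

theorem sum_coproduct_cons (i : Fin n)
    (σ τ : PlaneForest n) (F : PlaneForest n × PlaneForest n → ℝ) :
    ((coproduct (cons i σ τ)).map F).sum =
      ((coproduct τ).map fun d => F (cons i σ d.1, d.2)).sum +
      ((coproduct τ).map fun d =>
        ((coproduct σ).map fun c => F (mul c.1 d.1, cons i c.2 d.2)).sum).sum := by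
  rw [coproduct, sum_map_flatMap, ← List.sum_map_add]
  simp [Function.comp_def]

variable {Y : PlaneForest n → ℝ}

theorem cutSum_nil_left (hY : IsCharacter Y) (ρ : PlaneForest n) [Decidable (nil = ρ)] :
    cutSum Y nil ρ = if nil = ρ then 1 else 0 := by
  simp [cutSum, coproduct, hY.1]

theorem cutSum_cons_nil (hY : IsCharacter Y) (i : Fin n) (σ τ : PlaneForest n) :
    cutSum Y (cons i σ τ) nil = Y (graft i σ) * cutSum Y τ nil := by
  rw [cutSum, sum_coproduct_cons, cutSum, ← List.sum_map_mul_left]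
  simp only [reduceCtorEq, if_false, List.map_const', List.sum_replicate, smul_zero, add_zero]
  congr 1
  refine List.map_congr_left fun d _ => ?_
  split_ifs
  · exact hY.cons _ _ _
  · simp

theorem cutSum_cons_cons (hY : IsCharacter Y) (i j : Fin n) (σ τ ρ₁ ρ₂ : PlaneForest n) :
    cutSum Y (cons i σ τ) (cons j ρ₁ ρ₂) = Y (graft i σ) * cutSum Y τ (cons j ρ₁ ρ₂) +
      if i = j then cutSum Y σ ρ₁ * cutSum Y τ ρ₂ else 0 := by
  rw [cutSum, sum_coproduct_cons]
  congr 1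
  · rw [cutSum, ← List.sum_map_mul_left]
    congr 1
    refine List.map_congr_left fun d _ => ?_
    split_ifs
    · exact hY.cons _ _ _
    · simp
  · split_ifs with hij
    · subst hij
      rw [cutSum, cutSum, ← List.sum_map_mul_left]
      congr 1
      refine List.map_congr_left fun d _ => ?_
      rw [← List.sum_map_mul_right]
      congr 1
      refine List.map_congr_left fun c _ => ?_
      by_cases h₁ : c.2 = ρ₁ <;> by_cases h₂ : d.2 = ρ₂ <;> simp [h₁, h₂, hY.2]
    · simp [hij]

theorem cutSum_eq_zero {τ ρ : PlaneForest n} (h : τ.card < ρ.card) : cutSum Y τ ρ = 0 := by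
  refine List.sum_eq_zero fun x hx => ?_
  obtain ⟨c, hc, rfl⟩ := List.mem_map.1 hx
  refine if_neg ?_
  rintro rfl
  have := card_add_card_of_mem_coproduct hc
  omega

theorem abs_list_sum_le {α : Type*} (l : List α) (F : α → ℝ) {B : ℝ} (h : ∀ a ∈ l, |F a| ≤ B) :
    |(l.map F).sum| ≤ l.length * B := by
  induction l with
  | nil => simp
  | cons a l ih =>
    have h₁ := h a (by simp)
    have h₂ := ih fun b hb => h b (by simp [hb])
    simp only [List.map_cons, List.sum_cons, List.length_cons, Nat.cast_add, Nat.cast_one]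
    linarith [abs_add_le (F a) (l.map F).sum]

theorem abs_cutSum_le {H : ℝ} (hH : 0 ≤ H) (hY : ∀ σ, |Y σ| ≤ H ^ σ.card) (τ ρ : PlaneForest n) :
    |cutSum Y τ ρ| ≤ (coproduct τ).length * H ^ (τ.card - ρ.card) := by
  refine abs_list_sum_le _ _ fun c hc => ?_
  split_ifs with h
  · have := card_add_card_of_mem_coproduct hc
    refine (hY _).trans (le_of_eq ?_)
    rw [← h]
    congr 1
    omega
  · simp only [abs_zero]; positivity

/-- Regrouping the terms of a coproduct by their trunks. -/
theorem sum_coproduct_eq {N : ℕ} {τ : PlaneForest n} (hτ : τ.card < N) (Z : PlaneForest n → ℝ) :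
    ((coproduct τ).map fun c => Y c.1 * Z c.2).sum =
      ∑ ρ ∈ lowOrder n N, cutSum Y τ ρ * Z ρ := by
  classical
  have h : ∀ c ∈ coproduct τ, c.2 ∈ lowOrder n N := fun c hc => by
    have := card_add_card_of_mem_coproduct hc
    rw [mem_lowOrder]; omega
  simp only [cutSum]
  generalize coproduct τ = l at h
  induction l with
  | nil => simp
  | cons c l ih =>
    simp only [List.map_cons, List.sum_cons, add_mul, Finset.sum_add_distrib]
    rw [ih fun d hd => h d (by simp [hd])]
    congr 1
    have := h c (by simp)
    simp [ite_mul, this]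

/-- The extension to all plane forests, as a character, of a functional `g` given on trees with at
most `N` vertices: larger trees are sent to `0`. -/
noncomputable def extend (N : ℕ) (g : PlaneForest n → ℝ) : PlaneForest n → ℝ
  | nil => 1
  | cons i σ τ => (if σ.card < N then g (graft i σ) else 0) * extend N g τ

theorem isCharacter_extend (N : ℕ) (g : PlaneForest n → ℝ) : IsCharacter (extend N g) := by
  refine ⟨rfl, fun σ τ => ?_⟩
  induction σ with
  | nil => simp [mul, extend]
  | cons i σ σ' _ ih => simp only [mul, extend, ih, mul_assoc]

theorem extend_eq {N : ℕ} {g : PlaneForest n → ℝ} (h₁ : g nil = 1)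
    (hg : ∀ σ τ : PlaneForest n, σ.card + τ.card ≤ N → g (mul σ τ) = g σ * g τ)
    {τ : PlaneForest n} (hτ : τ.card ≤ N) : extend N g τ = g τ := by
  induction τ with
  | nil => exact h₁.symm
  | cons i σ τ _ ih =>
    simp only [card] at hτ
    have := hg (graft i σ) τ (by rw [card_graft]; omega)
    rw [extend, ih (by omega), if_pos (by omega), ← this]
    rfl

theorem abs_extend_le {N : ℕ} {g : PlaneForest n → ℝ} {H : ℝ} (hH : 0 ≤ H)
    (hg : ∀ τ : PlaneForest n, 1 ≤ τ.card → τ.card ≤ N → |g τ| ≤ H ^ τ.card)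
    (τ : PlaneForest n) : |extend N g τ| ≤ H ^ τ.card := by
  induction τ with
  | nil => simp [extend, card]
  | cons i σ τ _ ih =>
    rw [extend, abs_mul, card, pow_add]
    refine mul_le_mul ?_ ih (abs_nonneg _) (by positivity)
    split_ifs with h
    · have := hg (graft i σ) (by rw [card_graft]; omega) (by rw [card_graft]; omega)
      rwa [card_graft] at this
    · simp only [abs_zero]; positivity

open Classical in
/-- The plane forests with `k` trees, each of which has at most `N` vertices. -/
noncomputable def box (n N : ℕ) : ℕ → Finset (PlaneForest n)
  | 0 => {nil}
  | k + 1 => ((Finset.univ ×ˢ lowOrder n N) ×ˢ box n N k).image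
      fun x : (Fin n × PlaneForest n) × PlaneForest n => cons x.1.1 x.1.2 x.2

theorem mem_box_succ {N k : ℕ} {τ : PlaneForest n} : τ ∈ box n N (k + 1) ↔
    ∃ i σ τ', σ.card < N ∧ τ' ∈ box n N k ∧ τ = cons i σ τ' := by
  simp only [box, Finset.mem_image, Finset.mem_product, Finset.mem_univ, true_and, mem_lowOrder,
    Prod.exists]
  grind

theorem sum_box_succ {M : Type*} [AddCommMonoid M] (N k : ℕ) (g : PlaneForest n → M) :
    ∑ τ ∈ box n N (k + 1), g τ =
      ∑ p ∈ Finset.univ ×ˢ lowOrder n N, ∑ τ ∈ box n N k, g (cons p.1 p.2 τ) := by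
  classical
  rw [← Finset.sum_product']
  rw [box, Finset.sum_image]
  rintro ⟨⟨i, σ⟩, τ⟩ _ ⟨⟨j, σ'⟩, τ'⟩ _ h
  simp only [cons.injEq] at h
  simp [h.1, h.2.1, h.2.2]

theorem width_of_mem_box {N k : ℕ} {τ : PlaneForest n} (h : τ ∈ box n N k) : τ.width = k := by
  induction k generalizing τ with
  | zero =>
    simp only [box, Finset.mem_singleton] at h
    simp [h, width]
  | succ k ih =>
    obtain ⟨i, σ, τ', _, hτ', rfl⟩ := mem_box_succ.1 h
    rw [width, ih hτ']

theorem mem_box_of_card_le {N : ℕ} {τ : PlaneForest n} (h : τ.card ≤ N) :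
    τ ∈ box n N τ.width := by
  induction τ with
  | nil => simp [width, box]
  | cons i σ τ _ ih =>
    simp only [card] at h
    exact mem_box_succ.2 ⟨i, σ, τ, by omega, ih (by omega), rfl⟩

open Classical in
/-- A sum over the boxes of width less than `N` is a sum over the forests with fewer than `N`
vertices, up to forests with at least `N` vertices. -/
theorem sum_box_eq {M : Type*} [AddCommMonoid M] (N : ℕ) (g : PlaneForest n → M) :
    ∑ k ∈ Finset.range N, ∑ τ ∈ box n N k, g τ = ∑ τ ∈ lowOrder n N, g τ +
      ∑ k ∈ Finset.range N, ∑ τ ∈ box n N k with N ≤ τ.card, g τ := by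
  have h : ∀ k ∈ Finset.range N, ∑ τ ∈ box n N k, g τ =
      ∑ τ ∈ lowOrder n N with τ.width = k, g τ + ∑ τ ∈ box n N k with N ≤ τ.card, g τ := by
    intro k _
    rw [← Finset.sum_filter_add_sum_filter_not (box n N k) (fun τ => τ.card < N)]
    congr 1
    · refine Finset.sum_congr ?_ fun _ _ => rfl
      ext τ
      simp only [Finset.mem_filter, mem_lowOrder]
      constructor
      · rintro ⟨h₁, h₂⟩
        exact ⟨h₂, width_of_mem_box h₁⟩
      · rintro ⟨h₁, rfl⟩
        exact ⟨mem_box_of_card_le h₁.le, h₁⟩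
    · simp only [not_lt]
  rw [Finset.sum_congr rfl h, Finset.sum_add_distrib]
  congr 1
  refine Finset.sum_fiberwise_of_maps_to (fun τ hτ => ?_) g
  rw [mem_lowOrder] at hτ
  rw [Finset.mem_range]
  exact (width_le_card τ).trans_lt hτ

end PlaneForest

open PlaneForest

/-! ### Composition of elementary differentials with a character -/

section Composition

variable {m n : ℕ}
  {f : EuclideanSpace ℝ (Fin m) → EuclideanSpace ℝ (Fin n) →L[ℝ] EuclideanSpace ℝ (Fin m)}

-- The next three facts spare a search for the module structure on the operator space, which
-- rewriting with the general lemmas does not find.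
theorem add_smul_operator (a b : ℝ) (T : EuclideanSpace ℝ (Fin n) →L[ℝ] EuclideanSpace ℝ (Fin m)) :
    (a + b) • T = a • T + b • T := by exact add_smul a b T

theorem zero_smul_operator (T : EuclideanSpace ℝ (Fin n) →L[ℝ] EuclideanSpace ℝ (Fin m)) :
    (0 : ℝ) • T = 0 := by exact zero_smul ℝ T

theorem smul_sub_operator (c : ℝ) (T T' : EuclideanSpace ℝ (Fin n) →L[ℝ] EuclideanSpace ℝ (Fin m)) :
    c • (T - T') = c • T - c • T' := by exact smul_sub c T T'

theorem elemDiff_eq (τ : PlaneForest n) (x : EuclideanSpace ℝ (Fin m)) :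
    elemDiff f τ x = iterD f x (branchVectors f x τ) := rfl

/-- The vector `f^τ_i(x)`. -/
noncomputable def compDiff
    (f : EuclideanSpace ℝ (Fin m) → EuclideanSpace ℝ (Fin n) →L[ℝ] EuclideanSpace ℝ (Fin m))
    (x : EuclideanSpace ℝ (Fin m)) (i : Fin n) (τ : PlaneForest n) : EuclideanSpace ℝ (Fin m) :=
  elemDiff f τ x (EuclideanSpace.single i 1)

theorem branchVectors_cons (x : EuclideanSpace ℝ (Fin m)) (i : Fin n) (σ τ : PlaneForest n) :
    branchVectors f x (.cons i σ τ) = compDiff f x i σ :: branchVectors f x τ := by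
  rw [branchVectors]; rfl

theorem branchVectors_nil (x : EuclideanSpace ℝ (Fin m)) :
    branchVectors f x (.nil : PlaneForest n) = [] := by
  rw [branchVectors]

theorem length_branchVectors (x : EuclideanSpace ℝ (Fin m)) (τ : PlaneForest n) :
    (branchVectors f x τ).length = τ.width := by
  induction τ with
  | nil => simp [branchVectors_nil, width]
  | cons i σ τ _ ih => simp [branchVectors_cons, width, ih]

/-- The increment `∑_{i, |τ| < N} w(τ) Y^{[τ]_i} f^τ_i(x)` of the Euler scheme driven by `Y`. -/
noncomputable def increment (N : ℕ) (Y : PlaneForest n → ℝ)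
    (f : EuclideanSpace ℝ (Fin m) → EuclideanSpace ℝ (Fin n) →L[ℝ] EuclideanSpace ℝ (Fin m))
    (x : EuclideanSpace ℝ (Fin m)) : EuclideanSpace ℝ (Fin m) :=
  ∑ p ∈ Finset.univ ×ˢ lowOrder n N, (weight p.2 * Y (graft p.1 p.2)) • compDiff f x p.1 p.2

/-- The expansion `∑_{|τ| < N} w(τ) (∑_{cuts of τ with trunk ρ} Y) f^τ(x)` of `w(ρ) f^ρ` at a point
reached from `x` by an increment driven by `Y`. -/
noncomputable def expansion (N : ℕ) (Y : PlaneForest n → ℝ)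
    (f : EuclideanSpace ℝ (Fin m) → EuclideanSpace ℝ (Fin n) →L[ℝ] EuclideanSpace ℝ (Fin m))
    (x : EuclideanSpace ℝ (Fin m)) (ρ : PlaneForest n) :
    EuclideanSpace ℝ (Fin n) →L[ℝ] EuclideanSpace ℝ (Fin m) :=
  ∑ τ ∈ lowOrder n N, (weight τ * cutSum Y τ ρ) • elemDiff f τ x

/-- The list of the expansions of the branches of `ρ`. -/
noncomputable def expansionVectors (N : ℕ) (Y : PlaneForest n → ℝ)
    (f : EuclideanSpace ℝ (Fin m) → EuclideanSpace ℝ (Fin n) →L[ℝ] EuclideanSpace ℝ (Fin m))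
    (x : EuclideanSpace ℝ (Fin m)) : PlaneForest n → List (EuclideanSpace ℝ (Fin m))
  | .nil => []
  | .cons i σ τ =>
      expansion N Y f x σ (EuclideanSpace.single i 1) :: expansionVectors N Y f x τ

theorem length_expansionVectors (N : ℕ) (Y : PlaneForest n → ℝ) (x : EuclideanSpace ℝ (Fin m))
    (τ : PlaneForest n) : (expansionVectors N Y f x τ).length = τ.width := by
  induction τ with
  | nil => simp [expansionVectors, width]
  | cons i σ τ _ ih => simp [expansionVectors, width, ih]

/-- The list of the vectors `w(σ_j) f^{σ_j}_{i_j}(x)` for the branches of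
`[σ₁]_{i₁} ⋯ [σ_ℓ]_{i_ℓ}`. -/
noncomputable def weightedVectors
    (f : EuclideanSpace ℝ (Fin m) → EuclideanSpace ℝ (Fin n) →L[ℝ] EuclideanSpace ℝ (Fin m))
    (x : EuclideanSpace ℝ (Fin m)) : PlaneForest n → List (EuclideanSpace ℝ (Fin m))
  | .nil => []
  | .cons i σ τ => (weight σ • elemDiff f σ x) (EuclideanSpace.single i 1) :: weightedVectors f x τ

theorem length_weightedVectors (x : EuclideanSpace ℝ (Fin m)) (τ : PlaneForest n) :
    (weightedVectors f x τ).length = τ.width := by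
  induction τ with
  | nil => simp [weightedVectors, width]
  | cons i σ τ _ ih => simp [weightedVectors, width, ih]

variable {N : ℕ} {Y : PlaneForest n → ℝ}

theorem iterD_cons_smul {E F : Type*} [NormedAddCommGroup E] [NormedSpace ℝ E]
    [NormedAddCommGroup F] [NormedSpace ℝ F] (f : E → F) (x : E) (c : ℝ) (v : E) (l : List E) :
    iterD f x (c • v :: l) = c • iterD f x (v :: l) := (iterDLin f x l).map_smul c v

/-- Linearity of `D^ℓ f(x)` in an argument in the middle of the list. -/
theorem sum_smul_iterD_middle {E F : Type*} [NormedAddCommGroup E] [NormedSpace ℝ E]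
    [NormedAddCommGroup F] [NormedSpace ℝ F] {f : E → F} (hf : ContDiff ℝ N f) (x : E)
    {ι : Type*} (s : Finset ι) (c : ι → ℝ) (u : ι → E) (l₁ l₂ : List E)
    (h : l₁.length + l₂.length + 1 ≤ N) :
    ∑ a ∈ s, c a • iterD f x (l₁ ++ u a :: l₂) = iterD f x (l₁ ++ (∑ a ∈ s, c a • u a) :: l₂) := by
  have key : ∀ v, iterD f x (l₁ ++ v :: l₂) = iterDLin f x (l₁ ++ l₂) v := fun v =>
    iterD_perm hf List.perm_middle (by simp; omega) x
  simp only [key, map_sum, map_smul]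

theorem iterD_weightedVectors (hf : ContDiff ℝ N f) (x z : EuclideanSpace ℝ (Fin m))
    (ρ : PlaneForest n) (l : List (EuclideanSpace ℝ (Fin m))) (h : ρ.width + l.length ≤ N) :
    iterD f z (weightedVectors f x ρ ++ l) =
      (ρ.childrenFactorial : ℝ)⁻¹ • iterD f z (branchVectors f x ρ ++ l) := by
  induction ρ generalizing l with
  | nil => simp [weightedVectors, branchVectors_nil, childrenFactorial]
  | cons i σ τ _ ih =>
    simp only [width] at h
    have h₁ : ∀ (v) (L : List (EuclideanSpace ℝ (Fin m))), L.length = τ.width →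
        iterD f z (v :: L ++ l) = iterD f z (L ++ v :: l) := fun v L hL =>
      iterD_perm hf List.perm_middle.symm (by simp; omega) z
    rw [weightedVectors, branchVectors_cons, inv_childrenFactorial_cons, mul_smul, smul_comm,
      smul_apply, List.cons_append, iterD_cons_smul, ← List.cons_append,
      h₁ _ _ (length_weightedVectors _ _), h₁ _ _ (length_branchVectors _ _),
      ih _ (by simp; omega)]
    rw [smul_comm]
    rfl

/-- The algebraic heart of the composition rule: the forests of width `k`, with the pruned parts of
their cuts with trunk `ρ` evaluated by `Y`, sum up to the terms of `D^k f(x)` in which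
`width ρ` of the arguments are the expansions of the branches of `ρ` and the others are the
increment. In the recursion over `k`, the first tree of a forest is either pruned entirely or
contains the first branch of the trunk; this is Pascal's rule for the binomial coefficient. -/
theorem sum_box_cutSum (hf : ContDiff ℝ N f) (hY : IsCharacter Y) (x : EuclideanSpace ℝ (Fin m))
    (k : ℕ) (ρ : PlaneForest n) (l : List (EuclideanSpace ℝ (Fin m))) (h : k + l.length ≤ N) :
    ∑ τ ∈ box n N k, ((τ.childrenFactorial : ℝ)⁻¹ * cutSum Y τ ρ) •
        iterD f x (branchVectors f x τ ++ l) =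
      (k.choose ρ.width : ℝ) • iterD f x (List.replicate (k - ρ.width) (increment N Y f x) ++
        (expansionVectors N Y f x ρ ++ l)) := by
  classical
  induction k generalizing ρ l with
  | zero =>
    cases ρ with
    | nil => simp [box, cutSum_nil_left hY, childrenFactorial, branchVectors_nil, width,
        expansionVectors]
    | cons j ρ₁ ρ₂ => simp [box, cutSum_nil_left hY, width, zero_smul_operator]
  | succ k ih =>
    -- The tree evaluated by `Y` entirely contributes one more increment.
    have first : ∀ ρ : PlaneForest n,
        ∑ p ∈ Finset.univ ×ˢ lowOrder n N, ∑ τ ∈ box n N k,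
          (weight p.2 * (τ.childrenFactorial : ℝ)⁻¹ * (Y (graft p.1 p.2) * cutSum Y τ ρ)) •
            iterD f x (branchVectors f x τ ++ compDiff f x p.1 p.2 :: l) =
        (k.choose ρ.width : ℝ) • iterD f x (List.replicate (k - ρ.width) (increment N Y f x) ++
          (expansionVectors N Y f x ρ ++ increment N Y f x :: l)) := by
      intro ρ
      rw [← ih ρ (increment N Y f x :: l) (by simp; omega), Finset.sum_comm]
      refine Finset.sum_congr rfl fun τ hτ => ?_
      rw [increment, ← sum_smul_iterD_middle hf x _ _ _ _ _ (by
        rw [length_branchVectors, width_of_mem_box hτ]; omega), Finset.smul_sum]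
      refine Finset.sum_congr rfl fun p _ => ?_
      rw [smul_smul]
      congr 1
      ring
    have move : ∀ p : Fin n × PlaneForest n, ∀ τ ∈ box n N k,
        iterD f x (branchVectors f x (.cons p.1 p.2 τ) ++ l) =
          iterD f x (branchVectors f x τ ++ compDiff f x p.1 p.2 :: l) := fun p τ hτ => by
      rw [branchVectors_cons]
      refine iterD_perm hf List.perm_middle.symm ?_ x
      simp [length_branchVectors, width_of_mem_box hτ]; omega
    rw [sum_box_succ]
    cases ρ with
    | nil =>
      have e : ∀ p ∈ Finset.univ ×ˢ lowOrder n N, ∀ τ ∈ box n N k,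
          (((PlaneForest.cons p.1 p.2 τ).childrenFactorial : ℝ)⁻¹ *
            cutSum Y (.cons p.1 p.2 τ) .nil) •
            iterD f x (branchVectors f x (.cons p.1 p.2 τ) ++ l) =
          (weight p.2 * (τ.childrenFactorial : ℝ)⁻¹ * (Y (graft p.1 p.2) * cutSum Y τ .nil)) •
            iterD f x (branchVectors f x τ ++ compDiff f x p.1 p.2 :: l) := fun p _ τ hτ => by
        rw [move p τ hτ, cutSum_cons_nil hY, inv_childrenFactorial_cons]
      rw [Finset.sum_congr rfl fun p hp => Finset.sum_congr rfl (e p hp), first]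
      simp only [width, Nat.choose_zero_right, expansionVectors, List.nil_append, Nat.sub_zero,
        List.replicate_succ, List.cons_append]
      congr 1
      exact iterD_perm hf List.perm_middle (by simp; omega) x
    | cons j ρ₁ ρ₂ =>
      have e : ∀ p ∈ Finset.univ ×ˢ lowOrder n N, ∀ τ ∈ box n N k,
          (((PlaneForest.cons p.1 p.2 τ).childrenFactorial : ℝ)⁻¹ *
            cutSum Y (.cons p.1 p.2 τ) (.cons j ρ₁ ρ₂)) •
            iterD f x (branchVectors f x (.cons p.1 p.2 τ) ++ l) =
          (weight p.2 * (τ.childrenFactorial : ℝ)⁻¹ *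
              (Y (graft p.1 p.2) * cutSum Y τ (.cons j ρ₁ ρ₂))) •
            iterD f x (branchVectors f x τ ++ compDiff f x p.1 p.2 :: l) +
          if p.1 = j then ((τ.childrenFactorial : ℝ)⁻¹ * cutSum Y τ ρ₂) •
            (weight p.2 * cutSum Y p.2 ρ₁) •
              iterD f x (branchVectors f x τ ++ compDiff f x p.1 p.2 :: l) else 0 :=
        fun p _ τ hτ => by
          rw [move p τ hτ, cutSum_cons_cons hY, inv_childrenFactorial_cons, mul_add, add_smul_operator]
          congr 1
          split_ifs
          · rw [smul_smul]
            congr 1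
            ring
          · rw [mul_zero, zero_smul_operator]
      rw [Finset.sum_congr rfl fun p hp => Finset.sum_congr rfl (e p hp)]
      simp only [Finset.sum_add_distrib]
      rw [first]
      have second : ∑ p ∈ Finset.univ ×ˢ lowOrder n N, ∑ τ ∈ box n N k,
          (if p.1 = j then ((τ.childrenFactorial : ℝ)⁻¹ * cutSum Y τ ρ₂) •
            (weight p.2 * cutSum Y p.2 ρ₁) •
              iterD f x (branchVectors f x τ ++ compDiff f x p.1 p.2 :: l) else 0) =
          (k.choose ρ₂.width : ℝ) • iterD f x (List.replicate (k - ρ₂.width) (increment N Y f x) ++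
            (expansionVectors N Y f x ρ₂ ++
              expansion N Y f x ρ₁ (EuclideanSpace.single j 1) :: l)) := by
        rw [← ih ρ₂ (expansion N Y f x ρ₁ (EuclideanSpace.single j 1) :: l) (by simp; omega),
          Finset.sum_comm]
        refine Finset.sum_congr rfl fun τ hτ => ?_
        rw [Finset.sum_product, Finset.sum_eq_single j (fun b _ hb => by simp [hb]) (by simp)]
        simp only [if_true]
        rw [← Finset.smul_sum, sum_smul_iterD_middle hf x _ _ _ _ _ (by
          rw [length_branchVectors, width_of_mem_box hτ]; omega)]
        congr 4
        rw [expansion, sum_apply]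
        rfl
      rw [second]
      simp only [width]
      rw [Nat.choose_succ_succ, Nat.cast_add, add_smul_operator, add_comm]
      congr 1
      · rw [Nat.add_sub_add_right, expansionVectors]
        by_cases hk : k < ρ₂.width
        · simp [Nat.choose_eq_zero_of_lt hk, zero_smul_operator]
        congr 1
        refine iterD_perm hf ?_ ?_ x
        · exact List.Perm.append_left _ List.perm_middle
        · simp [length_expansionVectors]; omega
      · by_cases hk : k < ρ₂.width + 1
        · simp [Nat.choose_eq_zero_of_lt hk, zero_smul_operator]
        congr 1
        have hs : k + 1 - (ρ₂.width + 1) = (k - (ρ₂.width + 1)) + 1 := by omega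
        rw [hs, List.replicate_succ, List.cons_append, ← List.append_assoc, ← List.append_assoc]
        refine iterD_perm hf List.perm_middle ?_ x
        simp [length_expansionVectors, width]; omega

end Composition

/-! ### Bounds for elementary differentials and their expansions -/

section Bounds

/-- The product of the norms of a list of vectors, measured in units of length `1 / Q`. -/
noncomputable def normProd {E : Type*} [NormedAddCommGroup E] (Q : ℝ) (l : List E) : ℝ :=
  (l.map fun v => Q * ‖v‖).prod

section

variable {E F : Type*} [NormedAddCommGroup E] [NormedAddCommGroup F]

theorem normProd_nil (Q : ℝ) : normProd Q ([] : List E) = 1 := rfl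

theorem normProd_cons (Q : ℝ) (v : E) (l : List E) :
    normProd Q (v :: l) = Q * ‖v‖ * normProd Q l := by simp [normProd]

theorem normProd_append (Q : ℝ) (l l' : List E) :
    normProd Q (l ++ l') = normProd Q l * normProd Q l' := by simp [normProd]

theorem normProd_replicate (Q : ℝ) (k : ℕ) (v : E) :
    normProd Q (List.replicate k v) = (Q * ‖v‖) ^ k := by simp [normProd]

theorem normProd_nonneg {Q : ℝ} (hQ : 0 ≤ Q) (l : List E) : 0 ≤ normProd Q l := by
  induction l with
  | nil => simp [normProd]
  | cons v l ih => rw [normProd_cons]; positivity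

variable [NormedSpace ℝ E] [NormedSpace ℝ F]

/-- At the point `z`, the derivatives of `f` of order `ℓ ≤ N` are bounded by `P * Q ^ ℓ`. -/
def DerivBound (N : ℕ) (P Q : ℝ) (f : E → F) (z : E) : Prop :=
  ∀ ℓ ≤ N, ‖iteratedFDeriv ℝ ℓ f z‖ ≤ P * Q ^ ℓ

variable {N : ℕ} {P Q : ℝ} {f : E → F} {z : E}

theorem DerivBound.norm_iterD_le (h : DerivBound N P Q f z) {l : List E} (hl : l.length ≤ N) :
    ‖iterD f z l‖ ≤ P * normProd Q l := by
  have hp : 0 ≤ (l.map fun v => ‖v‖).prod :=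
    List.prod_nonneg fun a ha => by obtain ⟨v, _, rfl⟩ := List.mem_map.1 ha; exact norm_nonneg v
  refine (BranchedRDE.norm_iterD_le f z l).trans
    ((mul_le_mul_of_nonneg_right (h _ hl) hp).trans (le_of_eq ?_))
  rw [mul_assoc]
  congr 1
  clear hl hp
  induction l with
  | nil => simp [normProd]
  | cons v l ih =>
    rw [normProd_cons, ← ih]
    simp only [List.length_cons, List.map_cons, List.prod_cons, pow_succ]
    ring

/-- Replacing `j` equal arguments `u` of `D^ℓ f(z)` by a nearby vector `v`, one after the other. -/
theorem norm_iterD_replicate_sub_le (hP : 0 ≤ P) (hQ : 0 ≤ Q) (hf : ContDiff ℝ N f)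
    (h : DerivBound N P Q f z)
    {u v : E} {B r : ℝ} (hu : Q * ‖u‖ ≤ B) (hv : Q * ‖v‖ ≤ B) (hB : 1 ≤ B)
    (hr : Q * ‖u - v‖ ≤ r) (j : ℕ) (l : List E) (hl : j + l.length ≤ N) :
    ‖iterD f z (List.replicate j u ++ l) - iterD f z (List.replicate j v ++ l)‖ ≤
      j * B ^ j * (P * r * normProd Q l) := by
  have hr0 : 0 ≤ r := le_trans (by positivity) hr
  induction j generalizing l with
  | zero => simp
  | succ j ih =>
    have hl0 := normProd_nonneg hQ l
    have e₁ : iterD f z (List.replicate (j + 1) u ++ l) =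
        iterD f z (List.replicate j u ++ u :: l) := by
      refine iterD_perm hf ?_ (by simp; omega) z
      rw [List.replicate_succ]; exact List.perm_middle.symm
    have e₂ : iterD f z (List.replicate (j + 1) v ++ l) =
        iterD f z (v :: (List.replicate j v ++ l)) := by
      rw [List.replicate_succ]; rfl
    have e₃ : iterD f z (List.replicate j v ++ u :: l) =
        iterD f z (u :: (List.replicate j v ++ l)) :=
      iterD_perm hf List.perm_middle (by simp; omega) z
    have e₄ : iterD f z (u :: (List.replicate j v ++ l)) - iterD f z (v :: (List.replicate j v ++ l))
        = iterD f z ((u - v) :: (List.replicate j v ++ l)) :=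
      ((iterDLin f z (List.replicate j v ++ l)).map_sub u v).symm
    have h₁ := ih (u :: l) (by simp; omega)
    have h₂ := h.norm_iterD_le (l := (u - v) :: (List.replicate j v ++ l)) (by simp; omega)
    rw [normProd_cons, normProd_append, normProd_replicate] at h₂
    rw [normProd_cons] at h₁
    have h₃ : ‖iterD f z (List.replicate (j + 1) u ++ l) -
        iterD f z (List.replicate (j + 1) v ++ l)‖ ≤ j * B ^ j * (P * r * (Q * ‖u‖ * normProd Q l))
          + P * (Q * ‖u - v‖ * ((Q * ‖v‖) ^ j * normProd Q l)) := by
      rw [e₁, e₂, ← sub_add_sub_cancel _ (iterD f z (List.replicate j v ++ u :: l)), e₃, e₄]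
      rw [e₃] at h₁
      exact (norm_add_le _ _).trans (add_le_add h₁ h₂)
    refine h₃.trans ?_
    have h₄ : j * B ^ j * (P * r * (Q * ‖u‖ * normProd Q l)) ≤
        j * B ^ j * (P * r * (B * normProd Q l)) := by gcongr
    have h₅ : P * (Q * ‖u - v‖ * ((Q * ‖v‖) ^ j * normProd Q l)) ≤
        P * (r * (B ^ j * normProd Q l)) := by gcongr
    have h₆ : P * (r * (B ^ j * normProd Q l)) ≤ P * (r * (B ^ (j + 1) * normProd Q l)) := by
      gcongr
      omega
    refine (add_le_add h₄ (h₅.trans h₆)).trans (le_of_eq ?_)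
    push_cast
    ring

end

variable {m n : ℕ}
  {f : EuclideanSpace ℝ (Fin m) → EuclideanSpace ℝ (Fin n) →L[ℝ] EuclideanSpace ℝ (Fin m)}
  {N : ℕ} {P Q H : ℝ} {x z : EuclideanSpace ℝ (Fin m)} {Y : PlaneForest n → ℝ}

theorem norm_apply_single_le (T : EuclideanSpace ℝ (Fin n) →L[ℝ] EuclideanSpace ℝ (Fin m))
    (i : Fin n) : ‖T (EuclideanSpace.single i 1)‖ ≤ ‖T‖ := by
  simpa using T.le_opNorm (EuclideanSpace.single i (1 : ℝ))

theorem normProd_branchVectors_le (hP : 0 ≤ P) (hQ : 0 ≤ Q) (h : DerivBound N P Q f x)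
    {τ : PlaneForest n} (hτ : τ.card ≤ N) :
    normProd Q (branchVectors f x τ) ≤ (P * Q) ^ τ.card := by
  induction τ with
  | nil => simp [branchVectors_nil, normProd, card]
  | cons i σ τ ih₁ ih₂ =>
    simp only [card] at hτ
    have hσ := ih₁ (by omega)
    have hw := width_le_card σ
    rw [branchVectors_cons, normProd_cons, card, pow_add, pow_succ]
    refine mul_le_mul ?_ (ih₂ (by omega)) (normProd_nonneg hQ _) (by positivity)
    have h₁ : ‖compDiff f x i σ‖ ≤ P * (P * Q) ^ σ.card :=
      (norm_apply_single_le _ i).trans ((h.norm_iterD_le (by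
        rw [length_branchVectors]; omega)).trans (by gcongr))
    calc Q * ‖compDiff f x i σ‖ ≤ Q * (P * (P * Q) ^ σ.card) := by gcongr
      _ = (P * Q) ^ σ.card * (P * Q) := by ring

theorem norm_elemDiff_le (hP : 0 ≤ P) (hQ : 0 ≤ Q) (h : DerivBound N P Q f x)
    {τ : PlaneForest n} (hτ : τ.card ≤ N) : ‖elemDiff f τ x‖ ≤ P * (P * Q) ^ τ.card := by
  have hw := width_le_card τ
  exact (h.norm_iterD_le (by rw [length_branchVectors]; omega)).trans
    (mul_le_mul_of_nonneg_left (normProd_branchVectors_le hP hQ h hτ) hP)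

theorem norm_elemDiff_le_of_mem_box (hP : 0 ≤ P) (hQ : 0 ≤ Q) (h : DerivBound N P Q f x)
    {k : ℕ} (hk : k ≤ N) {τ : PlaneForest n} (hτ : τ ∈ box n N k) :
    ‖elemDiff f τ x‖ ≤ P * (P * Q) ^ τ.card := by
  have key : normProd Q (branchVectors f x τ) ≤ (P * Q) ^ τ.card := by
    clear hk
    induction k generalizing τ with
    | zero =>
      simp only [box, Finset.mem_singleton] at hτ
      simp [hτ, branchVectors_nil, normProd, card]
    | succ k ih =>
      obtain ⟨i, σ, τ', hσ, hτ', rfl⟩ := mem_box_succ.1 hτ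
      have h₁ := norm_elemDiff_le hP hQ h hσ.le
      rw [branchVectors_cons, normProd_cons, card, pow_add, pow_succ]
      refine mul_le_mul ?_ (ih hτ') (normProd_nonneg hQ _) (by positivity)
      calc Q * ‖compDiff f x i σ‖ ≤ Q * (P * (P * Q) ^ σ.card) := by
            gcongr; exact (norm_apply_single_le _ i).trans h₁
        _ = (P * Q) ^ σ.card * (P * Q) := by ring
  exact (h.norm_iterD_le (by rw [length_branchVectors, width_of_mem_box hτ]; omega)).trans
    (mul_le_mul_of_nonneg_left key hP)

theorem normProd_weightedVectors_le (hP : 0 ≤ P) (hQ : 0 ≤ Q) (h : DerivBound N P Q f x)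
    {τ : PlaneForest n} (hτ : τ.card ≤ N) :
    normProd Q (weightedVectors f x τ) ≤ (P * Q) ^ τ.card := by
  induction τ with
  | nil => simp [weightedVectors, normProd, card]
  | cons i σ τ _ ih =>
    simp only [card] at hτ
    have hσ := norm_elemDiff_le hP hQ h (τ := σ) (by omega)
    rw [weightedVectors, normProd_cons, card, pow_add, pow_succ]
    refine mul_le_mul ?_ (ih (by omega)) (normProd_nonneg hQ _) (by positivity)
    have h₁ : ‖(weight σ • elemDiff f σ x) (EuclideanSpace.single i 1)‖ ≤ ‖elemDiff f σ x‖ := by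
      refine (norm_apply_single_le _ i).trans ?_
      rw [norm_smul, Real.norm_of_nonneg (weight_nonneg σ)]
      exact mul_le_of_le_one_left (norm_nonneg _) (weight_le_one σ)
    calc _ ≤ Q * (P * (P * Q) ^ σ.card) := by gcongr; exact h₁.trans hσ
      _ = (P * Q) ^ σ.card * (P * Q) := by ring

theorem norm_increment_le (hP : 0 ≤ P) (hQ : 0 ≤ Q) (hH : 0 ≤ H) (h : DerivBound N P Q f x)
    (hY : ∀ σ, |Y σ| ≤ H ^ σ.card) (ha : P * Q * H ≤ 1) :
    Q * ‖increment N Y f x‖ ≤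
      ((Finset.univ ×ˢ lowOrder n N : Finset (Fin n × PlaneForest n)).card : ℝ) * (P * Q * H) := by
  rw [increment, ← nsmul_eq_mul, ← Finset.sum_const]
  refine (mul_le_mul_of_nonneg_left (norm_sum_le _ _) hQ).trans ?_
  rw [Finset.mul_sum]
  refine Finset.sum_le_sum fun p hp => ?_
  have hp' : p.2.card < N := mem_lowOrder.1 (Finset.mem_product.1 hp).2
  have h₁ : ‖compDiff f x p.1 p.2‖ ≤ P * (P * Q) ^ p.2.card :=
    (norm_apply_single_le _ _).trans (norm_elemDiff_le hP hQ h hp'.le)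
  have h₂ := hY (graft p.1 p.2)
  rw [card_graft] at h₂
  rw [norm_smul, Real.norm_eq_abs, abs_mul, abs_of_nonneg (weight_nonneg _)]
  calc Q * (weight p.2 * |Y (graft p.1 p.2)| * ‖compDiff f x p.1 p.2‖)
      ≤ Q * (1 * H ^ (p.2.card + 1) * (P * (P * Q) ^ p.2.card)) := by
        gcongr
        exact weight_le_one _
    _ = (P * Q * H) * (P * Q * H) ^ p.2.card := by ring
    _ ≤ (P * Q * H) * 1 := by gcongr; exact pow_le_one₀ (by positivity) ha
    _ = P * Q * H := mul_one _

/-- The size of a term of an expansion. The exponents balance: every vertex of the pruned part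
comes with one factor `P * Q` from the elementary differential and one factor `H` from `Y`. -/
theorem norm_cutSum_smul_le (hP : 0 ≤ P) (hQ : 0 ≤ Q) (hH : 0 ≤ H)
    (hY : ∀ σ, |Y σ| ≤ H ^ σ.card) {τ : PlaneForest n}
    (hτ : ‖elemDiff f τ x‖ ≤ P * (P * Q) ^ τ.card) (ρ : PlaneForest n) :
    ‖(weight τ * cutSum Y τ ρ) • elemDiff f τ x‖ ≤
      (coproduct τ).length * (P * (P * Q) ^ ρ.card * (P * Q * H) ^ (τ.card - ρ.card)) := by
  rcases lt_or_ge τ.card ρ.card with hlt | hle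
  · rw [cutSum_eq_zero hlt, mul_zero, zero_smul_operator, norm_zero]
    positivity
  · rw [norm_smul, Real.norm_eq_abs, abs_mul, abs_of_nonneg (weight_nonneg _)]
    calc weight τ * |cutSum Y τ ρ| * ‖elemDiff f τ x‖
        ≤ 1 * ((coproduct τ).length * H ^ (τ.card - ρ.card)) * (P * (P * Q) ^ τ.card) := by
          gcongr
          · exact weight_le_one _
          · exact abs_cutSum_le hH hY τ ρ
      _ = _ := by
          obtain ⟨k, hk⟩ := Nat.exists_eq_add_of_le hle
          rw [hk, Nat.add_sub_cancel_left]
          ring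

/-- The number of terms in the coproducts of the forests with fewer than `N` vertices. -/
noncomputable def cutCount (n N : ℕ) : ℝ := ∑ τ ∈ lowOrder n N, ((coproduct τ).length : ℝ)

theorem cutCount_nonneg (n N : ℕ) : 0 ≤ cutCount n N := Finset.sum_nonneg fun _ _ => by positivity

theorem norm_expansion_le (hP : 0 ≤ P) (hQ : 0 ≤ Q) (hH : 0 ≤ H) (h : DerivBound N P Q f x)
    (hY : ∀ σ, |Y σ| ≤ H ^ σ.card) (ha : P * Q * H ≤ 1) (ρ : PlaneForest n) :
    ‖expansion N Y f x ρ‖ ≤ cutCount n N * (P * (P * Q) ^ ρ.card) := by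
  rw [expansion, cutCount, Finset.sum_mul]
  refine (norm_sum_le _ _).trans (Finset.sum_le_sum fun τ hτ => ?_)
  refine (norm_cutSum_smul_le hP hQ hH hY
    (norm_elemDiff_le hP hQ h (mem_lowOrder.1 hτ).le) ρ).trans ?_
  refine mul_le_mul_of_nonneg_left ?_ (by positivity)
  exact mul_le_of_le_one_right (by positivity) (pow_le_one₀ (by positivity) ha)

theorem norm_expansion_single_le (hP : 0 ≤ P) (hQ : 0 ≤ Q) (hH : 0 ≤ H)
    (h : DerivBound N P Q f x) (hY : ∀ σ, |Y σ| ≤ H ^ σ.card) (ha : P * Q * H ≤ 1)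
    (ρ : PlaneForest n) (i : Fin n) :
    Q * ‖expansion N Y f x ρ (EuclideanSpace.single i 1)‖ ≤
      cutCount n N * (P * Q) ^ (ρ.card + 1) := by
  calc _ ≤ Q * (cutCount n N * (P * (P * Q) ^ ρ.card)) := by
        gcongr
        exact (norm_apply_single_le _ i).trans (norm_expansion_le hP hQ hH h hY ha ρ)
    _ = _ := by ring

theorem normProd_expansionVectors_le (hP : 0 ≤ P) (hQ : 0 ≤ Q) (hH : 0 ≤ H)
    (h : DerivBound N P Q f x) (hY : ∀ σ, |Y σ| ≤ H ^ σ.card) (ha : P * Q * H ≤ 1)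
    (ρ : PlaneForest n) :
    normProd Q (expansionVectors N Y f x ρ) ≤ cutCount n N ^ ρ.width * (P * Q) ^ ρ.card := by
  have hc := cutCount_nonneg n N
  induction ρ with
  | nil => simp [expansionVectors, normProd, card, width]
  | cons i σ τ _ ih =>
    rw [expansionVectors, normProd_cons, card, width]
    calc _ ≤ cutCount n N * (P * Q) ^ (σ.card + 1) *
          (cutCount n N ^ τ.width * (P * Q) ^ τ.card) := by
          exact mul_le_mul (norm_expansion_single_le hP hQ hH h hY ha σ i) ih
            (normProd_nonneg hQ _) (by positivity)
      _ = _ := by rw [pow_succ, pow_add (P * Q) (σ.card + 1)]; ring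

end Bounds

/-! ### The remainder of the expansion along an increment -/

section Remainder

variable {m n : ℕ}

/-- The point `y` is reached from `x` by the increment driven by the character `Y`, up to an error
`r`. Lengths are measured in units of `1 / Q`, on the segment from `x` to `y` the derivatives of
`f` of order `ℓ` are bounded by `P * Q ^ ℓ`, and `Y` has size `H` per vertex. -/
structure NearIncrement (N : ℕ)
    (f : EuclideanSpace ℝ (Fin m) → EuclideanSpace ℝ (Fin n) →L[ℝ] EuclideanSpace ℝ (Fin m))
    (Y : PlaneForest n → ℝ) (x y : EuclideanSpace ℝ (Fin m)) (P Q H r : ℝ) : Prop where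
  contDiff : ContDiff ℝ N f
  isCharacter : IsCharacter Y
  P_nonneg : 0 ≤ P
  Q_nonneg : 0 ≤ Q
  H_nonneg : 0 ≤ H
  r_nonneg : 0 ≤ r
  abs_le : ∀ σ, |Y σ| ≤ H ^ σ.card
  small : P * Q * H ≤ 1
  derivBound : ∀ t ∈ Set.Icc (0 : ℝ) 1, DerivBound N P Q f (x + t • (y - x))
  dist_le : Q * ‖y - x‖ ≤ 2
  error_le : Q * ‖y - x - increment N Y f x‖ ≤ r

variable {N : ℕ}
  {f : EuclideanSpace ℝ (Fin m) → EuclideanSpace ℝ (Fin n) →L[ℝ] EuclideanSpace ℝ (Fin m)}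
  {Y : PlaneForest n → ℝ} {x y : EuclideanSpace ℝ (Fin m)} {P Q H r : ℝ}

theorem NearIncrement.left (h : NearIncrement N f Y x y P Q H r) : DerivBound N P Q f x := by
  simpa using h.derivBound 0 (by simp)

theorem NearIncrement.right (h : NearIncrement N f Y x y P Q H r) : DerivBound N P Q f y := by
  simpa using h.derivBound 1 (by simp)

/-- The order of magnitude of the remainder of an expansion with trunk `ρ`, where `a` is the size
of the increment. -/
noncomputable def errorSize (N : ℕ) (P Q H r : ℝ) (ρ : PlaneForest n) : ℝ :=
  (P * Q) ^ ρ.card * ((P * Q * H) ^ (N - ρ.card) + r)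

theorem pow_le_of_le_add {K a r s : ℝ} (hK : 0 ≤ K) (ha₀ : 0 ≤ a) (hr : 0 ≤ r)
    (hs₀ : 0 ≤ s) (hs : s ≤ K * a + r) (hs₂ : s ≤ 2) {k : ℕ} (hk : 1 ≤ k) :
    s ^ k ≤ (K + 2) ^ k * (a ^ k + r) := by
  rcases le_total r 1 with h | h
  · have h₁ : s ≤ (K + 2) * max a r := by
      have := le_max_left a r
      have := le_max_right a r
      nlinarith
    have h₂ : (max a r) ^ k ≤ a ^ k + r := by
      rcases max_choice a r with h' | h' <;> rw [h']
      · linarith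
      · have : r ^ k ≤ r := pow_le_of_le_one hr h (by omega)
        have : 0 ≤ a ^ k := by positivity
        linarith
    calc s ^ k ≤ ((K + 2) * max a r) ^ k := by gcongr
      _ = (K + 2) ^ k * (max a r) ^ k := mul_pow _ _ _
      _ ≤ _ := by gcongr
  · have h₁ : s ^ k ≤ (K + 2) ^ k := by gcongr; linarith
    have h₂ : 0 ≤ a ^ k := by positivity
    refine h₁.trans (le_mul_of_one_le_right (by positivity) (by linarith))

/-- Replacing the weighted branches of `ρ` at the new point by their expansions, in the arguments of
an iterated derivative. -/
def BranchEstimate (m : ℕ) (N : ℕ) (ρ : PlaneForest n) : Prop :=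
  ∃ C : ℝ, 0 ≤ C ∧
    ∀ (f : EuclideanSpace ℝ (Fin m) → EuclideanSpace ℝ (Fin n) →L[ℝ] EuclideanSpace ℝ (Fin m))
      (Y : PlaneForest n → ℝ) (x y : EuclideanSpace ℝ (Fin m)) (P Q H r : ℝ),
      NearIncrement N f Y x y P Q H r →
      ∀ (z : EuclideanSpace ℝ (Fin m)) (l : List (EuclideanSpace ℝ (Fin m))),
        DerivBound N P Q f z → ρ.width + l.length ≤ N →
        ‖iterD f z (weightedVectors f y ρ ++ l) - iterD f z (expansionVectors N Y f x ρ ++ l)‖ ≤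
          C * (P * errorSize N P Q H r ρ * normProd Q l)

/-- The elementary differential `f^ρ` at the new point is given by its expansion, up to the error
expected from the number of vertices. -/
def ExpansionEstimate (m : ℕ) (N : ℕ) (ρ : PlaneForest n) : Prop :=
  ∃ C : ℝ, 0 ≤ C ∧
    ∀ (f : EuclideanSpace ℝ (Fin m) → EuclideanSpace ℝ (Fin n) →L[ℝ] EuclideanSpace ℝ (Fin m))
      (Y : PlaneForest n → ℝ) (x y : EuclideanSpace ℝ (Fin m)) (P Q H r : ℝ),
      NearIncrement N f Y x y P Q H r →
        ‖weight ρ • elemDiff f ρ y - expansion N Y f x ρ‖ ≤ C * (P * errorSize N P Q H r ρ)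

theorem errorSize_nonneg (hP : 0 ≤ P) (hQ : 0 ≤ Q) (hH : 0 ≤ H) (hr : 0 ≤ r)
    (ρ : PlaneForest n) : 0 ≤ errorSize N P Q H r ρ := by unfold errorSize; positivity

theorem errorSize_mul_le (hP : 0 ≤ P) (hQ : 0 ≤ Q) (hH : 0 ≤ H) (ha : P * Q * H ≤ 1)
    {ρ ρ' : PlaneForest n} {k : ℕ} (h : ρ'.card = ρ.card + k) :
    errorSize N P Q H r ρ * (P * Q) ^ k ≤ errorSize N P Q H r ρ' := by
  rw [errorSize, errorSize, mul_right_comm, ← pow_add, ← h]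
  have : (P * Q * H) ^ (N - ρ.card) ≤ (P * Q * H) ^ (N - ρ'.card) :=
    pow_le_pow_of_le_one (by positivity) ha (by omega)
  gcongr

theorem BranchEstimate.cons (i : Fin n) {σ τ : PlaneForest n} (hc : σ.card + 1 + τ.card ≤ N)
    (hσ : ExpansionEstimate m N σ) (hτ : BranchEstimate m N τ) :
    BranchEstimate m N (.cons i σ τ) := by
  obtain ⟨Cσ, hCσ, hσ⟩ := hσ
  obtain ⟨Cτ, hCτ, hτ⟩ := hτ
  have hcut := cutCount_nonneg n N
  refine ⟨Cσ + Cτ * cutCount n N, by positivity, fun f Y x y P Q H r h z l hz hl => ?_⟩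
  have hP := h.P_nonneg
  have hQ := h.Q_nonneg
  have hH := h.H_nonneg
  have hr := h.r_nonneg
  simp only [width] at hl
  set u : EuclideanSpace ℝ (Fin m) := (weight σ • elemDiff f σ y) (EuclideanSpace.single i 1) with hu
  set v : EuclideanSpace ℝ (Fin m) := expansion N Y f x σ (EuclideanSpace.single i 1) with hv
  set U := weightedVectors f y τ with hU
  set V := expansionVectors N Y f x τ with hV
  have hUl : U.length = τ.width := length_weightedVectors _ _
  have hVl : V.length = τ.width := length_expansionVectors _ _ _ _
  have hl0 := normProd_nonneg hQ l
  have e₁ : iterD f z (u :: U ++ l) - iterD f z (v :: U ++ l) =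
      iterD f z ((u - v) :: (U ++ l)) := ((iterDLin f z (U ++ l)).map_sub u v).symm
  have e₂ : ∀ W : List (EuclideanSpace ℝ (Fin m)), W.length = τ.width →
      iterD f z (v :: W ++ l) = iterD f z (W ++ v :: l) := fun W hW =>
    iterD_perm h.contDiff List.perm_middle.symm (by simp; omega) z
  have b₁ := hz.norm_iterD_le (l := (u - v) :: (U ++ l)) (by simp; omega)
  have b₂ := hτ f Y x y P Q H r h z (v :: l) hz (by simp; omega)
  have huv : ‖u - v‖ ≤ Cσ * (P * errorSize N P Q H r σ) :=
    (norm_apply_single_le (weight σ • elemDiff f σ y - expansion N Y f x σ) i).trans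
      (hσ f Y x y P Q H r h)
  have hvb := norm_expansion_single_le hP hQ hH h.left h.abs_le h.small σ i
  have hUb := normProd_weightedVectors_le hP hQ h.right (τ := τ) (by omega)
  rw [normProd_cons, normProd_append] at b₁
  rw [normProd_cons] at b₂
  have hsz₁ := errorSize_mul_le (N := N) (r := r) hP hQ hH h.small
    (ρ := σ) (ρ' := .cons i σ τ) (k := 1 + τ.card) (by simp only [card]; omega)
  have hsz₂ := errorSize_mul_le (N := N) (r := r) hP hQ hH h.small
    (ρ := τ) (ρ' := .cons i σ τ) (k := σ.card + 1) (by simp only [card]; omega)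
  have hsσ := errorSize_nonneg (N := N) hP hQ hH hr σ
  have hsτ := errorSize_nonneg (N := N) hP hQ hH hr τ
  have c₁ : P * (Q * ‖u - v‖ * (normProd Q U * normProd Q l)) ≤
      Cσ * (P * errorSize N P Q H r (.cons i σ τ) * normProd Q l) := by
    calc _ ≤ P * (Q * (Cσ * (P * errorSize N P Q H r σ)) * ((P * Q) ^ τ.card * normProd Q l)) := by
          have := normProd_nonneg hQ U
          gcongr
      _ = Cσ * (P * (errorSize N P Q H r σ * (P * Q) ^ (1 + τ.card)) * normProd Q l) := by ring
      _ ≤ _ := by gcongr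
  have c₂ : Cτ * (P * errorSize N P Q H r τ * (Q * ‖v‖ * normProd Q l)) ≤
      Cτ * cutCount n N * (P * errorSize N P Q H r (.cons i σ τ) * normProd Q l) := by
    calc _ ≤ Cτ * (P * errorSize N P Q H r τ *
          (cutCount n N * (P * Q) ^ (σ.card + 1) * normProd Q l)) := by gcongr
      _ = Cτ * cutCount n N *
          (P * (errorSize N P Q H r τ * (P * Q) ^ (σ.card + 1)) * normProd Q l) := by ring
      _ ≤ _ := by gcongr
  rw [weightedVectors, expansionVectors, ← hu, ← hv, ← hU, ← hV,
    ← sub_add_sub_cancel _ (iterD f z (v :: U ++ l)), e₁, e₂ U hUl, e₂ V hVl, add_mul]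
  exact (norm_add_le _ _).trans (add_le_add (b₁.trans c₁) (b₂.trans c₂))

/-- Regrouping the Taylor expansion of `D^ℓ f` along the increment, applied to the expansions of the
branches of `ρ`, as a sum over forests. -/
theorem sum_replicate_increment_eq (hf : ContDiff ℝ N f) (hY : IsCharacter Y)
    (x : EuclideanSpace ℝ (Fin m)) (ρ : PlaneForest n) (hρ : ρ.width ≤ N) :
    ∑ j ∈ Finset.range (N - ρ.width), (1 / (ρ.width.factorial : ℝ) * (1 / (j.factorial : ℝ))) •
        iterD f x (List.replicate j (increment N Y f x) ++ expansionVectors N Y f x ρ) =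
      ∑ k ∈ Finset.range N, ∑ τ ∈ box n N k, (weight τ * cutSum Y τ ρ) • elemDiff f τ x := by
  have h : ∀ k ∈ Finset.range N,
      ∑ τ ∈ box n N k, (weight τ * cutSum Y τ ρ) • elemDiff f τ x =
      (1 / (k.factorial : ℝ) * (k.choose ρ.width : ℝ)) • iterD f x
        (List.replicate (k - ρ.width) (increment N Y f x) ++ expansionVectors N Y f x ρ) := by
    intro k hk
    have := sum_box_cutSum hf hY x k ρ [] (by simpa using (Finset.mem_range.1 hk).le)
    simp only [List.append_nil] at this
    rw [mul_smul, ← this, Finset.smul_sum]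
    refine Finset.sum_congr rfl fun τ hτ => ?_
    rw [smul_smul, elemDiff_eq, weight_eq, width_of_mem_box hτ, mul_assoc]
  rw [Finset.sum_congr rfl h]
  obtain ⟨K, rfl⟩ := Nat.exists_eq_add_of_le hρ
  rw [Nat.add_sub_cancel_left, Finset.sum_range_add, Finset.sum_eq_zero (s := Finset.range ρ.width),
    zero_add]
  · refine Finset.sum_congr rfl fun j _ => ?_
    rw [Nat.add_sub_cancel_left]
    congr 1
    rw [Nat.cast_choose ℝ (Nat.le_add_right _ _), Nat.add_sub_cancel_left]
    have h₁ : ((ρ.width + j).factorial : ℝ) ≠ 0 := by positivity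
    field_simp
  · intro k hk
    rw [Nat.choose_eq_zero_of_lt (Finset.mem_range.1 hk), Nat.cast_zero, mul_zero,
      zero_smul_operator]

theorem BranchEstimate.expansionEstimate {ρ : PlaneForest n} (hρ : ρ.card < N)
    (hb : BranchEstimate m N ρ) : ExpansionEstimate m N ρ := by
  classical
  obtain ⟨C₁, hC₁, hb⟩ := hb
  have hcut := cutCount_nonneg n N
  have hwc := width_le_card ρ
  set ℓ := ρ.width with hℓ
  set K := N - ℓ with hK
  set K₁ : ℝ := ((Finset.univ ×ˢ lowOrder n N : Finset (Fin n × PlaneForest n)).card : ℝ)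
  have hK₁ : 0 ≤ K₁ := Nat.cast_nonneg _
  set C₂ : ℝ := (K₁ + 2) ^ K * cutCount n N ^ ℓ
  set C₃ : ℝ := ∑ j ∈ Finset.range K, j * (K₁ + 2) ^ j * cutCount n N ^ ℓ
  set C₄ : ℝ := ∑ k ∈ Finset.range N, ∑ τ ∈ box n N k with N ≤ τ.card, ((coproduct τ).length : ℝ)
  refine ⟨C₁ + C₂ + C₃ + C₄, by positivity, fun f Y x y P Q H r h => ?_⟩
  have hP := h.P_nonneg
  have hQ := h.Q_nonneg
  have hH := h.H_nonneg
  have hr := h.r_nonneg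
  set a := P * Q * H with ha
  have ha₀ : 0 ≤ a := by positivity
  have ha₁ : a ≤ 1 := h.small
  set S := errorSize N P Q H r ρ with hS
  have hS0 : 0 ≤ S := errorSize_nonneg hP hQ hH hr ρ
  set v := increment N Y f x with hv
  set V := expansionVectors N Y f x ρ with hV
  have hVl : V.length = ℓ := length_expansionVectors _ _ _ _
  have hVb : normProd Q V ≤ cutCount n N ^ ℓ * (P * Q) ^ ρ.card :=
    normProd_expansionVectors_le hP hQ hH h.left h.abs_le h.small ρ
  have hV0 := normProd_nonneg hQ V
  have hvb : Q * ‖v‖ ≤ K₁ * a := norm_increment_le hP hQ hH h.left h.abs_le h.small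
  have hyx : Q * ‖y - x‖ ≤ K₁ * a + r := by
    calc Q * ‖y - x‖ = Q * ‖v + (y - x - v)‖ := by congr 2; abel
      _ ≤ Q * (‖v‖ + ‖y - x - v‖) := by gcongr; exact norm_add_le _ _
      _ = Q * ‖v‖ + Q * ‖y - x - v‖ := mul_add _ _ _
      _ ≤ _ := add_le_add hvb h.error_le
  have hfac : ∀ j : ℕ, 0 ≤ 1 / (j.factorial : ℝ) ∧ 1 / (j.factorial : ℝ) ≤ 1 := fun j =>
    ⟨by positivity, by
      rw [div_le_one (by positivity)]; exact_mod_cast Nat.succ_le_of_lt (Nat.factorial_pos j)⟩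
  -- The branches are replaced by their expansions.
  have s₁ : ‖iterD f y (weightedVectors f y ρ) - iterD f y V‖ ≤ C₁ * (P * S) := by
    have := hb f Y x y P Q H r h y [] h.right (by simp; omega)
    simpa [normProd_nil] using this
  -- The derivative at the new point is expanded by Taylor's formula.
  have s₂ : ‖iterD f y V - ∑ j ∈ Finset.range K,
      (1 / (j.factorial : ℝ)) • iterD f x (List.replicate j (y - x) ++ V)‖ ≤ C₂ * (P * S) := by
    have t := norm_iterD_taylor_le h.contDiff x (y - x) V K (by omega)
      (B := P * ((Q * ‖y - x‖) ^ K * normProd Q V)) (fun t ht => by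
        have := (h.derivBound t ht).norm_iterD_le (l := List.replicate K (y - x) ++ V)
          (by simp; omega)
        rwa [normProd_append, normProd_replicate] at this)
    rw [add_sub_cancel] at t
    refine t.trans ?_
    have hp := pow_le_of_le_add hK₁ ha₀ hr (by positivity) hyx h.dist_le
      (k := K) (by omega)
    have hak : a ^ K ≤ a ^ (N - ρ.card) := pow_le_pow_of_le_one ha₀ ha₁ (by omega)
    calc P * ((Q * ‖y - x‖) ^ K * normProd Q V)
        ≤ P * (((K₁ + 2) ^ K * (a ^ (N - ρ.card) + r)) *
            (cutCount n N ^ ℓ * (P * Q) ^ ρ.card)) := by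
          gcongr
          exact hp.trans (by gcongr)
      _ = C₂ * (P * S) := by rw [hS, errorSize]; ring
  -- The displacement is replaced by the increment driven by `Y`.
  have s₃ : ‖∑ j ∈ Finset.range K,
        (1 / (j.factorial : ℝ)) • iterD f x (List.replicate j (y - x) ++ V) -
      ∑ j ∈ Finset.range K, (1 / (j.factorial : ℝ)) • iterD f x (List.replicate j v ++ V)‖ ≤
      C₃ * (P * S) := by
    rw [← Finset.sum_sub_distrib, Finset.sum_mul]
    refine (norm_sum_le _ _).trans (Finset.sum_le_sum fun j hj => ?_)
    rw [← smul_sub_operator, norm_smul, Real.norm_of_nonneg (hfac j).1]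
    refine (mul_le_of_le_one_left (norm_nonneg _) (hfac j).2).trans ?_
    have hj' := Finset.mem_range.1 hj
    have := norm_iterD_replicate_sub_le hP hQ h.contDiff h.left (u := y - x) (v := v)
      (B := K₁ + 2) (r := r) (by linarith [h.dist_le]) (by nlinarith) (by linarith) h.error_le j V
      (by omega)
    refine this.trans ?_
    have hrS : (P * Q) ^ ρ.card * r ≤ S := by
      rw [hS, errorSize]; gcongr; linarith [pow_nonneg ha₀ (N - ρ.card)]
    calc j * (K₁ + 2) ^ j * (P * r * normProd Q V)
        ≤ j * (K₁ + 2) ^ j * (P * r * (cutCount n N ^ ℓ * (P * Q) ^ ρ.card)) := by gcongr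
      _ = j * (K₁ + 2) ^ j * cutCount n N ^ ℓ * (P * ((P * Q) ^ ρ.card * r)) := by ring
      _ ≤ _ := by gcongr
  -- The forests with `N` vertices or more contribute to the error only.
  have s₄ : ‖∑ j ∈ Finset.range K, (1 / (ℓ.factorial : ℝ) * (1 / (j.factorial : ℝ))) •
        iterD f x (List.replicate j v ++ V) - expansion N Y f x ρ‖ ≤ C₄ * (P * S) := by
    rw [sum_replicate_increment_eq h.contDiff h.isCharacter x ρ (by omega), sum_box_eq, expansion,
      add_sub_cancel_left, Finset.sum_mul]
    refine (norm_sum_le _ _).trans (Finset.sum_le_sum fun k hk => ?_)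
    rw [Finset.sum_mul]
    refine (norm_sum_le _ _).trans (Finset.sum_le_sum fun τ hτ => ?_)
    obtain ⟨hτ₁, hτ₂⟩ := Finset.mem_filter.1 hτ
    refine (norm_cutSum_smul_le hP hQ hH h.abs_le
      (norm_elemDiff_le_of_mem_box hP hQ h.left (Finset.mem_range.1 hk).le hτ₁) ρ).trans ?_
    refine mul_le_mul_of_nonneg_left ?_ (by positivity)
    rw [mul_assoc]
    refine mul_le_mul_of_nonneg_left ?_ hP
    rw [hS, errorSize]
    refine mul_le_mul_of_nonneg_left ?_ (by positivity)
    have : a ^ (τ.card - ρ.card) ≤ a ^ (N - ρ.card) := pow_le_pow_of_le_one ha₀ ha₁ (by omega)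
    linarith
  have e : weight ρ • elemDiff f ρ y =
      (1 / (ℓ.factorial : ℝ)) • iterD f y (weightedVectors f y ρ) := by
    have := iterD_weightedVectors h.contDiff y y ρ [] (by simp; omega)
    simp only [List.append_nil] at this
    rw [this, smul_smul, weight_eq, elemDiff_eq]
  have e' : ∑ j ∈ Finset.range K, (1 / (ℓ.factorial : ℝ) * (1 / (j.factorial : ℝ))) •
      iterD f x (List.replicate j v ++ V) = (1 / (ℓ.factorial : ℝ)) •
      ∑ j ∈ Finset.range K, (1 / (j.factorial : ℝ)) • iterD f x (List.replicate j v ++ V) := by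
    rw [Finset.smul_sum]
    exact Finset.sum_congr rfl fun j _ => mul_smul _ _ _
  rw [e'] at s₄
  rw [e]
  have s₅ : ‖iterD f y (weightedVectors f y ρ) -
      ∑ j ∈ Finset.range K, (1 / (j.factorial : ℝ)) • iterD f x (List.replicate j v ++ V)‖ ≤
      (C₁ + C₂ + C₃) * (P * S) := by
    rw [add_mul, add_mul]
    exact (norm_sub_le_norm_sub_add_norm_sub _ _ _).trans (add_le_add
      ((norm_sub_le_norm_sub_add_norm_sub _ _ _).trans (add_le_add s₁ s₂)) s₃)
  rw [add_mul (C₁ + C₂ + C₃)]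
  refine (norm_sub_le_norm_sub_add_norm_sub _ ((1 / (ℓ.factorial : ℝ)) • ∑ j ∈ Finset.range K,
    (1 / (j.factorial : ℝ)) • iterD f x (List.replicate j v ++ V)) _).trans (add_le_add ?_ s₄)
  rw [← smul_sub_operator, norm_smul, Real.norm_of_nonneg (hfac ℓ).1]
  exact (mul_le_of_le_one_left (norm_nonneg _) (hfac ℓ).2).trans s₅

theorem branchEstimate {ρ : PlaneForest n} (hρ : ρ.card ≤ N) : BranchEstimate m N ρ := by
  induction ρ with
  | nil =>
    refine ⟨0, le_rfl, fun f Y x y P Q H r _ z l _ _ => ?_⟩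
    simp [weightedVectors, expansionVectors]
  | cons i σ τ ih₁ ih₂ =>
    simp only [card] at hρ
    exact BranchEstimate.cons i hρ
      ((ih₁ (by omega)).expansionEstimate (by omega)) (ih₂ (by omega))

/-- The expansion estimate, with one constant for all forests with fewer than `N` vertices. -/
theorem exists_expansion_bound (m n N : ℕ) : ∃ C : ℝ, 0 ≤ C ∧
    ∀ (f : EuclideanSpace ℝ (Fin m) → EuclideanSpace ℝ (Fin n) →L[ℝ] EuclideanSpace ℝ (Fin m))
      (Y : PlaneForest n → ℝ) (x y : EuclideanSpace ℝ (Fin m)) (P Q H r : ℝ),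
      NearIncrement N f Y x y P Q H r → ∀ ρ ∈ lowOrder n N,
        ‖weight ρ • elemDiff f ρ y - expansion N Y f x ρ‖ ≤ C * (P * errorSize N P Q H r ρ) := by
  have h : ∀ ρ ∈ lowOrder n N, ExpansionEstimate m N ρ := fun ρ hρ =>
    (branchEstimate (mem_lowOrder.1 hρ).le).expansionEstimate (mem_lowOrder.1 hρ)
  choose! C hC hb using h
  refine ⟨∑ ρ ∈ lowOrder n N, C ρ, Finset.sum_nonneg hC, fun f Y x y P Q H r h ρ hρ => ?_⟩
  refine (hb ρ hρ f Y x y P Q H r h).trans ?_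
  have := errorSize_nonneg (N := N) h.P_nonneg h.Q_nonneg h.H_nonneg h.r_nonneg ρ
  have := h.P_nonneg
  gcongr
  exact Finset.single_le_sum (f := C) hC hρ

end Remainder

/-! ### The increments of the Euler scheme -/

section Euler

variable {m n : ℕ} {γ : ℝ}
  {f : EuclideanSpace ℝ (Fin m) → EuclideanSpace ℝ (Fin n) →L[ℝ] EuclideanSpace ℝ (Fin m)}

namespace BranchedRoughPath

/-- The increment of the rough path from `s` to `t`, as a character of plane forests. -/
noncomputable def character (X : BranchedRoughPath n γ) (s t : ℝ) : PlaneForest n → ℝ :=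
  extend (level γ) fun τ => X.toFun τ.toForest s t

variable (X : BranchedRoughPath n γ) {s u t : ℝ}

theorem isCharacter_character (s t : ℝ) : IsCharacter (X.character s t) := isCharacter_extend _ _

theorem character_eq (hs : s ∈ Set.Icc (-1 : ℝ) 0) (ht : t ∈ Set.Icc (-1 : ℝ) 0)
    {τ : PlaneForest n} (hτ : τ.card ≤ level γ) : X.character s t τ = X.toFun τ.toForest s t :=
  extend_eq (X.map_one s hs t ht) (fun σ τ h => X.map_mul σ τ h s hs t ht) hτ

theorem character_graft {τ : PlaneForest n} (hτ : τ.card < level γ) (i : Fin n) :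
    X.character s t (graft i τ) = X.toFun (graft i τ).toForest s t := by
  simp [character, graft, extend, hτ]

theorem graftVec_eq_sum (τ : PlaneForest n) (s t : ℝ) :
    X.graftVec τ s t =
      ∑ i, X.toFun (graft i τ).toForest s t • EuclideanSpace.single i (1 : ℝ) := by
  ext j
  simp [graftVec, Finset.sum_apply, Pi.single_apply]

/-- Chen's relation for the trees `[τ]_i`, with the terms grouped by the trunk. -/
theorem graftVec_chen (hs : s ∈ Set.Icc (-1 : ℝ) 0) (hu : u ∈ Set.Icc (-1 : ℝ) 0)
    (ht : t ∈ Set.Icc (-1 : ℝ) 0) {τ : PlaneForest n} (hτ : τ.card < level γ) :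
    X.graftVec τ s t = X.graftVec τ s u +
      ∑ ρ ∈ lowOrder n (level γ), cutSum (X.character s u) τ ρ • X.graftVec ρ u t := by
  ext i
  have h₁ := X.chen (graft i τ) (by rw [card_graft]; omega) s hs u hu t ht
  have h₂ : ((coproduct τ).map fun c => X.toFun c.1.toForest s u *
      X.toFun (graft i c.2).toForest u t).sum =
      ∑ ρ ∈ lowOrder n (level γ), cutSum (X.character s u) τ ρ *
        X.toFun (graft i ρ).toForest u t := by
    rw [← sum_coproduct_eq hτ fun ρ => X.toFun (graft i ρ).toForest u t]
    congr 1
    refine List.map_congr_left fun c hc => ?_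
    have := card_add_card_of_mem_coproduct hc
    rw [X.character_eq hs hu (by omega)]
  have h₃ : X.toFun (graft i τ).toForest s t = X.toFun (graft i τ).toForest s u +
      ((coproduct τ).map fun c => X.toFun c.1.toForest s u *
        X.toFun (graft i c.2).toForest u t).sum := by
    rw [h₁]
    simp only [graft, coproduct, List.flatMap_cons, List.flatMap_nil, List.append_nil,
      List.map_cons, List.sum_cons, List.map_map, PlaneForest.mul_nil]
    rw [X.map_one u hu t ht, mul_one]
    rfl
  simp only [graftVec, PiLp.add_apply, WithLp.ofLp_sum, WithLp.ofLp_smul, Finset.sum_apply,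
    Pi.smul_apply, smul_eq_mul]
  rw [h₃, h₂]

theorem norm_graftVec_le {H : ℝ}
    (hX : ∀ τ : PlaneForest n, 1 ≤ τ.card → τ.card ≤ level γ →
      |X.toFun τ.toForest s t| ≤ H ^ τ.card)
    {τ : PlaneForest n} (hτ : τ.card < level γ) :
    ‖X.graftVec τ s t‖ ≤ n * H ^ (τ.card + 1) := by
  rw [graftVec_eq_sum]
  refine (norm_sum_le _ _).trans ?_
  refine (Finset.sum_le_card_nsmul _ _ (H ^ (τ.card + 1)) fun i _ => ?_).trans (by simp)
  have := hX (graft i τ) (by rw [card_graft]; omega) (by rw [card_graft]; omega)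
  rw [card_graft] at this
  rw [norm_smul]
  simpa using this

theorem abs_character_le {H : ℝ} (hH : 0 ≤ H)
    (hX : ∀ τ : PlaneForest n, 1 ≤ τ.card → τ.card ≤ level γ →
      |X.toFun τ.toForest s t| ≤ H ^ τ.card) (τ : PlaneForest n) :
    |X.character s t τ| ≤ H ^ τ.card := abs_extend_le hH hX τ

end BranchedRoughPath

variable (X : BranchedRoughPath n γ)

theorem eulerIncrement_eq (x : EuclideanSpace ℝ (Fin m)) (s t : ℝ) :
    eulerIncrement f X x s t =
      ∑ τ ∈ lowOrder n (level γ), (weight τ • elemDiff f τ x) (X.graftVec τ s t) := rfl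

theorem eulerIncrement_eq_increment (x : EuclideanSpace ℝ (Fin m)) (s t : ℝ) :
    eulerIncrement f X x s t = increment (level γ) (X.character s t) f x := by
  rw [eulerIncrement_eq, increment, Finset.sum_product_right]
  refine Finset.sum_congr rfl fun τ hτ => ?_
  rw [X.graftVec_eq_sum, map_sum]
  refine Finset.sum_congr rfl fun i _ => ?_
  rw [X.character_graft (mem_lowOrder.1 hτ), map_smul, mul_smul, smul_comm]
  rfl

/-- The defect of additivity of the Euler scheme is made of the errors of the expansions of the
elementary differentials. -/
theorem eulerIncrement_sub {s u t : ℝ} (hs : s ∈ Set.Icc (-1 : ℝ) 0)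
    (hu : u ∈ Set.Icc (-1 : ℝ) 0) (ht : t ∈ Set.Icc (-1 : ℝ) 0) (x y : EuclideanSpace ℝ (Fin m)) :
    eulerIncrement f X x s t - eulerIncrement f X x s u - eulerIncrement f X y u t =
      -∑ ρ ∈ lowOrder n (level γ), (weight ρ • elemDiff f ρ y -
        expansion (level γ) (X.character s u) f x ρ) (X.graftVec ρ u t) := by
  have h : eulerIncrement f X x s t = eulerIncrement f X x s u +
      ∑ ρ ∈ lowOrder n (level γ),
        expansion (level γ) (X.character s u) f x ρ (X.graftVec ρ u t) := by
    simp only [eulerIncrement_eq, expansion, sum_apply]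
    rw [Finset.sum_comm, ← Finset.sum_add_distrib]
    refine Finset.sum_congr rfl fun τ hτ => ?_
    rw [X.graftVec_chen hs hu ht (mem_lowOrder.1 hτ), map_add, map_sum]
    congr 1
    refine Finset.sum_congr rfl fun ρ _ => ?_
    rw [map_smul, smul_apply, smul_apply, smul_smul, mul_comm]
  rw [h]
  simp only [sub_apply, Finset.sum_sub_distrib, eulerIncrement_eq]
  abel

/-- The additivity defect of the Euler scheme along a path that follows the scheme up to an
error `r`. -/
theorem exists_eulerIncrement_sub_bound (m n : ℕ) (γ : ℝ) : ∃ C : ℝ, 0 ≤ C ∧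
    ∀ (f : EuclideanSpace ℝ (Fin m) → EuclideanSpace ℝ (Fin n) →L[ℝ] EuclideanSpace ℝ (Fin m))
      (X : BranchedRoughPath n γ) (s u t : ℝ) (x y : EuclideanSpace ℝ (Fin m)) (P Q H r : ℝ),
      s ∈ Set.Icc (-1 : ℝ) 0 → u ∈ Set.Icc (-1 : ℝ) 0 → t ∈ Set.Icc (-1 : ℝ) 0 →
      NearIncrement (level γ) f (X.character s u) x y P Q H r →
      (∀ τ : PlaneForest n, 1 ≤ τ.card → τ.card ≤ level γ →
        |X.toFun τ.toForest u t| ≤ H ^ τ.card) →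
      Q * ‖eulerIncrement f X x s t - eulerIncrement f X x s u - eulerIncrement f X y u t‖ ≤
        C * ((P * Q * H) ^ (level γ + 1) + P * Q * H * r) := by
  obtain ⟨C, hC, hb⟩ := exists_expansion_bound m n (level γ)
  refine ⟨∑ ρ ∈ lowOrder n (level γ), C * n, Finset.sum_nonneg fun _ _ => by positivity,
    fun f X s u t x y P Q H r hs hu ht h hX => ?_⟩
  have hP := h.P_nonneg
  have hQ := h.Q_nonneg
  have hH := h.H_nonneg
  have hr := h.r_nonneg
  rw [eulerIncrement_sub X hs hu ht, norm_neg, Finset.sum_mul]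
  refine (mul_le_mul_of_nonneg_left (norm_sum_le _ _) hQ).trans ?_
  rw [Finset.mul_sum]
  refine Finset.sum_le_sum fun ρ hρ => ?_
  have hρ' := mem_lowOrder.1 hρ
  have h₁ := hb f _ x y P Q H r h ρ hρ
  have h₂ := X.norm_graftVec_le hX hρ'
  have h₀ := errorSize_nonneg (N := level γ) hP hQ hH hr ρ
  obtain ⟨k, hk⟩ := Nat.exists_eq_add_of_lt hρ'
  have h₃ : (P * Q * H) ^ ρ.card ≤ 1 := pow_le_one₀ (by positivity) h.small
  calc Q * ‖_‖ ≤ Q * (C * (P * errorSize (level γ) P Q H r ρ) * (n * H ^ (ρ.card + 1))) := by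
        gcongr
        exact (ContinuousLinearMap.le_opNorm _ _).trans (by gcongr)
    _ = C * n * ((P * Q * H) ^ (level γ + 1) + P * Q * H * r * (P * Q * H) ^ ρ.card) := by
        have : level γ - ρ.card = k + 1 := by omega
        rw [errorSize, this, hk]
        ring
    _ ≤ C * n * ((P * Q * H) ^ (level γ + 1) + P * Q * H * r) := by
        refine mul_le_mul_of_nonneg_left (add_le_add le_rfl ?_) (by positivity)
        exact mul_le_of_le_one_right (by positivity) h₃

end Euler

/-! ### Sewing -/

/-- A two-parameter function whose defect of additivity is of order `β > 1` and which is
infinitesimal with respect to `t - s` is of order `β`. The defect may contain the function itself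
with a small factor; times are measured in units of `h₀`. -/
theorem exists_sewing_bound {β γ C : ℝ} (hγ : 0 < γ) (hβ : 1 < β) (hβγ : β ≤ 1 + γ) (hC : 0 ≤ C) :
    ∃ κ A : ℝ, 0 < κ ∧ κ ≤ 1 ∧ 0 ≤ A ∧ ∀ (h₀ s₀ s₁ : ℝ) (R : ℝ → ℝ → ℝ), 0 < h₀ →
      s₁ - s₀ ≤ κ * h₀ →
      (∀ s u t, s₀ ≤ s → s < u → u < t → t ≤ s₁ →
        R s t ≤ R s u + R u t + C * (((t - s) / h₀) ^ β + ((t - s) / h₀) ^ γ * R s u)) →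
      (∀ ε > 0, ∃ δ > 0, ∀ s t, s₀ ≤ s → s < t → t ≤ s₁ → t - s ≤ δ → R s t ≤ ε * (t - s)) →
      ∀ s t, s₀ ≤ s → s < t → t ≤ s₁ → R s t ≤ A * ((t - s) / h₀) ^ β := by
  set μ : ℝ := (1 - 2 * (1 / 2 : ℝ) ^ β) / 2 with hμ
  have hhalf : (1 / 2 : ℝ) ^ β < 1 / 2 := by
    simpa using Real.rpow_lt_rpow_of_exponent_gt (x := (1 / 2 : ℝ)) (by norm_num) (by norm_num) hβ
  have hhalf0 : 0 < (1 / 2 : ℝ) ^ β := by positivity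
  have hμ0 : 0 < μ := by rw [hμ]; linarith
  set κ : ℝ := min 1 ((μ / (C + 1)) ^ (1 / γ)) with hκ
  have hκ0 : 0 < κ := lt_min one_pos (by positivity)
  have hκγ : C * κ ^ γ ≤ μ := by
    have h₁ : κ ^ γ ≤ μ / (C + 1) := by
      calc κ ^ γ ≤ ((μ / (C + 1)) ^ (1 / γ)) ^ γ :=
            Real.rpow_le_rpow hκ0.le (min_le_right _ _) hγ.le
        _ = μ / (C + 1) := by
            rw [← Real.rpow_mul (by positivity), one_div_mul_cancel hγ.ne', Real.rpow_one]
    calc C * κ ^ γ ≤ (C + 1) * (μ / (C + 1)) := by gcongr; linarith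
      _ = μ := by field_simp
  refine ⟨κ, C / μ, hκ0, min_le_left _ _, by positivity, fun h₀ s₀ s₁ R hh hlen hR ho => ?_⟩
  -- Bisection propagates the bound, up to `ε`, from short to long intervals.
  have key : ∀ ε > 0, ∀ s t, s₀ ≤ s → s < t → t ≤ s₁ →
      R s t ≤ C / μ * (1 + ε) * ((t - s) / h₀) ^ β + ε * ((t - s) / h₀) := by
    intro ε hε
    obtain ⟨δ, hδ, hsmall⟩ := ho (ε / h₀) (by positivity)
    have main : ∀ k : ℕ, ∀ s t, s₀ ≤ s → s < t → t ≤ s₁ → t - s ≤ 2 ^ k * δ →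
        R s t ≤ C / μ * (1 + ε) * ((t - s) / h₀) ^ β + ε * ((t - s) / h₀) := by
      intro k
      induction k with
      | zero =>
        intro s t hs hst ht hd
        have h₁ := hsmall s t hs hst ht (by simpa using hd)
        have h₂ : 0 ≤ C / μ * (1 + ε) * ((t - s) / h₀) ^ β := by
          have : 0 ≤ (t - s) / h₀ := div_nonneg (by linarith) hh.le
          positivity
        have h₃ : ε / h₀ * (t - s) = ε * ((t - s) / h₀) := by ring
        linarith
      | succ k ih =>
        intro s t hs hst ht hd
        set u := (s + t) / 2 with hu
        have hd' : 2 ^ (k + 1) * δ = 2 * (2 ^ k * δ) := by ring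
        have i₁ := ih s u hs (by linarith) (by linarith) (by linarith)
        have i₂ := ih u t (by linarith) (by linarith) ht (by linarith)
        have i₃ := hR s u t hs (by linarith) (by linarith) ht
        set T := (t - s) / h₀ with hT
        have e₁ : (u - s) / h₀ = 1 / 2 * T := by rw [hu, hT]; ring
        have e₂ : (t - u) / h₀ = 1 / 2 * T := by rw [hu, hT]; ring
        have hT0 : 0 < T := div_pos (by linarith) hh
        have hTκ : T ≤ κ := by rw [hT, div_le_iff₀ hh]; linarith
        have hT1 : T ≤ 1 := hTκ.trans (min_le_left _ _)
        rw [e₁, Real.mul_rpow (by norm_num) hT0.le] at i₁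
        rw [e₂, Real.mul_rpow (by norm_num) hT0.le] at i₂
        have hTγ : C * T ^ γ ≤ μ :=
          (mul_le_mul_of_nonneg_left (Real.rpow_le_rpow hT0.le hTκ hγ.le) hC).trans hκγ
        have hTβ : T ^ γ * T ≤ T ^ β := by
          rw [← Real.rpow_add_one hT0.ne']
          exact Real.rpow_le_rpow_of_exponent_ge hT0 hT1 (by linarith)
        have hTβ0 : 0 < T ^ β := by positivity
        have hTγ0 : 0 < T ^ γ := by positivity
        set B := C / μ * (1 + ε) with hB
        have hB0 : 0 ≤ B := by positivity
        have hBμ : μ * B = C * (1 + ε) := by rw [hB]; field_simp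
        set p := (1 / 2 : ℝ) ^ β with hp
        have j₁ : C * (T ^ γ * R s u) ≤ μ * (B * T ^ β) + C * ε * T ^ β := by
          calc C * (T ^ γ * R s u) ≤ C * (T ^ γ * (B * (p * T ^ β) + ε * (1 / 2 * T))) := by gcongr
            _ = C * T ^ γ * (B * (p * T ^ β)) + C * ε * (1 / 2 * (T ^ γ * T)) := by ring
            _ ≤ μ * (B * (1 * T ^ β)) + C * ε * (1 * T ^ β) := by
                gcongr
                · linarith
                · norm_num
            _ = _ := by ring
        have hp2 : 2 * p = 1 - 2 * μ := by rw [hμ]; ring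
        have j₂ : B * (p * T ^ β) + B * (p * T ^ β) = B * T ^ β - 2 * (μ * B * T ^ β) := by
          linear_combination B * T ^ β * hp2
        have j₃ : μ * B * T ^ β = C * T ^ β + C * ε * T ^ β := by rw [hBμ]; ring
        nlinarith
    intro s t hs hst ht
    obtain ⟨k, hk⟩ := pow_unbounded_of_one_lt ((t - s) / δ) (one_lt_two : (1 : ℝ) < 2)
    exact main k s t hs hst ht (by rw [div_lt_iff₀ hδ] at hk; exact hk.le)
  intro s t hs hst ht
  have hlim : Filter.Tendsto (fun ε : ℝ => C / μ * (1 + ε) * ((t - s) / h₀) ^ β +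
      ε * ((t - s) / h₀)) (nhdsWithin 0 (Set.Ioi 0))
      (nhds (C / μ * (1 + 0) * ((t - s) / h₀) ^ β + 0 * ((t - s) / h₀))) := by
    refine Filter.Tendsto.mono_left ?_ nhdsWithin_le_nhds
    exact Continuous.tendsto (by fun_prop) 0
  have := ge_of_tendsto hlim (Filter.eventually_of_mem self_mem_nhdsWithin fun ε hε =>
    key ε hε s t hs hst ht)
  simpa using this

/-! ### The local estimate for solutions -/

section Local

theorem one_lt_mul_level_add_one {γ : ℝ} (hγ : 0 < γ) : 1 < γ * (level γ + 1) := by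
  have := Nat.lt_floor_add_one (1 / γ)
  rw [div_lt_iff₀ hγ] at this
  rw [level]; linarith

variable {m n : ℕ} {γ : ℝ}

/-- The path `φ` solves `dφ = b(φ) dt + f(φ) dX` on `[-1, 0]`, in the sense of Davie. -/
def IsDavieSolution (b : EuclideanSpace ℝ (Fin m) → EuclideanSpace ℝ (Fin m))
    (f : EuclideanSpace ℝ (Fin m) → EuclideanSpace ℝ (Fin n) →L[ℝ] EuclideanSpace ℝ (Fin m))
    (X : BranchedRoughPath n γ) (φ : ℝ → EuclideanSpace ℝ (Fin m)) : Prop :=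
  ∀ ε > 0, ∃ δ > 0, ∀ s t : ℝ, -1 ≤ s → s < t → t ≤ 0 → t - s ≤ δ →
    ‖φ t - φ s - ((t - s) • b (φ s) + eulerIncrement f X (φ s) s t)‖ ≤ ε * (t - s)

/-- Bounds in units of time `h₀` and length `1 / Q`, on the time interval `[s₀, s₁]` and the ball of
radius `1 / Q` about `c`: the drift has speed and Lipschitz constant at most `B`, and `f` and `X`
have the sizes `P` and `H`. -/
structure LocalBounds (B : ℝ) (b : EuclideanSpace ℝ (Fin m) → EuclideanSpace ℝ (Fin m))
    (f : EuclideanSpace ℝ (Fin m) → EuclideanSpace ℝ (Fin n) →L[ℝ] EuclideanSpace ℝ (Fin m))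
    (X : BranchedRoughPath n γ) (P Q H h₀ s₀ s₁ : ℝ) (c : EuclideanSpace ℝ (Fin m)) : Prop where
  contDiff : ContDiff ℝ (level γ) f
  P_nonneg : 0 ≤ P
  Q_pos : 0 < Q
  H_nonneg : 0 ≤ H
  h₀_pos : 0 < h₀
  left_le : -1 ≤ s₀
  le_right : s₁ ≤ 0
  derivBound : ∀ z ∈ Metric.closedBall c (1 / Q), DerivBound (level γ) P Q f z
  abs_le : ∀ τ : PlaneForest n, 1 ≤ τ.card → τ.card ≤ level γ → ∀ s t, s₀ ≤ s → s < t → t ≤ s₁ →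
    |X.toFun τ.toForest s t| ≤ (H * (t - s) ^ γ) ^ τ.card
  speed_le : ∀ z ∈ Metric.closedBall c (1 / Q), Q * ‖b z‖ ≤ B / h₀
  lipschitz : ∀ y ∈ Metric.closedBall c (1 / Q), ∀ z ∈ Metric.closedBall c (1 / Q),
    ‖b y - b z‖ ≤ B / h₀ * ‖y - z‖

theorem LocalBounds.mono {B : ℝ} {b : EuclideanSpace ℝ (Fin m) → EuclideanSpace ℝ (Fin m)}
    {f : EuclideanSpace ℝ (Fin m) → EuclideanSpace ℝ (Fin n) →L[ℝ] EuclideanSpace ℝ (Fin m)}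
    {X : BranchedRoughPath n γ} {P Q H h₀ s₀ s₁ s₂ : ℝ} {c : EuclideanSpace ℝ (Fin m)}
    (h : LocalBounds B b f X P Q H h₀ s₀ s₁ c) (hs : s₂ ≤ s₁) :
    LocalBounds B b f X P Q H h₀ s₀ s₂ c :=
  { h with
    le_right := hs.trans h.le_right
    abs_le := fun τ h₁ h₂ s t hs₀ hst ht => h.abs_le τ h₁ h₂ s t hs₀ hst (ht.trans hs) }

set_option maxHeartbeats 1000000 in
/-- While a solution stays in a ball of radius `1 / Q`, and for times short compared with `h₀`, it
moves by the drift up to the noise and a remainder of order larger than one. -/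
theorem exists_local_bound (m n : ℕ) {γ B : ℝ} (hγ₀ : 0 < γ) (hγ₁ : γ ≤ 1) (hB : 0 ≤ B) :
    ∃ β κ A : ℝ, 1 < β ∧ 0 < κ ∧ κ ≤ 1 ∧ 0 ≤ A ∧
    ∀ (b : EuclideanSpace ℝ (Fin m) → EuclideanSpace ℝ (Fin m))
      (f : EuclideanSpace ℝ (Fin m) → EuclideanSpace ℝ (Fin n) →L[ℝ] EuclideanSpace ℝ (Fin m))
      (X : BranchedRoughPath n γ) (φ : ℝ → EuclideanSpace ℝ (Fin m)) (P Q H h₀ s₀ s₁ : ℝ)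
      (c : EuclideanSpace ℝ (Fin m)),
      IsDavieSolution b f X φ → LocalBounds B b f X P Q H h₀ s₀ s₁ c →
      P * Q * (H * h₀ ^ γ) ≤ 1 → s₁ - s₀ ≤ κ * h₀ →
      (∀ t, s₀ ≤ t → t ≤ s₁ → φ t ∈ Metric.closedBall c (1 / Q)) →
      ∀ s t, s₀ ≤ s → s < t → t ≤ s₁ → Q * ‖φ t - φ s - (t - s) • b (φ s)‖ ≤
        A * (P * Q * (H * h₀ ^ γ) * ((t - s) / h₀) ^ γ + ((t - s) / h₀) ^ β) := by
  obtain ⟨C, hC, hdefect⟩ := exists_eulerIncrement_sub_bound m n γ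
  set N := level γ with hN
  set K : ℝ := ((Finset.univ ×ˢ lowOrder n N : Finset (Fin n × PlaneForest n)).card : ℝ) with hK
  have hK0 : 0 ≤ K := Nat.cast_nonneg _
  set β : ℝ := min (γ * (N + 1)) (1 + γ) with hβdef
  have hβ : 1 < β := lt_min (one_lt_mul_level_add_one hγ₀) (by linarith)
  have hβ₁ : β ≤ γ * (N + 1) := min_le_left _ _
  have hβ₂ : β ≤ 1 + γ := min_le_right _ _
  set C₁ : ℝ := C * (1 + B) + B * (K + B) + B with hC₁
  have hC₁0 : 0 ≤ C₁ := by positivity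
  obtain ⟨κ, A, hκ, hκ1, hA, hsew⟩ := exists_sewing_bound hγ₀ hβ hβ₂ hC₁0
  refine ⟨β, κ, K + A, hβ, hκ, hκ1, by positivity, ?_⟩
  intro b f X φ P Q H h₀ s₀ s₁ c hsol hL hsmall hlen hball
  have hP := hL.P_nonneg
  have hQ := hL.Q_pos
  have hH := hL.H_nonneg
  have hh := hL.h₀_pos
  set a₀ := P * Q * (H * h₀ ^ γ) with ha₀
  have ha₀0 : 0 ≤ a₀ := by positivity
  have hmem : ∀ t, s₀ ≤ t → t ≤ s₁ → t ∈ Set.Icc (-1 : ℝ) 0 := fun t h₁ h₂ =>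
    ⟨hL.left_le.trans h₁, h₂.trans hL.le_right⟩
  -- The size of the noise between times `s` and `t`.
  have hscale : ∀ s t, s < t → P * Q * (H * (t - s) ^ γ) = a₀ * ((t - s) / h₀) ^ γ := by
    intro s t hst
    rw [ha₀, Real.div_rpow (by linarith) hh.le]
    have : 0 < h₀ ^ γ := by positivity
    field_simp
  have hT : ∀ s t, s₀ ≤ s → s < t → t ≤ s₁ → 0 < (t - s) / h₀ ∧ (t - s) / h₀ ≤ 1 := by
    intro s t hs hst ht
    refine ⟨div_pos (by linarith) hh, ?_⟩
    rw [div_le_one hh]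
    nlinarith
  have hincr : ∀ s t, s₀ ≤ s → s < t → t ≤ s₁ → ∀ z ∈ Metric.closedBall c (1 / Q),
      Q * ‖eulerIncrement f X z s t‖ ≤ K * (a₀ * ((t - s) / h₀) ^ γ) := by
    intro s t hs hst ht z hz
    obtain ⟨hT0, hT1⟩ := hT s t hs hst ht
    have hH' : 0 ≤ H * (t - s) ^ γ := mul_nonneg hH (Real.rpow_nonneg (by linarith) _)
    rw [eulerIncrement_eq_increment, ← hscale s t hst]
    refine norm_increment_le hP hQ.le hH' (hL.derivBound z hz) (X.abs_character_le hH'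
      fun τ h₁ h₂ => hL.abs_le τ h₁ h₂ s t hs hst ht) ?_
    rw [hscale s t hst]
    exact mul_le_one₀ hsmall (by positivity) (Real.rpow_le_one hT0.le hT1 hγ₀.le)
  set D : ℝ → ℝ → EuclideanSpace ℝ (Fin m) := fun s t =>
    φ t - φ s - ((t - s) • b (φ s) + eulerIncrement f X (φ s) s t) with hD
  have hR : ∀ s t, s₀ ≤ s → s < t → t ≤ s₁ → Q * ‖D s t‖ ≤ A * ((t - s) / h₀) ^ β := by
    refine hsew h₀ s₀ s₁ (fun s t => Q * ‖D s t‖) hh hlen ?_ ?_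
    · intro s u t hs hsu hut ht
      have hst := hsu.trans hut
      obtain ⟨hT0, hT1⟩ := hT s t hs hst ht
      set T := (t - s) / h₀ with hTdef
      have huT : (u - s) / h₀ ≤ T := by rw [hTdef]; gcongr
      have htT : (t - u) / h₀ ≤ T := by rw [hTdef]; gcongr
      have hφs := hball s hs (by linarith)
      have hφu := hball u (by linarith) (by linarith)
      have hH' : 0 ≤ H * (t - s) ^ γ := mul_nonneg hH (Real.rpow_nonneg (by linarith) _)
      set r := Q * ‖D s u‖ + B * T with hr
      have hr0 : 0 ≤ r := by positivity
      have hTγ0 : 0 < T ^ γ := by positivity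
      have hTγ1 : T ^ γ ≤ 1 := Real.rpow_le_one hT0.le hT1 hγ₀.le
      have haT : P * Q * (H * (t - s) ^ γ) = a₀ * T ^ γ := hscale s t hst
      have haT1 : a₀ * T ^ γ ≤ T ^ γ := mul_le_of_le_one_left hTγ0.le hsmall
      have hspeed : Q * ‖(u - s) • b (φ s)‖ ≤ B * T := by
        rw [norm_smul, Real.norm_of_nonneg (by linarith)]
        calc Q * ((u - s) * ‖b (φ s)‖) = (u - s) * (Q * ‖b (φ s)‖) := by ring
          _ ≤ (u - s) * (B / h₀) := by
              have := hL.speed_le _ hφs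
              gcongr
          _ = B * ((u - s) / h₀) := by ring
          _ ≤ B * T := by gcongr
      have hXle : ∀ s' t', s ≤ s' → s' < t' → t' ≤ t → ∀ τ : PlaneForest n, 1 ≤ τ.card →
          τ.card ≤ level γ → |X.toFun τ.toForest s' t'| ≤ (H * (t - s) ^ γ) ^ τ.card := by
        intro s' t' h₁ h₂ h₃ τ h₄ h₅
        refine (hL.abs_le τ h₄ h₅ s' t' (by linarith) h₂ (by linarith)).trans ?_
        have : (t' - s') ^ γ ≤ (t - s) ^ γ := Real.rpow_le_rpow (by linarith) (by linarith) hγ₀.le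
        have h₀' : 0 ≤ (t' - s') ^ γ := Real.rpow_nonneg (by linarith) _
        gcongr
      have herr : Q * ‖φ u - φ s - increment (level γ) (X.character s u) f (φ s)‖ ≤ r := by
        rw [← eulerIncrement_eq_increment]
        have e : φ u - φ s - eulerIncrement f X (φ s) s u = D s u + (u - s) • b (φ s) := by
          simp only [hD]; abel
        rw [e, hr]
        calc Q * ‖D s u + (u - s) • b (φ s)‖ ≤ Q * (‖D s u‖ + ‖(u - s) • b (φ s)‖) := by
              gcongr; exact norm_add_le _ _
          _ = Q * ‖D s u‖ + Q * ‖(u - s) • b (φ s)‖ := by ring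
          _ ≤ _ := by gcongr
      have hdist : Q * ‖φ u - φ s‖ ≤ 2 := by
        rw [Metric.mem_closedBall, dist_eq_norm] at hφs hφu
        have h₁ : ‖φ u - φ s‖ ≤ 1 / Q + 1 / Q := by
          calc ‖φ u - φ s‖ = ‖(φ u - c) - (φ s - c)‖ := by congr 1; abel
            _ ≤ ‖φ u - c‖ + ‖φ s - c‖ := norm_sub_le _ _
            _ ≤ _ := add_le_add hφu hφs
        calc Q * ‖φ u - φ s‖ ≤ Q * (1 / Q + 1 / Q) := by gcongr
          _ = 2 := by field_simp; norm_num
      have hnear : NearIncrement (level γ) f (X.character s u) (φ s) (φ u) P Q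
          (H * (t - s) ^ γ) r :=
        { contDiff := hL.contDiff
          isCharacter := X.isCharacter_character s u
          P_nonneg := hP
          Q_nonneg := hQ.le
          H_nonneg := hH'
          r_nonneg := hr0
          abs_le := X.abs_character_le hH' (hXle s u le_rfl hsu hut.le)
          small := by rw [haT]; linarith
          derivBound := fun θ hθ => hL.derivBound _
            ((convex_closedBall c (1 / Q)).add_smul_sub_mem hφs hφu hθ)
          dist_le := hdist
          error_le := herr }
      have hdef := hdefect f X s u t (φ s) (φ u) P Q _ r (hmem s hs (by linarith))
        (hmem u (by linarith) (by linarith)) (hmem t (by linarith) ht) hnear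
        (hXle u t hsu.le hut le_rfl)
      rw [haT] at hdef
      -- The displacement between `s` and `u`.
      have hmove : Q * ‖φ u - φ s‖ ≤ K * T ^ γ + r := by
        have h₁ := norm_increment_le hP hQ.le hH' (hL.derivBound _ hφs) hnear.abs_le hnear.small
        rw [haT] at h₁
        calc Q * ‖φ u - φ s‖ = Q * ‖increment (level γ) (X.character s u) f (φ s) +
              (φ u - φ s - increment (level γ) (X.character s u) f (φ s))‖ := by congr 2; abel
          _ ≤ Q * (‖increment (level γ) (X.character s u) f (φ s)‖ +
              ‖φ u - φ s - increment (level γ) (X.character s u) f (φ s)‖) := by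
              gcongr; exact norm_add_le _ _
          _ = Q * ‖increment (level γ) (X.character s u) f (φ s)‖ +
              Q * ‖φ u - φ s - increment (level γ) (X.character s u) f (φ s)‖ := mul_add _ _ _
          _ ≤ K * (a₀ * T ^ γ) + r := add_le_add h₁ herr
          _ ≤ _ := by gcongr
      have hdrift : Q * ‖(t - u) • (b (φ s) - b (φ u))‖ ≤ B * T * (K * T ^ γ + r) := by
        rw [norm_smul, Real.norm_of_nonneg (by linarith)]
        have h₁ := hL.lipschitz _ hφs _ hφu
        rw [norm_sub_rev (φ s)] at h₁
        calc Q * ((t - u) * ‖b (φ s) - b (φ u)‖)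
            ≤ Q * ((t - u) * (B / h₀ * ‖φ u - φ s‖)) := by gcongr
          _ = B * ((t - u) / h₀) * (Q * ‖φ u - φ s‖) := by ring
          _ ≤ B * T * (K * T ^ γ + r) := by gcongr
      have e : D s t = D s u + D u t - (t - u) • (b (φ s) - b (φ u)) -
          (eulerIncrement f X (φ s) s t - eulerIncrement f X (φ s) s u -
            eulerIncrement f X (φ u) u t) := by
        simp only [hD, smul_sub]
        have : (t - s) • b (φ s) = (u - s) • b (φ s) + (t - u) • b (φ s) := by
          rw [← add_smul]; congr 1; ring
        rw [this]
        abel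
      have hsum : Q * ‖D s t‖ ≤ Q * ‖D s u‖ + Q * ‖D u t‖ + B * T * (K * T ^ γ + r) +
          C * ((a₀ * T ^ γ) ^ (level γ + 1) + a₀ * T ^ γ * r) := by
        rw [e]
        calc _ ≤ Q * (‖D s u‖ + ‖D u t‖ + ‖(t - u) • (b (φ s) - b (φ u))‖ +
              ‖eulerIncrement f X (φ s) s t - eulerIncrement f X (φ s) s u -
                eulerIncrement f X (φ u) u t‖) := by
              gcongr
              exact (norm_sub_le _ _).trans (add_le_add ((norm_sub_le _ _).trans
                (add_le_add (norm_add_le _ _) le_rfl)) le_rfl)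
          _ ≤ _ := by
              rw [mul_add, mul_add, mul_add]
              gcongr
      refine hsum.trans ?_
      have hTβ0 : 0 < T ^ β := by positivity
      have p₁ : (a₀ * T ^ γ) ^ (level γ + 1) ≤ T ^ β := by
        calc (a₀ * T ^ γ) ^ (level γ + 1) ≤ (T ^ γ) ^ (level γ + 1) := by gcongr
          _ = T ^ (γ * (N + 1)) := by
              rw [← Real.rpow_natCast, ← Real.rpow_mul hT0.le]; push_cast; rfl
          _ ≤ T ^ β := Real.rpow_le_rpow_of_exponent_ge hT0 hT1 hβ₁
      have p₂ : T * T ^ γ ≤ T ^ β := by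
        rw [← Real.rpow_one_add' hT0.le (by linarith)]
        exact Real.rpow_le_rpow_of_exponent_ge hT0 hT1 hβ₂
      have p₃ : T ≤ T ^ γ := by
        simpa using Real.rpow_le_rpow_of_exponent_ge hT0 hT1 hγ₁
      have p₄ : T * T ≤ T ^ β := le_trans (by gcongr) p₂
      set ρ := Q * ‖D s u‖ with hρ
      have hρ0 : 0 ≤ ρ := by positivity
      have q₁ : B * T * (K * T ^ γ + r) ≤ B * (K + B) * T ^ β + B * (T ^ γ * ρ) := by
        calc B * T * (K * T ^ γ + r) = B * (K * (T * T ^ γ) + (T * ρ + B * (T * T))) := by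
              rw [hr]; ring
          _ ≤ B * (K * T ^ β + (T ^ γ * ρ + B * T ^ β)) := by gcongr
          _ = _ := by ring
      have q₂ : a₀ * T ^ γ * r ≤ T ^ γ * ρ + B * T ^ β := by
        calc a₀ * T ^ γ * r ≤ T ^ γ * r := by gcongr
          _ = T ^ γ * ρ + B * (T * T ^ γ) := by rw [hr]; ring
          _ ≤ _ := by gcongr
      have q₃ : C * ((a₀ * T ^ γ) ^ (level γ + 1) + a₀ * T ^ γ * r) ≤
          C * (T ^ β + (T ^ γ * ρ + B * T ^ β)) := by gcongr
      have q₄ : 0 ≤ T ^ γ * ρ := by positivity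
      have q₅ : C₁ * (T ^ β + T ^ γ * ρ) = C * (T ^ β + (T ^ γ * ρ + B * T ^ β)) +
          (B * (K + B) * T ^ β + B * (T ^ γ * ρ)) + (B * T ^ β + C * B * (T ^ γ * ρ) +
            B * (K + B) * (T ^ γ * ρ)) := by rw [hC₁]; ring
      have q₆ : 0 ≤ B * T ^ β + C * B * (T ^ γ * ρ) + B * (K + B) * (T ^ γ * ρ) := by positivity
      linarith
    · intro ε hε
      obtain ⟨δ, hδ, h⟩ := hsol (ε / Q) (by positivity)
      refine ⟨δ, hδ, fun s t hs hst ht hd => ?_⟩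
      have := h s t (hL.left_le.trans hs) hst (ht.trans hL.le_right) hd
      calc Q * ‖D s t‖ ≤ Q * (ε / Q * (t - s)) := by gcongr
        _ = ε * (t - s) := by field_simp
  intro s t hs hst ht
  have hφs := hball s hs (by linarith)
  have h₁ := hR s t hs hst ht
  have h₂ := hincr s t hs hst ht _ hφs
  obtain ⟨hT0, hT1⟩ := hT s t hs hst ht
  have e : φ t - φ s - (t - s) • b (φ s) = D s t + eulerIncrement f X (φ s) s t := by
    simp only [hD]; abel
  rw [e]
  set T := (t - s) / h₀
  have hTγ0 : 0 < T ^ γ := by positivity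
  have hTβ0 : 0 < T ^ β := by positivity
  calc Q * ‖D s t + eulerIncrement f X (φ s) s t‖
      ≤ Q * ‖D s t‖ + Q * ‖eulerIncrement f X (φ s) s t‖ := by
        rw [← mul_add]; gcongr; exact norm_add_le _ _
    _ ≤ A * T ^ β + K * (a₀ * T ^ γ) := add_le_add h₁ h₂
    _ ≤ (K + A) * (a₀ * T ^ γ + T ^ β) := by
        have : 0 ≤ K * T ^ β + A * (a₀ * T ^ γ) := by positivity
        linarith

/-- One time step of length at most `κ * h₀`, for a noise of size at most `ε` in the local units: the
solution moves by the drift, up to an error `κ` in units of `1 / Q`. In particular it does not leave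
the ball of radius `1 / Q`. -/
theorem exists_step_bound (m n : ℕ) {γ B : ℝ} (hγ₀ : 0 < γ) (hγ₁ : γ ≤ 1) (hB : 0 ≤ B) :
    ∃ κ ε : ℝ, 0 < κ ∧ κ ≤ 1 ∧ 0 < ε ∧
    ∀ (b : EuclideanSpace ℝ (Fin m) → EuclideanSpace ℝ (Fin m))
      (f : EuclideanSpace ℝ (Fin m) → EuclideanSpace ℝ (Fin n) →L[ℝ] EuclideanSpace ℝ (Fin m))
      (X : BranchedRoughPath n γ) (φ : ℝ → EuclideanSpace ℝ (Fin m)) (P Q H h₀ s₀ s₁ : ℝ),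
      IsDavieSolution b f X φ → ContinuousOn φ (Set.Icc (-1) 0) →
      LocalBounds B b f X P Q H h₀ s₀ s₁ (φ s₀) →
      P * Q * (H * h₀ ^ γ) ≤ ε → s₁ - s₀ ≤ κ * h₀ →
      ∀ t, s₀ ≤ t → t ≤ s₁ → φ t ∈ Metric.closedBall (φ s₀) (1 / Q) ∧
        Q * ‖φ t - φ s₀ - (t - s₀) • b (φ s₀)‖ ≤ κ := by
  obtain ⟨β, κ₀, A, hβ, hκ₀, hκ₀1, hA, hloc⟩ := exists_local_bound m n hγ₀ hγ₁ hB
  set κ : ℝ := min κ₀ (min (1 / (2 * (1 + B))) ((1 / (2 * (A + 1))) ^ (1 / (β - 1)))) with hκdef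
  have hκ : 0 < κ := lt_min hκ₀ (lt_min (by positivity) (by positivity))
  have hκ1 : κ ≤ 1 := (min_le_left _ _).trans hκ₀1
  have hκB : (1 + B) * κ ≤ 1 / 2 := by
    have : κ ≤ 1 / (2 * (1 + B)) := (min_le_right _ _).trans (min_le_left _ _)
    calc (1 + B) * κ ≤ (1 + B) * (1 / (2 * (1 + B))) := by gcongr
      _ = 1 / 2 := by field_simp
  have hκβ : A * κ ^ β ≤ κ / 2 := by
    have h₁ : κ ^ (β - 1) ≤ 1 / (2 * (A + 1)) := by
      calc κ ^ (β - 1) ≤ ((1 / (2 * (A + 1))) ^ (1 / (β - 1))) ^ (β - 1) :=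
            Real.rpow_le_rpow hκ.le ((min_le_right _ _).trans (min_le_right _ _)) (by linarith)
        _ = 1 / (2 * (A + 1)) := by
            rw [← Real.rpow_mul (by positivity), one_div_mul_cancel (by linarith), Real.rpow_one]
    have h₂ : κ ^ β = κ ^ (β - 1) * κ := by
      rw [← Real.rpow_add_one hκ.ne', sub_add_cancel]
    rw [h₂]
    calc A * (κ ^ (β - 1) * κ) ≤ (A + 1) * (1 / (2 * (A + 1)) * κ) := by gcongr; linarith
      _ = κ / 2 := by field_simp
  set ε : ℝ := min 1 (κ / (2 * (A + 1))) with hε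
  have hε0 : 0 < ε := lt_min one_pos (by positivity)
  have hAε : A * ε ≤ κ / 2 := by
    calc A * ε ≤ (A + 1) * (κ / (2 * (A + 1))) := by
          gcongr
          · linarith
          · exact min_le_right _ _
      _ = κ / 2 := by field_simp
  refine ⟨κ, ε, hκ, hκ1, hε0, ?_⟩
  intro b f X φ P Q H h₀ s₀ s₁ hsol hcont hL hsmall hlen
  have hQ := hL.Q_pos
  have hh := hL.h₀_pos
  have hP := hL.P_nonneg
  have hH := hL.H_nonneg
  -- The estimate holds as long as the ball has not been left.
  have hest : ∀ t, s₀ ≤ t → t ≤ s₁ →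
      (∀ u, s₀ ≤ u → u ≤ t → φ u ∈ Metric.closedBall (φ s₀) (1 / Q)) →
      Q * ‖φ t - φ s₀ - (t - s₀) • b (φ s₀)‖ ≤ κ := by
    intro t hs ht hball
    rcases hs.eq_or_lt with rfl | hs
    · simpa using hκ.le
    have h := hloc b f X φ P Q H h₀ s₀ t (φ s₀) hsol (hL.mono ht)
      (hsmall.trans (min_le_left _ _))
      ((by linarith : t - s₀ ≤ κ * h₀).trans (by gcongr; exact min_le_left _ _)) hball
      s₀ t le_rfl hs le_rfl
    have hT0 : 0 < (t - s₀) / h₀ := div_pos (by linarith) hh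
    have hTκ : (t - s₀) / h₀ ≤ κ := by rw [div_le_iff₀ hh]; linarith
    set T := (t - s₀) / h₀
    have h₁ : T ^ γ ≤ 1 := Real.rpow_le_one hT0.le (hTκ.trans hκ1) hγ₀.le
    have h₂ : T ^ β ≤ κ ^ β := Real.rpow_le_rpow hT0.le hTκ (by linarith)
    have h₃ : 0 < T ^ γ := by positivity
    calc _ ≤ A * (P * Q * (H * h₀ ^ γ) * T ^ γ + T ^ β) := h
      _ ≤ A * (ε * 1 + κ ^ β) := by gcongr
      _ = A * ε + A * κ ^ β := by ring
      _ ≤ κ := by linarith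
  have hdist : ∀ t, s₀ ≤ t → t ≤ s₁ →
      (∀ u, s₀ ≤ u → u ≤ t → φ u ∈ Metric.closedBall (φ s₀) (1 / Q)) →
      ‖φ t - φ s₀‖ < 1 / Q := by
    intro t hs ht hball
    have h₁ := hest t hs ht hball
    have h₂ := hL.speed_le (φ s₀) (Metric.mem_closedBall_self (by positivity))
    have h₃ : Q * ‖(t - s₀) • b (φ s₀)‖ ≤ B * κ := by
      rw [norm_smul, Real.norm_of_nonneg (by linarith)]
      calc Q * ((t - s₀) * ‖b (φ s₀)‖) = (t - s₀) * (Q * ‖b (φ s₀)‖) := by ring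
        _ ≤ (κ * h₀) * (B / h₀) := by
            gcongr
            · linarith
        _ = B * κ := by field_simp
    have h₄ : Q * ‖φ t - φ s₀‖ < 1 := by
      calc Q * ‖φ t - φ s₀‖ = Q * ‖(φ t - φ s₀ - (t - s₀) • b (φ s₀)) +
            (t - s₀) • b (φ s₀)‖ := by congr 2; abel
        _ ≤ Q * ‖φ t - φ s₀ - (t - s₀) • b (φ s₀)‖ + Q * ‖(t - s₀) • b (φ s₀)‖ := by
            rw [← mul_add]; gcongr; exact norm_add_le _ _
        _ ≤ κ + B * κ := add_le_add h₁ h₃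
        _ < 1 := by linarith
    rw [lt_div_iff₀ hQ]; linarith
  have hball : ∀ t, s₀ ≤ t → t ≤ s₁ → φ t ∈ Metric.closedBall (φ s₀) (1 / Q) := by
    by_contra! hne
    obtain ⟨t, hs, ht, hout⟩ := hne
    rw [Metric.mem_closedBall, dist_eq_norm, not_le] at hout
    -- The first time at which the boundary of the ball is reached.
    set S : Set ℝ := {u | u ∈ Set.Icc s₀ t ∧ 1 / Q ≤ ‖φ u - φ s₀‖} with hS
    have hc : ContinuousOn (fun u => ‖φ u - φ s₀‖) (Set.Icc s₀ t) :=
      ((hcont.mono (Set.Icc_subset_Icc hL.left_le (ht.trans hL.le_right))).sub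
        continuousOn_const).norm
    have hScpt : IsCompact S := by
      have : IsClosed S := hc.preimage_isClosed_of_isClosed isClosed_Icc isClosed_Ici
      exact isCompact_Icc.of_isClosed_subset this fun u hu => hu.1
    obtain ⟨u, hu, hmin⟩ := hScpt.exists_isLeast ⟨t, ⟨hs, le_rfl⟩, hout.le⟩
    have hlt : ∀ v, s₀ ≤ v → v < u → ‖φ v - φ s₀‖ < 1 / Q := by
      intro v hv hvu
      by_contra! h
      exact absurd (hmin ⟨⟨hv, hvu.le.trans hu.1.2⟩, h⟩) (not_le.2 hvu)
    have hle : ‖φ u - φ s₀‖ ≤ 1 / Q := by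
      rcases hu.1.1.eq_or_lt with h | h
      · rw [← h]; simp only [sub_self, norm_zero]; positivity
      have h₁ : Filter.Tendsto (fun v => ‖φ v - φ s₀‖) (nhdsWithin u (Set.Ico s₀ u))
          (nhds ‖φ u - φ s₀‖) :=
        ((hc u hu.1).mono (Set.Ico_subset_Icc_self.trans (Set.Icc_subset_Icc_right hu.1.2)))
      have : (nhdsWithin u (Set.Ico s₀ u)).NeBot := by
        rw [← mem_closure_iff_nhdsWithin_neBot, closure_Ico h.ne]
        exact Set.right_mem_Icc.2 h.le
      exact le_of_tendsto h₁ (Filter.eventually_of_mem self_mem_nhdsWithin fun v hv =>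
        (hlt v hv.1 hv.2).le)
    have := hdist u hu.1.1 (hu.1.2.trans ht) fun v hv hvu => by
      rw [Metric.mem_closedBall, dist_eq_norm]
      rcases hvu.eq_or_lt with rfl | h
      · exact hle
      · exact (hlt v hv h).le
    exact absurd hu.2 (not_le.2 this)
  intro t hs ht
  exact ⟨hball t hs ht, hest t hs ht fun u hu hut => hball u hu (hut.trans ht)⟩

end Local

/-! ### Bounds from the norms of the vector field and of the rough path -/

section Norms

variable {m n : ℕ} {γ : ℝ}

namespace BranchedRoughPath

variable (X : BranchedRoughPath n γ)

theorem holderNorm_mono {β : ℝ} {I J : Set ℝ} (h : I ⊆ J) (x : ℝ → ℝ → ℝ) :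
    holderNorm β I x ≤ holderNorm β J x :=
  iSup₂_mono' fun s hs => ⟨s, h hs, iSup₂_mono' fun t ht => ⟨t, h ht, le_rfl⟩⟩

theorem homNorm_lt_top {I : Set ℝ} (hI : I ⊆ Set.Icc (-1) 0) : X.homNorm I < ∞ := by
  let g : PlaneForest n → ℝ≥0∞ := fun τ =>
    holderNorm (γ * τ.card) I (X.toFun τ.toForest) ^ (1 / (τ.card : ℝ))
  have h : X.homNorm I ≤ ∑ τ ∈ lowOrder n (level γ + 1), g τ :=
    iSup₂_le fun τ hτ => Finset.single_le_sum_of_canonicallyOrdered (f := g)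
      (mem_lowOrder.2 (by omega))
  refine h.trans_lt (ENNReal.sum_lt_top.2 fun τ hτ => ?_)
  refine ENNReal.rpow_lt_top_of_nonneg (by positivity) (ne_of_lt ?_)
  exact (holderNorm_mono hI _).trans_lt (X.holder τ (by rw [mem_lowOrder] at hτ; omega))

theorem abs_le_homNorm {I : Set ℝ} (hI : I ⊆ Set.Icc (-1) 0) {τ : PlaneForest n}
    (h₁ : 1 ≤ τ.card) (h₂ : τ.card ≤ level γ) {s t : ℝ} (hs : s ∈ I) (ht : t ∈ I) (hst : s < t) :
    |X.toFun τ.toForest s t| ≤ ((X.homNorm I).toReal * (t - s) ^ γ) ^ τ.card := by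
  have hts : 0 < t - s := by linarith
  have hk : (0 : ℝ) < τ.card := by exact_mod_cast h₁
  have e₁ : ENNReal.ofReal (|X.toFun τ.toForest s t| / |t - s| ^ (γ * τ.card)) ≤
      holderNorm (γ * τ.card) I (X.toFun τ.toForest) :=
    le_iSup₂_of_le s hs (le_iSup₂_of_le t ht (le_iSup_of_le hst.ne le_rfl))
  have e₂ : holderNorm (γ * τ.card) I (X.toFun τ.toForest) ≤ X.homNorm I ^ (τ.card : ℝ) := by
    have : holderNorm (γ * τ.card) I (X.toFun τ.toForest) ^ (1 / (τ.card : ℝ)) ≤ X.homNorm I :=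
      le_iSup₂_of_le (f := fun (τ : PlaneForest n) (_ : 1 ≤ τ.card ∧ τ.card ≤ level γ) =>
        holderNorm (γ * τ.card) I (X.toFun τ.toForest) ^ (1 / (τ.card : ℝ))) τ ⟨h₁, h₂⟩ le_rfl
    calc holderNorm (γ * τ.card) I (X.toFun τ.toForest)
        = (holderNorm (γ * τ.card) I (X.toFun τ.toForest) ^ (1 / (τ.card : ℝ))) ^ (τ.card : ℝ) := by
          rw [← ENNReal.rpow_mul, one_div_mul_cancel hk.ne', ENNReal.rpow_one]
      _ ≤ _ := ENNReal.rpow_le_rpow this hk.le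
  have e₃ := ENNReal.toReal_mono
    (ENNReal.rpow_ne_top_of_nonneg hk.le (X.homNorm_lt_top hI).ne) (e₁.trans e₂)
  rw [ENNReal.toReal_ofReal (by positivity), ← ENNReal.toReal_rpow, abs_of_pos hts,
    div_le_iff₀ (by positivity), Real.rpow_natCast] at e₃
  rwa [mul_pow, ← Real.rpow_natCast ((t - s) ^ γ), ← Real.rpow_mul hts.le]

end BranchedRoughPath

variable
  {f : EuclideanSpace ℝ (Fin m) → EuclideanSpace ℝ (Fin n) →L[ℝ] EuclideanSpace ℝ (Fin m)}

theorem norm_iteratedFDeriv_le_weightedNorm {N : ℕ} {η q : ℝ} (h : weightedNorm N η q f < ⊤)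
    {ℓ : ℕ} (hℓ : ℓ ≤ N) (x : EuclideanSpace ℝ (Fin m)) :
    ‖iteratedFDeriv ℝ ℓ f x‖ ≤ (weightedNorm N η q f).toReal * (‖x‖ + 1) ^ (η + ℓ * q) := by
  have e : ENNReal.ofReal (‖iteratedFDeriv ℝ ℓ f x‖ / (‖x‖ + 1) ^ (η + ℓ * q)) ≤
      weightedNorm N η q f :=
    le_iSup₂_of_le ℓ (Finset.mem_range.2 (by omega)) (le_iSup_of_le x le_rfl)
  have e' := ENNReal.toReal_mono h.ne e
  have : 0 < ‖x‖ + 1 := by positivity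
  rwa [ENNReal.toReal_ofReal (by positivity), div_le_iff₀ (by positivity)] at e'

end Norms

/-! ### Continuity of solutions -/

section Continuity

variable {m n : ℕ} {γ : ℝ}
  {f : EuclideanSpace ℝ (Fin m) → EuclideanSpace ℝ (Fin n) →L[ℝ] EuclideanSpace ℝ (Fin m)}

/-- On bounded sets, the Euler scheme has increments of order `γ`. -/
theorem exists_eulerIncrement_bound (hγ : 0 < γ) (X : BranchedRoughPath n γ) {η q : ℝ}
    (hf : weightedNorm (level γ) η q f < ⊤) (ρ : ℝ) : ∃ E : ℝ, 0 ≤ E ∧ ∀ x, ‖x‖ ≤ ρ →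
      ∀ s t : ℝ, -1 ≤ s → s < t → t ≤ 0 → ‖eulerIncrement f X x s t‖ ≤ E * (t - s) ^ γ := by
  set F := (weightedNorm (level γ) η q f).toReal
  have hF : 0 ≤ F := ENNReal.toReal_nonneg
  set H := (X.homNorm (Set.Icc (-1) 0)).toReal
  have hH : 0 ≤ H := ENNReal.toReal_nonneg
  set P := F * (|ρ| + 1) ^ (|η| + level γ * |q|)
  have hP : 0 ≤ P := by positivity
  refine ⟨∑ τ ∈ lowOrder n (level γ), P * (P * 1) ^ τ.card * (n * H ^ (τ.card + 1)),
    by positivity, fun x hx s t hs hst ht => ?_⟩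
  have hd : DerivBound (level γ) P 1 f x := fun ℓ hℓ => by
    rw [one_pow, mul_one]
    refine (norm_iteratedFDeriv_le_weightedNorm hf hℓ x).trans ?_
    have h₁ : (ℓ : ℝ) ≤ level γ := by exact_mod_cast hℓ
    have h₂ : η + ℓ * q ≤ |η| + level γ * |q| := by
      have : (ℓ : ℝ) * q ≤ level γ * |q| :=
        (mul_le_mul_of_nonneg_left (le_abs_self q) (Nat.cast_nonneg ℓ)).trans (by gcongr)
      linarith [le_abs_self η]
    refine mul_le_mul_of_nonneg_left ?_ hF
    refine (Real.rpow_le_rpow_of_exponent_le (by linarith [norm_nonneg x]) h₂).trans ?_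
    have : ‖x‖ ≤ |ρ| := hx.trans (le_abs_self ρ)
    gcongr
  have hT : 0 ≤ (t - s) ^ γ := Real.rpow_nonneg (by linarith) _
  have hT1 : (t - s) ^ γ ≤ 1 := Real.rpow_le_one (by linarith) (by linarith) hγ.le
  rw [eulerIncrement_eq, Finset.sum_mul]
  refine (norm_sum_le _ _).trans (Finset.sum_le_sum fun τ hτ => ?_)
  have hτ' := mem_lowOrder.1 hτ
  have h₁ := norm_elemDiff_le hP zero_le_one hd hτ'.le
  have h₂ := X.norm_graftVec_le (s := s) (t := t) (H := H * (t - s) ^ γ) (fun τ h₁ h₂ =>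
    X.abs_le_homNorm subset_rfl h₁ h₂ ⟨hs, hst.le.trans ht⟩ ⟨hs.trans hst.le, ht⟩ hst) hτ'
  have h₃ : ‖weight τ • elemDiff f τ x‖ ≤ P * (P * 1) ^ τ.card := by
    rw [norm_smul, Real.norm_of_nonneg (weight_nonneg τ)]
    exact (mul_le_of_le_one_left (norm_nonneg _) (weight_le_one τ)).trans h₁
  have h₄ : (H * (t - s) ^ γ) ^ (τ.card + 1) ≤ H ^ (τ.card + 1) * (t - s) ^ γ := by
    rw [mul_pow]
    refine mul_le_mul_of_nonneg_left ?_ (by positivity)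
    exact pow_le_of_le_one hT hT1 (by omega)
  refine (ContinuousLinearMap.le_opNorm _ _).trans ?_
  calc _ ≤ P * (P * 1) ^ τ.card * (n * (H ^ (τ.card + 1) * (t - s) ^ γ)) := by
        refine mul_le_mul h₃ (h₂.trans ?_) (norm_nonneg _) (by positivity)
        gcongr
    _ = _ := by ring

/-- Davie solutions are continuous. A drift bounded on bounded sets is enough: near a given time the
solution is bounded by the scheme started a little earlier, hence Hölder continuous. -/
theorem IsDavieSolution.continuousOn (hγ₀ : 0 < γ) (hγ₁ : γ ≤ 1) {X : BranchedRoughPath n γ}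
    {η q : ℝ} (hf : weightedNorm (level γ) η q f < ⊤)
    {b : EuclideanSpace ℝ (Fin m) → EuclideanSpace ℝ (Fin m)}
    (hb : ∀ ρ, ∃ D : ℝ, 0 ≤ D ∧ ∀ x, ‖x‖ ≤ ρ → ‖b x‖ ≤ D) {φ : ℝ → EuclideanSpace ℝ (Fin m)}
    (hsol : IsDavieSolution b f X φ) : ContinuousOn φ (Set.Icc (-1) 0) := by
  obtain ⟨δ, hδ, hsol⟩ := hsol 1 one_pos
  have step : ∀ ρ, ∃ K : ℝ, 0 ≤ K ∧ ∀ s t : ℝ, -1 ≤ s → s < t → t ≤ 0 → t - s ≤ δ → ‖φ s‖ ≤ ρ →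
      ‖φ t - φ s‖ ≤ K * (t - s) ^ γ := by
    intro ρ
    obtain ⟨E, hE, hEb⟩ := exists_eulerIncrement_bound hγ₀ X hf ρ
    obtain ⟨D, hD, hDb⟩ := hb ρ
    refine ⟨1 + D + E, by positivity, fun s t hs hst ht hd hφ => ?_⟩
    have h₁ := hsol s t hs hst ht hd
    have h₂ := hEb (φ s) hφ s t hs hst ht
    have h₃ := hDb (φ s) hφ
    have h₄ : t - s ≤ (t - s) ^ γ := by
      simpa using Real.rpow_le_rpow_of_exponent_ge (x := t - s) (by linarith) (by linarith) hγ₁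
    have hts : 0 ≤ t - s := by linarith
    calc ‖φ t - φ s‖ = ‖(φ t - φ s - ((t - s) • b (φ s) + eulerIncrement f X (φ s) s t)) +
          (t - s) • b (φ s) + eulerIncrement f X (φ s) s t‖ := by congr 1; abel
      _ ≤ 1 * (t - s) + (t - s) * D + E * (t - s) ^ γ := by
          refine (norm_add_le _ _).trans (add_le_add ((norm_add_le _ _).trans
            (add_le_add h₁ ?_)) h₂)
          rw [norm_smul, Real.norm_of_nonneg hts]
          gcongr
      _ ≤ 1 * (t - s) ^ γ + (t - s) ^ γ * D + E * (t - s) ^ γ := by gcongr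
      _ = _ := by ring
  intro t ht
  set s := max (-1) (t - δ / 2) with hs
  have hs₁ : -1 ≤ s := le_max_left _ _
  obtain ⟨K₁, hK₁, hstep₁⟩ := step ‖φ s‖
  obtain ⟨K₂, hK₂, hstep₂⟩ := step (‖φ s‖ + K₁)
  have hbound : ∀ u ∈ Set.Icc (-1 : ℝ) 0, |u - t| ≤ δ / 2 → ‖φ u‖ ≤ ‖φ s‖ + K₁ := by
    intro u hu hut
    rw [abs_le] at hut
    have hsu : s ≤ u := max_le hu.1 (by linarith)
    rcases hsu.eq_or_lt with h | h
    · rw [← h]; linarith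
    have h₁ := hstep₁ s u hs₁ h hu.2 (by linarith [le_max_right (-1) (t - δ / 2)]) le_rfl
    have h₂ : (u - s) ^ γ ≤ 1 := Real.rpow_le_one (by linarith) (by linarith [hu.2]) hγ₀.le
    calc ‖φ u‖ = ‖φ s + (φ u - φ s)‖ := by congr 1; abel
      _ ≤ ‖φ s‖ + K₁ * 1 := (norm_add_le _ _).trans (by gcongr; exact h₁.trans (by gcongr))
      _ = _ := by ring
  have hholder : ∀ u ∈ Set.Icc (-1 : ℝ) 0, |u - t| ≤ δ / 2 → dist (φ u) (φ t) ≤ K₂ * |u - t| ^ γ := by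
    intro u hu hut
    rw [dist_eq_norm]
    rcases lt_trichotomy u t with h | h | h
    · rw [norm_sub_rev, abs_sub_comm, abs_of_pos (by linarith)]
      rw [abs_le] at hut
      exact hstep₂ u t hu.1 h ht.2 (by linarith) (hbound u hu (abs_le.2 hut))
    · simp [h, Real.zero_rpow hγ₀.ne']
    · rw [abs_of_pos (by linarith)] at hut ⊢
      exact hstep₂ t u ht.1 h hu.2 (by linarith) (hbound t ht (by simp; linarith))
  rw [ContinuousWithinAt, tendsto_iff_dist_tendsto_zero]
  have hlim : Filter.Tendsto (fun u => K₂ * |u - t| ^ γ) (nhdsWithin t (Set.Icc (-1) 0))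
      (nhds 0) := by
    have hc : Continuous fun u : ℝ => K₂ * |u - t| ^ γ :=
      continuous_const.mul (((continuous_id.sub continuous_const).abs).rpow_const
        fun _ => Or.inr hγ₀.le)
    have := (hc.tendsto t).mono_left (nhdsWithin_le_nhds (s := Set.Icc (-1) 0))
    simpa [Real.zero_rpow hγ₀.ne'] using this
  refine squeeze_zero' (Filter.Eventually.of_forall fun _ => dist_nonneg) ?_ hlim
  have hnear : ∀ᶠ u in nhdsWithin t (Set.Icc (-1) 0), |u - t| ≤ δ / 2 := by
    refine nhdsWithin_le_nhds ?_
    filter_upwards [Metric.ball_mem_nhds t (half_pos hδ)] with u hu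
    rw [Metric.mem_ball, Real.dist_eq] at hu
    exact hu.le
  filter_upwards [hnear, self_mem_nhdsWithin] with u hu hu'
  exact hholder u hu' hu

end Continuity

/-! ### Comparison of the noise with the damping -/

section Scaling

theorem rpow_le_of_ratio {x L e : ℝ} (hL : 0 < L) (h₁ : L / 3 ≤ x) (h₂ : x ≤ 3 * L) :
    x ^ e ≤ 3 ^ |e| * L ^ e := by
  have hx : 0 < x := by linarith
  rcases le_total 0 e with he | he
  · rw [abs_of_nonneg he, ← Real.mul_rpow (by norm_num) hL.le]
    exact Real.rpow_le_rpow hx.le h₂ he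
  · have h₃ : (L / 3) ^ e = 3 ^ |e| * L ^ e := by
      rw [abs_of_nonpos he, Real.div_rpow hL.le (by norm_num), Real.rpow_neg (by norm_num)]
      field_simp
    rw [← h₃]
    exact Real.rpow_le_rpow_of_nonpos (by positivity) h₁ he

variable {m n : ℕ} {γ : ℝ}

/-- The damping `-|x|^{p-1} x`. -/
noncomputable def damping (p : ℝ) (x : EuclideanSpace ℝ (Fin m)) : EuclideanSpace ℝ (Fin m) :=
  -(‖x‖ ^ (p - 1) • x)

theorem norm_damping (p : ℝ) (x : EuclideanSpace ℝ (Fin m)) :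
    ‖damping p x‖ = ‖x‖ ^ (p - 1) * ‖x‖ := by
  rw [damping, norm_neg, norm_smul, Real.norm_of_nonneg (by positivity)]

theorem norm_damping_le {p ρ : ℝ} (hp : 1 < p) {x : EuclideanSpace ℝ (Fin m)} (hx : ‖x‖ ≤ ρ) :
    ‖damping p x‖ ≤ ρ ^ p := by
  have hρ : 0 ≤ ρ := (norm_nonneg x).trans hx
  rw [norm_damping]
  calc ‖x‖ ^ (p - 1) * ‖x‖ ≤ ρ ^ (p - 1) * ρ := by
        gcongr
    _ = ρ ^ p := by rw [← Real.rpow_add_one' hρ (by linarith), sub_add_cancel]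

theorem isSolution_iff {p : ℝ}
    {f : EuclideanSpace ℝ (Fin m) → EuclideanSpace ℝ (Fin n) →L[ℝ] EuclideanSpace ℝ (Fin m)}
    {X : BranchedRoughPath n γ} {φ : ℝ → EuclideanSpace ℝ (Fin m)} :
    IsSolution p f X φ ↔ IsDavieSolution (damping p) f X φ := by
  simp only [IsSolution, IsDavieSolution, damping, smul_neg]

theorem abs_rpow_sub_rpow_le {L e r s : ℝ} (hL : 0 < L) (hr₁ : L / 3 ≤ r) (hr₂ : r ≤ 3 * L)
    (hs₁ : L / 3 ≤ s) (hs₂ : s ≤ 3 * L) :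
    |r ^ e - s ^ e| ≤ |e| * 3 ^ |e - 1| * L ^ (e - 1) * |r - s| := by
  have := (convex_Icc (L / 3) (3 * L)).norm_image_sub_le_of_norm_hasDerivWithin_le
    (f := fun x : ℝ => x ^ e) (f' := fun x => e * x ^ (e - 1))
    (C := |e| * 3 ^ |e - 1| * L ^ (e - 1)) (fun x hx =>
      (Real.hasDerivAt_rpow_const (Or.inl (by linarith [hx.1]))).hasDerivWithinAt)
    (fun x hx => by
      have hx0 : 0 < x := by linarith [hx.1]
      rw [norm_mul, Real.norm_eq_abs, Real.norm_of_nonneg (by positivity), mul_assoc]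
      gcongr
      exact rpow_le_of_ratio hL hx.1 hx.2) ⟨hs₁, hs₂⟩ ⟨hr₁, hr₂⟩
  simpa only [Real.norm_eq_abs] using this

theorem norm_damping_sub_le {p L : ℝ} (hp : 1 < p) (hL : 0 < L) {x y : EuclideanSpace ℝ (Fin m)}
    (hx₁ : L / 3 ≤ ‖x‖) (hx₂ : ‖x‖ ≤ 3 * L) (hy₁ : L / 3 ≤ ‖y‖) (hy₂ : ‖y‖ ≤ 3 * L) :
    ‖damping p x - damping p y‖ ≤
      (3 ^ (p - 1) + 3 * ((p - 1) * 3 ^ |p - 2|)) * L ^ (p - 1) * ‖x - y‖ := by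
  have h₁ : ‖x‖ ^ (p - 1) ≤ 3 ^ (p - 1) * L ^ (p - 1) := by
    rw [← Real.mul_rpow (by norm_num) hL.le]
    exact Real.rpow_le_rpow (norm_nonneg _) hx₂ (by linarith)
  have h₂ := abs_rpow_sub_rpow_le (e := p - 1) hL hx₁ hx₂ hy₁ hy₂
  have e₂ : p - 1 - 1 = p - 2 := by ring
  rw [e₂, abs_of_pos (by linarith : 0 < p - 1)] at h₂
  have h₃ : |‖x‖ - ‖y‖| ≤ ‖x - y‖ := abs_norm_sub_norm_le x y
  have e : damping p x - damping p y =
      -(‖x‖ ^ (p - 1) • (x - y)) - (‖x‖ ^ (p - 1) - ‖y‖ ^ (p - 1)) • y := by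
    rw [damping, damping, smul_sub, sub_smul]; abel
  have e₃ : L ^ (p - 2) * L = L ^ (p - 1) := by
    rw [← Real.rpow_add_one hL.ne']; congr 1; ring
  rw [e]
  refine (norm_sub_le _ _).trans ?_
  rw [norm_neg, norm_smul, norm_smul, Real.norm_of_nonneg (by positivity), Real.norm_eq_abs]
  have hp1 : 0 ≤ p - 1 := by linarith
  calc ‖x‖ ^ (p - 1) * ‖x - y‖ + |‖x‖ ^ (p - 1) - ‖y‖ ^ (p - 1)| * ‖y‖
      ≤ 3 ^ (p - 1) * L ^ (p - 1) * ‖x - y‖ +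
        ((p - 1) * 3 ^ |p - 2| * L ^ (p - 2) * ‖x - y‖) * (3 * L) := by
        gcongr
        exact h₂.trans (by gcongr)
    _ = 3 ^ (p - 1) * L ^ (p - 1) * ‖x - y‖ +
        3 * ((p - 1) * 3 ^ |p - 2|) * (L ^ (p - 2) * L) * ‖x - y‖ := by ring
    _ = _ := by rw [e₃]; ring

/-- The local bounds hold around a point of size `L ≥ 1`, in units of time `L ^ -(p + q)` and
length `L ^ -q / 2`. In these units the damping has order one. -/
theorem localBounds_damping {p η q : ℝ} (hp : 1 < p) (hq : -1 ≤ q)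
    {f : EuclideanSpace ℝ (Fin m) → EuclideanSpace ℝ (Fin n) →L[ℝ] EuclideanSpace ℝ (Fin m)}
    (hf : ContDiff ℝ (level γ) f) (hw : weightedNorm (level γ) η q f < ⊤)
    (X : BranchedRoughPath n γ) {a z s₀ s₁ : ℝ} (ha : -1 ≤ a) (hz : z ≤ 0) (hs₀ : a ≤ s₀)
    (hs₁ : s₁ ≤ z) {c : EuclideanSpace ℝ (Fin m)} (hc : 1 ≤ ‖c‖) :
    LocalBounds (2 * 3 ^ p + (3 ^ (p - 1) + 3 * ((p - 1) * 3 ^ |p - 2|))) (damping p) f X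
      (3 ^ (|η| + level γ * |q|) * (weightedNorm (level γ) η q f).toReal * ‖c‖ ^ η)
      (2 * ‖c‖ ^ q) (X.homNorm (Set.Icc a z)).toReal (‖c‖ ^ (-(p + q))) s₀ s₁ c := by
  set L := ‖c‖ with hL
  have hL0 : 0 < L := by linarith
  set F := (weightedNorm (level γ) η q f).toReal
  have hF : 0 ≤ F := ENNReal.toReal_nonneg
  have hp1 : 0 ≤ p - 1 := by linarith
  have hrad : 1 / (2 * L ^ q) ≤ L / 2 := by
    rw [div_le_div_iff₀ (by positivity) (by norm_num)]
    have h : 1 ≤ L * L ^ q := by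
      rw [mul_comm, ← Real.rpow_add_one hL0.ne']
      exact Real.one_le_rpow hc (by linarith)
    linarith
  have hnorm : ∀ y ∈ Metric.closedBall c (1 / (2 * L ^ q)), L / 2 ≤ ‖y‖ ∧ ‖y‖ ≤ 3 / 2 * L := by
    intro y hy
    rw [Metric.mem_closedBall, dist_eq_norm] at hy
    have h := (abs_le.1 (abs_norm_sub_norm_le y c))
    constructor <;> linarith [h.1, h.2]
  have hinv : ∀ B : ℝ, B / L ^ (-(p + q)) = B * L ^ (p + q) := fun B => by
    rw [Real.rpow_neg hL0.le, div_inv_eq_mul]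
  refine
    { contDiff := hf
      P_nonneg := by positivity
      Q_pos := by positivity
      H_nonneg := ENNReal.toReal_nonneg
      h₀_pos := by positivity
      left_le := ha.trans hs₀
      le_right := hs₁.trans hz
      derivBound := fun y hy ℓ hℓ => ?_
      abs_le := fun τ h₁ h₂ s t hs hst ht => X.abs_le_homNorm (Set.Icc_subset_Icc ha hz) h₁ h₂
        ⟨by linarith, by linarith⟩ ⟨by linarith, by linarith⟩ hst
      speed_le := fun y hy => ?_
      lipschitz := fun x hx y hy => ?_ }
  · obtain ⟨h₁, h₂⟩ := hnorm y hy
    refine (norm_iteratedFDeriv_le_weightedNorm hw hℓ y).trans ?_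
    have h₃ := rpow_le_of_ratio (x := ‖y‖ + 1) (L := L) (e := η + ℓ * q) hL0 (by linarith)
      (by linarith)
    have h₄ : |η + ℓ * q| ≤ |η| + level γ * |q| := by
      refine (abs_add_le _ _).trans ?_
      rw [abs_mul, Nat.abs_cast]
      have : (ℓ : ℝ) ≤ level γ := by exact_mod_cast hℓ
      gcongr
    have h₅ : (3 : ℝ) ^ |η + ℓ * q| ≤ 3 ^ (|η| + level γ * |q|) :=
      Real.rpow_le_rpow_of_exponent_le (by norm_num) h₄
    have h₆ : L ^ (η + ℓ * q) = L ^ η * (L ^ q) ^ ℓ := by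
      rw [Real.rpow_add hL0, mul_comm (ℓ : ℝ) q, Real.rpow_mul hL0.le, Real.rpow_natCast]
    have h₇ : (L ^ q) ^ ℓ ≤ (2 * L ^ q) ^ ℓ := by
      gcongr
      linarith [Real.rpow_pos_of_pos hL0 q]
    calc F * (‖y‖ + 1) ^ (η + ℓ * q) ≤ F * (3 ^ (|η| + level γ * |q|) * (L ^ η * (L ^ q) ^ ℓ)) := by
          rw [← h₆]
          gcongr
          exact h₃.trans (by gcongr)
      _ ≤ F * (3 ^ (|η| + level γ * |q|) * (L ^ η * (2 * L ^ q) ^ ℓ)) := by gcongr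
      _ = _ := by ring
  · obtain ⟨h₁, h₂⟩ := hnorm y hy
    have h₃ := norm_damping_le hp (x := y) (ρ := 3 * L) (by linarith)
    rw [hinv]
    calc 2 * L ^ q * ‖damping p y‖ ≤ 2 * L ^ q * (3 * L) ^ p := by gcongr
      _ = 2 * 3 ^ p * L ^ (p + q) := by
          rw [Real.mul_rpow (by norm_num) hL0.le, Real.rpow_add hL0]; ring
      _ ≤ _ := by
          refine mul_le_mul_of_nonneg_right ?_ (by positivity)
          exact le_add_of_nonneg_right (by positivity)
  · obtain ⟨h₁, h₂⟩ := hnorm x hx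
    obtain ⟨h₃, h₄⟩ := hnorm y hy
    have h₅ := norm_damping_sub_le hp hL0 (x := x) (y := y) (by linarith) (by linarith)
      (by linarith) (by linarith)
    rw [hinv]
    have h₆ : L ^ (p - 1) ≤ L ^ (p + q) := Real.rpow_le_rpow_of_exponent_le hc (by linarith)
    refine h₅.trans ?_
    refine mul_le_mul_of_nonneg_right (mul_le_mul ?_ h₆ (by positivity) (by positivity))
      (norm_nonneg _)
    exact le_add_of_nonneg_left (by positivity)

end Scaling

/-! ### Coming down from infinity -/

section ComingDown

/-- Along one step of the damping, the power of a size in which the damping is linear grows by at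
least a multiple of the length of the step. -/
theorem rpow_neg_add_le {p L L' h : ℝ} (hp : 1 < p) (hL : 0 < L) (hL' : 0 < L')
    (hle : L' ≤ L - h * L ^ p / 2) :
    L ^ (-(p - 1)) + (p - 1) / 2 * h ≤ L' ^ (-(p - 1)) := by
  have hp1 : 0 < p - 1 := by linarith
  set x := h * L ^ (p - 1) / 2 with hx
  have e : L ^ p = L ^ (p - 1) * L := by rw [← Real.rpow_add_one hL.ne', sub_add_cancel]
  have h₁ : L' ≤ L * (1 - x) := by
    refine hle.trans (le_of_eq ?_)
    rw [hx, e]; ring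
  have hx1 : 0 < 1 - x := pos_of_mul_pos_right (hL'.trans_le h₁) hL.le
  have h₂ : 1 + (p - 1) * x ≤ (1 - x) ^ (-(p - 1)) := by
    rw [Real.rpow_def_of_pos hx1]
    have h₃ := Real.log_le_sub_one_of_pos hx1
    have h₄ := Real.add_one_le_exp (Real.log (1 - x) * -(p - 1))
    nlinarith
  have hpow : 0 < L ^ (-(p - 1)) := by positivity
  have hone : L ^ (-(p - 1)) * L ^ (p - 1) = 1 := by
    rw [← Real.rpow_add hL, neg_add_cancel, Real.rpow_zero]
  calc L ^ (-(p - 1)) + (p - 1) / 2 * h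
      = L ^ (-(p - 1)) * (1 + (p - 1) * x) := by
        rw [hx]
        linear_combination (-((p - 1) / 2 * h)) * hone
    _ ≤ L ^ (-(p - 1)) * (1 - x) ^ (-(p - 1)) := by gcongr
    _ = (L * (1 - x)) ^ (-(p - 1)) := by rw [Real.mul_rpow hL.le hx1.le]
    _ ≤ L' ^ (-(p - 1)) := Real.rpow_le_rpow_of_nonpos hL' h₁ (by linarith)

/-- A continuous function which decreases as under a damping of power `p`, whenever it exceeds half
of its final value `g z`, can have lived only for a time of order `g z ^ -(p - 1)`. The decrease is
required for steps of length `κ g ^ -(p + q)` only. -/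
theorem length_le_of_damped {p q κ : ℝ} (hp : 1 < p) (hq : -1 ≤ q) (hκ : 0 < κ) (hκ1 : κ ≤ 1)
    {g : ℝ → ℝ} {a z : ℝ} (haz : a ≤ z) (hg : ContinuousOn g (Set.Icc a z)) (hM : 2 ≤ g z)
    (hgrow : ∀ s ∈ Set.Icc a z, g z / 2 ≤ g s → ∀ t ∈ Set.Icc s z,
      t - s ≤ κ * g s ^ (-(p + q)) → g t ≤ 3 / 2 * g s)
    (hdamp : ∀ s ∈ Set.Icc a z, g z / 2 ≤ g s → s + κ * g s ^ (-(p + q)) ≤ z →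
      g (s + κ * g s ^ (-(p + q))) ≤ g s - κ * g s ^ (-(p + q)) * g s ^ p / 2) :
    z - a ≤ 2 ^ (p - 1) * (2 / (p - 1) + 1) * g z ^ (-(p - 1)) := by
  set M := g z with hMdef
  have hp1 : 0 < p - 1 := by linarith
  -- The function stays above `M / 2`: otherwise consider the last time at which it does not.
  have habove : ∀ s ∈ Set.Icc a z, M / 2 < g s := by
    by_contra! hne
    obtain ⟨s₁, hs₁, hs₁'⟩ := hne
    set S : Set ℝ := {s | s ∈ Set.Icc a z ∧ g s ≤ M / 2} with hS
    have hScpt : IsCompact S := isCompact_Icc.of_isClosed_subset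
      (hg.preimage_isClosed_of_isClosed isClosed_Icc isClosed_Iic) fun s hs => hs.1
    obtain ⟨s, hs, hmax⟩ := hScpt.exists_isGreatest ⟨s₁, hs₁, hs₁'⟩
    have hsz : s < z := lt_of_le_of_ne hs.1.2 (by
      rintro rfl
      have := hs.2
      linarith)
    have hgt : ∀ t ∈ Set.Ioc s z, M / 2 < g t := by
      intro t ht
      by_contra! h
      exact absurd (hmax ⟨⟨hs.1.1.trans ht.1.le, ht.2⟩, h⟩) (not_le.2 ht.1)
    have hge : M / 2 ≤ g s := by
      have h₁ : Filter.Tendsto g (nhdsWithin s (Set.Ioc s z)) (nhds (g s)) :=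
        (hg s hs.1).mono (Set.Ioc_subset_Icc_self.trans (Set.Icc_subset_Icc_left hs.1.1))
      have : (nhdsWithin s (Set.Ioc s z)).NeBot := by
        rw [← mem_closure_iff_nhdsWithin_neBot, closure_Ioc hsz.ne]
        exact Set.left_mem_Icc.2 hsz.le
      exact ge_of_tendsto h₁ (Filter.eventually_of_mem self_mem_nhdsWithin fun t ht =>
        (hgt t ht).le)
    have hgs : g s = M / 2 := le_antisymm hs.2 hge
    have hpos : 0 < g s := by linarith
    have hh : 0 < κ * g s ^ (-(p + q)) := by positivity
    rcases le_or_gt (s + κ * g s ^ (-(p + q))) z with h | h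
    · have h₁ := hdamp s hs.1 hge h
      have h₂ := hgt _ ⟨by linarith, h⟩
      have h₃ : 0 ≤ κ * g s ^ (-(p + q)) * g s ^ p / 2 := by positivity
      linarith
    · have := hgrow s hs.1 hge z ⟨hs.1.2, le_rfl⟩ (by linarith)
      linarith
  have hpos : ∀ s ∈ Set.Icc a z, 0 < g s := fun s hs => by linarith [habove s hs]
  -- The last time up to which the power of `g` has grown linearly.
  set S : Set ℝ := {s | s ∈ Set.Icc a z ∧ 0 ≤ g s ^ (-(p - 1)) - (p - 1) / 2 * (s - a)} with hS
  have hc : ContinuousOn (fun s => g s ^ (-(p - 1)) - (p - 1) / 2 * (s - a)) (Set.Icc a z) :=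
    (hg.rpow_const fun s hs => Or.inl (hpos s hs).ne').sub (by fun_prop)
  have hScpt : IsCompact S := isCompact_Icc.of_isClosed_subset
    (hc.preimage_isClosed_of_isClosed isClosed_Icc isClosed_Ici) fun s hs => hs.1
  have haS : a ∈ S := by
    refine ⟨⟨le_rfl, haz⟩, ?_⟩
    have := hpos a ⟨le_rfl, haz⟩
    simp only [sub_self, mul_zero, sub_zero]
    positivity
  obtain ⟨s, hs, hmax⟩ := hScpt.exists_isGreatest ⟨a, haS⟩
  have hgs := hpos s hs.1
  have hM2 := habove s hs.1
  have hh : 0 < κ * g s ^ (-(p + q)) := by positivity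
  have hlast : z < s + κ * g s ^ (-(p + q)) := by
    by_contra! h
    have hmem : s + κ * g s ^ (-(p + q)) ∈ Set.Icc a z := ⟨by linarith [hs.1.1], h⟩
    have h₁ := rpow_neg_add_le hp hgs (hpos _ hmem) (hdamp s hs.1 hM2.le h)
    have h₂ := hmax ⟨hmem, by have := hs.2; linarith⟩
    linarith
  have hbig : g s ^ (-(p - 1)) ≤ 2 ^ (p - 1) * M ^ (-(p - 1)) := by
    calc g s ^ (-(p - 1)) ≤ (M / 2) ^ (-(p - 1)) :=
          Real.rpow_le_rpow_of_nonpos (by linarith) hM2.le (by linarith)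
      _ = 2 ^ (p - 1) * M ^ (-(p - 1)) := by
          rw [Real.div_rpow (by linarith) (by norm_num), Real.rpow_neg (by norm_num : (0:ℝ) ≤ 2)]
          field_simp
  have hstep : κ * g s ^ (-(p + q)) ≤ g s ^ (-(p - 1)) := by
    have h₁ : g s ^ (-(p + q)) ≤ g s ^ (-(p - 1)) :=
      Real.rpow_le_rpow_of_exponent_le (by linarith) (by linarith)
    have h₂ : 0 < g s ^ (-(p + q)) := by positivity
    nlinarith
  have hsa : s - a ≤ 2 / (p - 1) * g s ^ (-(p - 1)) := by
    have h₁ : (p - 1) / 2 * (s - a) ≤ g s ^ (-(p - 1)) := by have := hs.2; linarith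
    calc s - a = 2 / (p - 1) * ((p - 1) / 2 * (s - a)) := by field_simp
      _ ≤ _ := by gcongr
  calc z - a ≤ (2 / (p - 1) + 1) * g s ^ (-(p - 1)) := by linarith
    _ ≤ (2 / (p - 1) + 1) * (2 ^ (p - 1) * M ^ (-(p - 1))) := by gcongr
    _ = _ := by ring

variable {m n : ℕ}

/-- If the noise is small compared with the damping at the scale of `φ z`, on the time interval
`[a, z]`, then this interval has length of order `|φ z| ^ -(p - 1)`. -/
theorem exists_length_bound (m n : ℕ) {γ p η q : ℝ} (hγ₀ : 0 < γ) (hγ₁ : γ ≤ 1) (hp : 1 < p)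
    (hq : -1 ≤ q) (hcond : 0 < γ * (p + q) - η - q) :
    ∃ ε A : ℝ, 0 < ε ∧ 0 < A ∧
      ∀ (f : EuclideanSpace ℝ (Fin m) → EuclideanSpace ℝ (Fin n) →L[ℝ] EuclideanSpace ℝ (Fin m))
        (X : BranchedRoughPath n γ) (φ : ℝ → EuclideanSpace ℝ (Fin m)),
        ContDiff ℝ (level γ) f → weightedNorm (level γ) η q f < ⊤ → IsSolution p f X φ →
        ∀ a z : ℝ, -1 ≤ a → a ≤ z → z ≤ 0 → 2 ≤ ‖φ z‖ →
          (weightedNorm (level γ) η q f).toReal * (X.homNorm (Set.Icc a z)).toReal ≤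
            ε * ‖φ z‖ ^ (γ * (p + q) - η - q) →
          z - a ≤ A * ‖φ z‖ ^ (-(p - 1)) := by
  have hp1 : 0 < p - 1 := by linarith
  obtain ⟨κ, ε₀, hκ, hκ1, hε₀, hstep⟩ := exists_step_bound m n (γ := γ)
    (B := 2 * 3 ^ p + (3 ^ (p - 1) + 3 * ((p - 1) * 3 ^ |p - 2|))) hγ₀ hγ₁ (by positivity)
  set δ := γ * (p + q) - η - q with hδ
  set c₁ : ℝ := 2 * 3 ^ (|η| + level γ * |q|) * 2 ^ δ with hc₁
  have hc₁0 : 0 < c₁ := by positivity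
  refine ⟨ε₀ / c₁, 2 ^ (p - 1) * (2 / (p - 1) + 1), by positivity, by positivity, ?_⟩
  intro f X φ hf hw hsol a z ha haz hz hM hsmall
  rw [isSolution_iff] at hsol
  set F := (weightedNorm (level γ) η q f).toReal
  set H := (X.homNorm (Set.Icc a z)).toReal
  have hF : 0 ≤ F := ENNReal.toReal_nonneg
  have hH : 0 ≤ H := ENNReal.toReal_nonneg
  have hcont : ContinuousOn φ (Set.Icc (-1) 0) :=
    hsol.continuousOn hγ₀ hγ₁ hw fun ρ => ⟨|ρ| ^ p, by positivity, fun x hx =>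
      norm_damping_le hp (hx.trans (le_abs_self ρ))⟩
  -- The noise is small in the local units at any time at which the solution is at least `M / 2`.
  have hnoise : ∀ s, ‖φ z‖ / 2 ≤ ‖φ s‖ →
      3 ^ (|η| + level γ * |q|) * F * ‖φ s‖ ^ η * (2 * ‖φ s‖ ^ q) *
        (H * (‖φ s‖ ^ (-(p + q))) ^ γ) ≤ ε₀ := by
    intro s hs
    set L := ‖φ s‖
    have hL : 0 < L := by linarith
    have hLδ : (‖φ z‖ / 2) ^ δ ≤ L ^ δ := Real.rpow_le_rpow (by positivity) hs hcond.le
    have e₁ : L ^ η * L ^ q * (L ^ (-(p + q))) ^ γ = (L ^ δ)⁻¹ := by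
      rw [← Real.rpow_mul hL.le, ← Real.rpow_add hL, ← Real.rpow_add hL, ← Real.rpow_neg hL.le]
      congr 1
      rw [hδ]; ring
    have e₂ : ‖φ z‖ ^ δ = 2 ^ δ * (‖φ z‖ / 2) ^ δ := by
      rw [← Real.mul_rpow (by norm_num) (by positivity)]
      congr 1
      ring
    have hLδ0 : 0 < L ^ δ := by positivity
    calc _ = 2 * 3 ^ (|η| + level γ * |q|) * (F * H) *
          (L ^ η * L ^ q * (L ^ (-(p + q))) ^ γ) := by ring
      _ ≤ 2 * 3 ^ (|η| + level γ * |q|) * (ε₀ / c₁ * (2 ^ δ * L ^ δ)) * (L ^ δ)⁻¹ := by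
          rw [e₁]
          have : F * H ≤ ε₀ / c₁ * (2 ^ δ * L ^ δ) := hsmall.trans (by rw [e₂]; gcongr)
          refine mul_le_mul_of_nonneg_right ?_ (by positivity)
          exact mul_le_mul_of_nonneg_left this (by positivity)
      _ = ε₀ := by
          rw [hc₁]
          field_simp
  have hmove : ∀ s ∈ Set.Icc a z, ‖φ z‖ / 2 ≤ ‖φ s‖ → ∀ t ∈ Set.Icc s z,
      t - s ≤ κ * ‖φ s‖ ^ (-(p + q)) →
      φ t ∈ Metric.closedBall (φ s) (1 / (2 * ‖φ s‖ ^ q)) ∧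
        2 * ‖φ s‖ ^ q * ‖φ t - φ s - (t - s) • damping p (φ s)‖ ≤ κ := by
    intro s hs hsM t ht hd
    exact hstep (damping p) f X φ _ _ H _ s t hsol hcont
      (localBounds_damping hp hq hf hw X ha hz hs.1 ht.2 (by linarith)) (hnoise s hsM) hd
      t ht.1 le_rfl
  refine length_le_of_damped hp hq hκ hκ1 haz (g := fun t => ‖φ t‖)
    (hcont.mono (Set.Icc_subset_Icc ha hz)).norm hM ?_ ?_
  · intro s hs hsM t ht hd
    have h₁ := (hmove s hs hsM t ht hd).1
    rw [Metric.mem_closedBall, dist_eq_norm] at h₁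
    have hL : 1 ≤ ‖φ s‖ := by linarith
    have h₂ : 1 / (2 * ‖φ s‖ ^ q) ≤ ‖φ s‖ / 2 := by
      have hq0 : 0 < ‖φ s‖ ^ q := Real.rpow_pos_of_pos (by linarith) q
      rw [div_le_div_iff₀ (by positivity) (by norm_num)]
      have h : 1 ≤ ‖φ s‖ ^ q * ‖φ s‖ := by
        rw [← Real.rpow_add_one (by linarith)]
        exact Real.one_le_rpow hL (by linarith)
      linarith
    have h₃ := norm_sub_norm_le (φ t) (φ s)
    linarith
  · intro s hs hsM hle
    set L := ‖φ s‖ with hLdef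
    have hL : 1 ≤ L := by linarith
    have hL0 : 0 < L := by linarith
    set h := κ * L ^ (-(p + q)) with hh
    have hh0 : 0 < h := by positivity
    have h₁ := (hmove s hs hsM (s + h) ⟨by linarith, hle⟩ (by linarith)).2
    rw [add_sub_cancel_left, ← hLdef] at h₁
    have hLq : 0 < L ^ q := by positivity
    have e₁ : h * L ^ p = κ * L ^ (-q) := by
      rw [hh, mul_assoc, ← Real.rpow_add hL0]; congr 2; ring
    have e₂ : L ^ (-q) * L ^ q = 1 := by rw [← Real.rpow_add hL0, neg_add_cancel, Real.rpow_zero]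
    -- The error is at most half of the displacement by the damping.
    have h₂ : ‖φ (s + h) - φ s - h • damping p (φ s)‖ ≤ h * L ^ p / 2 := by
      rw [e₁]
      have : L ^ q * ‖φ (s + h) - φ s - h • damping p (φ s)‖ ≤ L ^ q * (κ * L ^ (-q) / 2) := by
        have : L ^ q * (κ * L ^ (-q) / 2) = κ / 2 := by linear_combination κ / 2 * e₂
        linarith
      exact le_of_mul_le_mul_left this hLq
    have hfac : h * L ^ (p - 1) ≤ 1 := by
      rw [hh, mul_assoc, ← Real.rpow_add hL0]
      have : L ^ (-(p + q) + (p - 1)) ≤ 1 := Real.rpow_le_one_of_one_le_of_nonpos hL (by linarith)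
      have h0 : 0 < L ^ (-(p + q) + (p - 1)) := by positivity
      nlinarith
    have e₃ : φ s + h • damping p (φ s) = (1 - h * L ^ (p - 1)) • φ s := by
      rw [damping, ← hLdef, sub_smul, one_smul, smul_neg, smul_smul, ← sub_eq_add_neg]
    have e₄ : L ^ p = L ^ (p - 1) * L := by rw [← Real.rpow_add_one hL0.ne', sub_add_cancel]
    calc ‖φ (s + h)‖ = ‖(φ (s + h) - φ s - h • damping p (φ s)) +
          (φ s + h • damping p (φ s))‖ := by congr 1; abel
      _ ≤ h * L ^ p / 2 + ‖φ s + h • damping p (φ s)‖ :=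
          (norm_add_le _ _).trans (add_le_add h₂ le_rfl)
      _ = h * L ^ p / 2 + (1 - h * L ^ (p - 1)) * L := by
          rw [e₃, norm_smul, Real.norm_of_nonneg (by linarith)]
      _ = L - h * L ^ p / 2 := by rw [e₄]; ring

end ComingDown

end BranchedRDE

theorem mainTheorem5 (m n : ℕ) (γ p α η q : ℝ) (hγ₀ : 0 < γ) (hγ₁ : γ ≤ 1) (hp : 1 < p)
    (hα : α = 1 / (p - 1)) (hq : -1 ≤ q) (hcond : 0 < γ / α + γ - q * (1 - γ) - η) :
    ∃ C : ℝ, 0 < C ∧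
      ∀ (f : EuclideanSpace ℝ (Fin m) → EuclideanSpace ℝ (Fin n) →L[ℝ] EuclideanSpace ℝ (Fin m))
        (X : BranchedRDE.BranchedRoughPath n γ) (φ : ℝ → EuclideanSpace ℝ (Fin m)),
        ContDiff ℝ (BranchedRDE.level γ) f →
        BranchedRDE.weightedNorm (BranchedRDE.level γ) η q f < ⊤ →
        BranchedRDE.IsSolution p f X φ →
        ∀ z : ℝ, -1 < z → z ≤ 0 →
          ‖φ z‖ ≤ C *
            (((BranchedRDE.weightedNorm (BranchedRDE.level γ) η q f).toReal *
                (X.homNorm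
                  (Set.Icc (z - BranchedRDE.localScale C α z (φ z)) z)).toReal) ^
                (1 / (γ + γ / α - q * (1 - γ) - η))
              + |z + 1| ^ (-α)) := by
  have hp1 : 0 < p - 1 := by linarith
  have hα0 : 0 < α := by rw [hα]; positivity
  have hαinv : 1 / α = p - 1 := by rw [hα, one_div_one_div]
  have hγα : γ / α = γ * (p - 1) := by rw [div_eq_mul_one_div, hαinv]
  have hδ : γ + γ / α - q * (1 - γ) - η = γ * (p + q) - η - q := by rw [hγα]; ring
  have hδ0 : 0 < γ * (p + q) - η - q := by rw [← hδ]; linarith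
  obtain ⟨ε, A, hε, hA, hlen⟩ := BranchedRDE.exists_length_bound m n hγ₀ hγ₁ hp hq hδ0
  rw [hδ]
  set δ := γ * (p + q) - η - q
  -- A lower bound for the constant: `C ≥ 2` gives `|φ z| ≥ 2`, the power of `1 / ε` makes the noise
  -- small, and the other two terms make both parts of the local scale longer than allowed.
  set C : ℝ := 2 + A + (2 * A) ^ α + (1 / ε) ^ (1 / δ) with hC
  have hC₁ : 0 < (2 * A) ^ α := by positivity
  have hC₂ : 0 < (1 / ε) ^ (1 / δ) := by positivity
  have hC0 : 0 < C := by positivity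
  refine ⟨C, hC0, fun f X φ hf hw hsol z hz₁ hz₀ => ?_⟩
  by_contra! hlt
  set F := (BranchedRDE.weightedNorm (BranchedRDE.level γ) η q f).toReal
  set lam := BranchedRDE.localScale C α z (φ z) with hlam
  set H := (X.homNorm (Set.Icc (z - lam) z)).toReal
  have hF : 0 ≤ F := ENNReal.toReal_nonneg
  have hH : 0 ≤ H := ENNReal.toReal_nonneg
  have hzpos : 0 < z + 1 := by linarith
  rw [abs_of_pos hzpos] at hlt
  have ht₁ : 0 ≤ (F * H) ^ (1 / δ) := by positivity
  have ht₂ : 0 < (z + 1) ^ (-α) := by positivity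
  have hM₁ : C * (F * H) ^ (1 / δ) < ‖φ z‖ :=
    lt_of_le_of_lt (by gcongr; linarith) hlt
  have hM₂ : C * (z + 1) ^ (-α) < ‖φ z‖ :=
    lt_of_le_of_lt (by gcongr; linarith) hlt
  have hone : 1 ≤ (z + 1) ^ (-α) :=
    Real.one_le_rpow_of_pos_of_le_one_of_nonpos hzpos (by linarith) (by linarith)
  have hM : 2 ≤ ‖φ z‖ := by nlinarith
  have hM0 : 0 < ‖φ z‖ := by linarith
  have hne : φ z ≠ 0 := norm_pos_iff.1 hM0
  have hlam' : lam = min (C * ‖φ z‖ ^ (-(p - 1))) ((z + 1) / 2) := by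
    rw [hlam, BranchedRDE.localScale, if_neg hne, hαinv, abs_of_pos hzpos]
  have hlam_le : lam ≤ (z + 1) / 2 := by rw [hlam']; exact min_le_right _ _
  have hpow0 : 0 < ‖φ z‖ ^ (-(p - 1)) := by positivity
  have hlam_gt : A * ‖φ z‖ ^ (-(p - 1)) < lam := by
    rw [hlam', lt_min_iff]
    constructor
    · gcongr
      linarith
    · have h₁ : (2 * A) ^ α * (z + 1) ^ (-α) < ‖φ z‖ :=
        lt_of_le_of_lt (by gcongr; linarith) hM₂
      have h₂ : ‖φ z‖ ^ (-(p - 1)) < ((2 * A) ^ α * (z + 1) ^ (-α)) ^ (-(p - 1)) :=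
        Real.rpow_lt_rpow_of_neg (by positivity) h₁ (by linarith)
      have hαp : α * -(p - 1) = -1 := by rw [hα]; field_simp
      have h₃ : ((2 * A) ^ α * (z + 1) ^ (-α)) ^ (-(p - 1)) = (2 * A)⁻¹ * (z + 1) := by
        rw [Real.mul_rpow (by positivity) (by positivity), ← Real.rpow_mul (by positivity),
          ← Real.rpow_mul hzpos.le, neg_mul, hαp, neg_neg, Real.rpow_one, Real.rpow_neg_one]
      rw [h₃] at h₂
      calc A * ‖φ z‖ ^ (-(p - 1)) < A * ((2 * A)⁻¹ * (z + 1)) := by gcongr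
        _ = (z + 1) / 2 := by field_simp
  have hsmall : F * H ≤ ε * ‖φ z‖ ^ δ := by
    have h₁ : (1 / ε) ^ (1 / δ) * (F * H) ^ (1 / δ) ≤ ‖φ z‖ :=
      le_trans (by gcongr; linarith) hM₁.le
    rw [← Real.mul_rpow (by positivity) (by positivity)] at h₁
    have h₂ := Real.rpow_le_rpow (by positivity) h₁ hδ0.le
    rw [← Real.rpow_mul (by positivity), one_div_mul_cancel hδ0.ne', Real.rpow_one] at h₂
    calc F * H = ε * (1 / ε * (F * H)) := by field_simp
      _ ≤ ε * ‖φ z‖ ^ δ := by gcongr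
  have hlam0 : 0 < lam := lt_trans (by positivity) hlam_gt
  have := hlen f X φ hf hw hsol (z - lam) z (by linarith) (by linarith) hz₀ hM hsmall
  linarith
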